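/- Let $n\ge 1$, let $S^{n+1}\subset\mathbb R^{n+2}$ be the unit sphere and $\langle\cdot,\cdot\rangle$ the Euclidean scalar product. Let $M_0$ be a closed (compact, Hausdorff, without boundary), connected $n$-dimensional manifold of class $C^2$, and let $x:M_0\to S^{n+1}$ be an immersion of class $C^2$ which is strictly convex: at every point the second fundamental form is positive definite with respect to one of the two unit normals $\nu$, that is, $-\langle x_{ij},\nu\rangle v^iv^j>0$ for all $v\neq 0$. If $n=1$, assume in addition that $x$ is injective. Put $M=x(M_0)$. A *convex body* of $S^{n+1}$ is a closed set with nonempty interior which is contained in an open hemisphere and contains, with any two of its points, the minimizing geodesic arc between them; it is a *convex body of* a set $A\subset S^{n+1}$ if its boundary in $S^{n+1}$ is $A$. Then: 1. $M$ has exactly one convex body, denoted $\hat M$. 2. At every $p\in M_0$ there is exactly one unit normal $\tilde x(p)\in T_{x(p)}S^{n+1}\subset\mathbb R^{n+2}$ of the hypersurface that is exterior to $\hat M$, i.e. such that $\cos t\,x(p)+\sin t\,\tilde x(p)\notin\hat M$ for all small $t>0$. Regarded as a map $\tilde x:M_0\to S^{n+1}$ it is called the Gauss map; put $\tilde M=\tilde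 x(M_0)$. 3. $\tilde M$ has exactly one convex body, denoted $\hat{\tilde M}$. 4. The polar set $M^*=\{y\in S^{n+1}:\sup_{z\in M}\langle z,y\rangle=0\}$ satisfies $M^*=\tilde M$. 5. The polar $\hat M^*=\{y\in S^{n+1}:\sup_{z\in\hat M}\langle z,y\rangle\le 0\}$ of $\hat M$ satisfies $\hat M^*=\hat{\tilde M}$. -/

import Mathlib

open scoped Manifold ContDiff Topology

noncomputable section

namespace SphereGeom

/-- The Euclidean space `ℝ^{n+2}`. -/
abbrev Ambient (n : ℕ) : Type := EuclideanSpace ℝ (Fin (n + 2))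

/-- The unit sphere `S^{n+1} ⊂ ℝ^{n+2}`, with the subspace topology. -/
abbrev Sph (n : ℕ) : Type := Metric.sphere (0 : Ambient n) 1

section Hypersurface

variable {n : ℕ} {M₀ : Type*} [TopologicalSpace M₀]
  [ChartedSpace (EuclideanSpace ℝ (Fin n)) M₀]

/-- `x : M₀ → S^{n+1}`, viewed as a map into `ℝ^{n+2}`. -/
def toAmbient (x : M₀ → Sph n) (p : M₀) : Ambient n := (x p : Ambient n)

/-- `x` is an immersion of class `C^2`. Being `C^2` as a map into the submanifold `S^{n+1}`
and as a map into `ℝ^{n+2}` is the same thing. -/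
structure IsC2Immersion (x : M₀ → Sph n) : Prop where
  contMDiff : ContMDiff (𝓡 n) 𝓘(ℝ, Ambient n) 2 (toAmbient x)
  injective_mfderiv : ∀ p : M₀,
    Function.Injective (mfderiv (𝓡 n) 𝓘(ℝ, Ambient n) (toAmbient x) p)

/-- `ν` is a unit normal of the hypersurface `x` at `p`: a unit vector, tangent to the sphere at
`x p` and orthogonal to the image of the differential of `x` at `p`. -/
def IsUnitNormal (x : M₀ → Sph n) (p : M₀) (ν : Sph n) : Prop :=
  inner ℝ (ν : Ambient n) (x p : Ambient n) = 0 ∧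
  ∀ v : TangentSpace (𝓡 n) p,
    inner ℝ (ν : Ambient n) (mfderiv (𝓡 n) 𝓘(ℝ, Ambient n) (toAmbient x) p v : Ambient n) = 0

/-- The map `x` in the preferred chart of `M₀` around `p`. -/
def inChart (x : M₀ → Sph n) (p : M₀) (u : EuclideanSpace ℝ (Fin n)) : Ambient n :=
  toAmbient x ((chartAt (EuclideanSpace ℝ (Fin n)) p).symm u)

/-- The second fundamental form at `p` belonging to a unit normal `ν`, with the sign convention
`x_{ij} = - g_{ij} x - h_{ij} ν`, that is `h_{ij} = - ⟨x_{ij}, ν⟩`. The Christoffel terms in the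
covariant second derivative `x_{ij}` are tangential, hence orthogonal to `ν`, so partial
derivatives may be used and the form does not depend on the chart. -/
def secondFundForm (x : M₀ → Sph n) (p : M₀) (ν : Sph n) (v w : EuclideanSpace ℝ (Fin n)) : ℝ :=
  - inner ℝ
      (fderiv ℝ (fderiv ℝ (inChart x p)) (chartAt (EuclideanSpace ℝ (Fin n)) p p) v w)
      (ν : Ambient n)

/-- Strict convexity: at every point the second fundamental form is positive definite for one of
the two unit normals (equivalently, it is definite). -/
def IsStrictlyConvex (x : M₀ → Sph n) : Prop :=
  ∀ p : M₀, ∃ ν : Sph n, IsUnitNormal x p ν ∧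
    ∀ v : EuclideanSpace ℝ (Fin n), v ≠ 0 → 0 < secondFundForm x p ν v v

/-- `ν` is the exterior unit normal at `p` with respect to the body `K`: a unit normal such that
the geodesic `t ↦ cos t • x p + sin t • ν` starting at `x p` in direction `ν` lies outside `K`
for all small `t > 0`. -/
def IsExteriorNormal (x : M₀ → Sph n) (K : Set (Sph n)) (p : M₀) (ν : Sph n) : Prop :=
  IsUnitNormal x p ν ∧
  ∀ᶠ t in 𝓝[>] (0 : ℝ),
    Real.cos t • (x p : Ambient n) + Real.sin t • (ν : Ambient n) ∉
      ((fun y : Sph n => (y : Ambient n)) '' K)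

/-- `xt : M₀ → S^{n+1}` is the Gauss map of a hypersurface `x` bounding the body `K`: it sends
each `p` to the exterior unit normal at `p`, regarded as a point of the unit sphere. -/
def IsGaussMap (x : M₀ → Sph n) (K : Set (Sph n)) (xt : M₀ → Sph n) : Prop :=
  ∀ p : M₀, IsExteriorNormal x K p (xt p)

end Hypersurface

section Bodies

variable {n : ℕ}

/-- `K` is a convex body of the sphere: closed, with nonempty interior, contained in an open
hemisphere, and containing with any two points the minimizing geodesic arc between them.
For two non-antipodal points `u`, `v` this arc consists of the unit vectors `a u + b v` with
`a, b ≥ 0`; points of an open hemisphere are never antipodal. -/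
structure IsConvexBody (K : Set (Sph n)) : Prop where
  isClosed : IsClosed K
  interior_nonempty : (interior K).Nonempty
  hemisphere : ∃ e : Sph n, ∀ y ∈ K, 0 < inner ℝ (y : Ambient n) (e : Ambient n)
  geodesic_mem : ∀ u ∈ K, ∀ v ∈ K, ∀ a b : ℝ, 0 ≤ a → 0 ≤ b → ∀ w : Sph n,
    (w : Ambient n) = a • (u : Ambient n) + b • (v : Ambient n) → w ∈ K

/-- `K` is a convex body of `M`: a convex body of the sphere whose boundary in the sphere
is `M`. -/
def IsConvexBodyOf (K M : Set (Sph n)) : Prop := IsConvexBody K ∧ frontier K = M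

/-- The polar set `{y | sup_{x ∈ M} ⟨x, y⟩ = 0}`. -/
def polarSet (M : Set (Sph n)) : Set (Sph n) :=
  {y | IsLUB ((fun x : Sph n => inner ℝ (x : Ambient n) (y : Ambient n)) '' M) 0}

/-- The polar `{y | sup_{x ∈ K} ⟨x, y⟩ ≤ 0}` of a body `K`. -/
def polarBody (K : Set (Sph n)) : Set (Sph n) :=
  {y | ∀ x ∈ K, inner ℝ (x : Ambient n) (y : Ambient n) ≤ 0}

end Bodies

end SphereGeom

end

/-! Let ν be the unit normal for which the second fundamental form is positive definite. It is
continuous, and near p the hypersurface lies on the negative side of its tangent great sphere at p,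
touching it only at p. The core is the global version: ⟨x q, ν p⟩ < 0 for all p ≠ q
(`IsConvexNormal.height_neg` for n ≥ 2, `IsConvexNormal.height_neg_of_injective` for n = 1).

For n ≥ 2 a hemisphere is turned about a fixed p₀: its pole is cos θ ν p₀ + sin θ x p₀ with 0 ≤ θ <
π, and D_θ is the component of p₀ in the part of M₀ mapped into it. "Any two distinct points of D_θ
lie strictly inside each other's tangent hemispheres" is a closed condition on θ. It is also open,
because strictness passes to the closure of D_θ (`IsConvexNormal.closure_subset_strictPairs`) and
the strict pairs form an open set. To pass to the closure, three kinds of contact are excluded: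
antipodal points, double points, and a point x q ≠ ±x p on the tangent sphere at p; in the last case
p can be moved inside D_θ so that x q gets outside the tangent hemisphere. Finally the closure of
D_θ is all of M₀ for some θ < π. Otherwise its boundary points accumulate, as θ → π, at a point of
the tangent sphere at p₀ other than x p₀, and tangent spheres near p₀ exclude this.

For n = 1 the curve is a single periodic orbit of its unit tangent field. If it met the tangent
great circle at X 0 again within a period, then the forward and the backward arc from X 0 up to
their first returns would cross in central projection, against injectivity
(`IsConvexFrame.inner_neg_zero`).

The strict inequality is symmetric under exchange of x and ν, and both (x, ν) and (ν, x) satisfy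
`IsSupportPair`. The body of x is the intersection of the hemispheres ⟨y, ν p⟩ ≤ 0, that of ν the
intersection of the hemispheres ⟨y, x p⟩ ≤ 0. Uniqueness and the polar of the body rest on the fact
that a convex body is the union of the arcs joining its boundary points. -/

noncomputable section

namespace SphereGeom

/-- The model space of the hypersurface. -/
abbrev Coord (n : ℕ) : Type := EuclideanSpace ℝ (Fin n)

/-! ### Change of charts for the immersion -/

section Charts

variable {n : ℕ} {M₀ : Type*} [TopologicalSpace M₀]
  [ChartedSpace (EuclideanSpace ℝ (Fin n)) M₀] {x : M₀ → Sph n}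

theorem IsC2Immersion.continuous (hx : IsC2Immersion x) : Continuous x :=
  continuous_induced_rng.2 hx.contMDiff.continuous

theorem IsC2Immersion.contDiffOn_inChart [IsManifold (𝓡 n) 2 M₀] (hx : IsC2Immersion x) (p : M₀) :
    ContDiffOn ℝ 2 (inChart x p) (chartAt (Coord n) p).target := by
  rw [← contMDiffOn_iff_contDiffOn]
  exact hx.contMDiff.comp_contMDiffOn contMDiffOn_chart_symm

theorem inChart_apply (p : M₀) {q : M₀} (hq : q ∈ (chartAt (Coord n) p).source) :
    inChart x p (chartAt (Coord n) p q) = x q := by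
  simp [inChart, toAmbient, (chartAt (Coord n) p).left_inv hq]

theorem IsC2Immersion.mfderiv_eq [IsManifold (𝓡 n) 2 M₀] (hx : IsC2Immersion x) (q : M₀) :
    mfderiv (𝓡 n) 𝓘(ℝ, Ambient n) (toAmbient x) q =
      fderiv ℝ (inChart x q) (chartAt (Coord n) q q) := by
  have h : MDifferentiableAt (𝓡 n) 𝓘(ℝ, Ambient n) (toAmbient x) q :=
    (hx.contMDiff q).mdifferentiableAt (by norm_num)
  rw [h.mfderiv]
  simp only [modelWithCornersSelf_coe, Set.range_id, fderivWithin_univ]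
  rfl

/-- The coordinate change between the preferred charts at `p` and `q`. -/
def chartChange (p q : M₀) (u : Coord n) : Coord n :=
  chartAt (Coord n) q ((chartAt (Coord n) p).symm u)

theorem contDiffAt_chartChange [IsManifold (𝓡 n) 2 M₀] (p q : M₀) {r : M₀}
    (hp : r ∈ (chartAt (Coord n) p).source)
    (hq : r ∈ (chartAt (Coord n) q).source) :
    ContDiffAt ℝ 2 (chartChange p q) (chartAt (Coord n) p r) := by
  rw [← contMDiffAt_iff_contDiffAt]
  have h1 := (contMDiffOn_chart_symm (I := 𝓡 n) (n := 2) (x := p)).contMDiffAt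
    ((chartAt (Coord n) p).open_target.mem_nhds
      ((chartAt (Coord n) p).map_source hp))
  have h2 := (contMDiffOn_chart (I := 𝓡 n) (n := 2) (x := q)).contMDiffAt
    ((chartAt (Coord n) q).open_source.mem_nhds hq)
  rw [← (chartAt (Coord n) p).left_inv hp] at h2
  exact ContMDiffAt.comp _ h2 h1

theorem inChart_eventuallyEq (x : M₀ → Sph n) (p q : M₀) {r : M₀}
    (hp : r ∈ (chartAt (Coord n) p).source)
    (hq : r ∈ (chartAt (Coord n) q).source) :
    inChart x p =ᶠ[𝓝 (chartAt (Coord n) p r)]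
      inChart x q ∘ chartChange p q := by
  have hc : ContinuousAt (chartAt (Coord n) p).symm
      (chartAt (Coord n) p r) :=
    (chartAt (Coord n) p).continuousAt_symm
      ((chartAt (Coord n) p).map_source hp)
  have hs : (chartAt (Coord n) q).source ∈
      𝓝 ((chartAt (Coord n) p).symm (chartAt (Coord n) p r)) := by
    rw [(chartAt (Coord n) p).left_inv hp]
    exact (chartAt (Coord n) q).open_source.mem_nhds hq
  filter_upwards [hc hs] with u hu
  simp only [inChart, Function.comp, chartChange]
  rw [(chartAt (Coord n) q).left_inv hu]

theorem chartChange_apply (p q : M₀) {r : M₀}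
    (hp : r ∈ (chartAt (Coord n) p).source) :
    chartChange p q (chartAt (Coord n) p r) =
      chartAt (Coord n) q r := by
  simp [chartChange, (chartAt (Coord n) p).left_inv hp]

theorem fderiv_chartChange_comp [IsManifold (𝓡 n) 2 M₀] (p q : M₀) {r : M₀}
    (hp : r ∈ (chartAt (Coord n) p).source)
    (hq : r ∈ (chartAt (Coord n) q).source)
    (v : Coord n) :
    fderiv ℝ (chartChange q p) (chartAt (Coord n) q r)
      (fderiv ℝ (chartChange p q) (chartAt (Coord n) p r) v) = v := by
  have h1 := (contDiffAt_chartChange p q hp hq).differentiableAt (by norm_num)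
  have h2 := (contDiffAt_chartChange q p hq hp).differentiableAt (by norm_num)
  rw [← chartChange_apply p q hp] at h2
  have h3 : chartChange q p ∘ chartChange p q =ᶠ[𝓝 (chartAt (Coord n) p r)] id := by
    have hc : ContinuousAt (chartAt (Coord n) p).symm
        (chartAt (Coord n) p r) :=
      (chartAt (Coord n) p).continuousAt_symm
        ((chartAt (Coord n) p).map_source hp)
    have hs : (chartAt (Coord n) q).source ∈ 𝓝
        ((chartAt (Coord n) p).symm (chartAt (Coord n) p r)) := by
      rw [(chartAt (Coord n) p).left_inv hp]
      exact (chartAt (Coord n) q).open_source.mem_nhds hq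
    filter_upwards [hc hs, (chartAt (Coord n) p).open_target.mem_nhds
      ((chartAt (Coord n) p).map_source hp)] with u hu hu'
    simp only [Function.comp, chartChange, id]
    rw [(chartAt (Coord n) q).left_inv hu,
      (chartAt (Coord n) p).right_inv hu']
  have h4 := h3.fderiv_eq (𝕜 := ℝ)
  rw [fderiv_comp _ h2 h1, fderiv_id, chartChange_apply p q hp] at h4
  exact DFunLike.congr_fun h4 v

theorem IsC2Immersion.fderiv_inChart [IsManifold (𝓡 n) 2 M₀] (hx : IsC2Immersion x) (p q : M₀)
    {r : M₀} (hp : r ∈ (chartAt (Coord n) p).source)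
    (hq : r ∈ (chartAt (Coord n) q).source) (v : Coord n) :
    fderiv ℝ (inChart x p) (chartAt (Coord n) p r) v =
      fderiv ℝ (inChart x q) (chartAt (Coord n) q r)
        (fderiv ℝ (chartChange p q) (chartAt (Coord n) p r) v) := by
  have h1 := (contDiffAt_chartChange p q hp hq).differentiableAt (by norm_num)
  have h2 : DifferentiableAt ℝ (inChart x q) (chartAt (Coord n) q r) :=
    ((hx.contDiffOn_inChart q).contDiffAt
      ((chartAt (Coord n) q).open_target.mem_nhds
        ((chartAt (Coord n) q).map_source hq))).differentiableAt (by norm_num)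
  rw [← chartChange_apply p q hp] at h2
  rw [(inChart_eventuallyEq x p q hp hq).fderiv_eq, fderiv_comp _ h2 h1, chartChange_apply p q hp]
  rfl

end Charts

/-! ### Unit normals and the second fundamental form in arbitrary charts -/

section LocalGeometry

variable {n : ℕ} {M₀ : Type*} [TopologicalSpace M₀]
  [ChartedSpace (EuclideanSpace ℝ (Fin n)) M₀] {x ν : M₀ → Sph n}

/-- `ν` assigns to each point the unit normal for which the second fundamental form is positive
definite. -/
structure IsConvexNormal (x ν : M₀ → Sph n) : Prop where
  unitNormal : ∀ p, IsUnitNormal x p (ν p)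
  pos : ∀ p, ∀ v : Coord n, v ≠ 0 → 0 < secondFundForm x p (ν p) v v

theorem inner_self_sph (y : Sph n) : inner ℝ (y : Ambient n) (y : Ambient n) = 1 := by
  rw [real_inner_self_eq_norm_sq]
  simp

theorem norm_sph (y : Sph n) : ‖(y : Ambient n)‖ = 1 := by simp

variable [IsManifold (𝓡 n) 2 M₀]

theorem IsC2Immersion.contDiffAt_inChart (hx : IsC2Immersion x) {p q : M₀}
    (hq : q ∈ (chartAt (Coord n) p).source) :
    ContDiffAt ℝ 2 (inChart x p) (chartAt (Coord n) p q) :=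
  (hx.contDiffOn_inChart p).contDiffAt
    ((chartAt (Coord n) p).open_target.mem_nhds ((chartAt (Coord n) p).map_source hq))

theorem IsC2Immersion.fderiv_injective (hx : IsC2Immersion x) {p q : M₀}
    (hq : q ∈ (chartAt (Coord n) p).source) :
    Function.Injective (fderiv ℝ (inChart x p) (chartAt (Coord n) p q)) := by
  rw [injective_iff_map_eq_zero]
  intro v hv
  have hqq := mem_chart_source (Coord n) q
  rw [hx.fderiv_inChart p q hq hqq] at hv
  have h0 : Function.Injective (fderiv ℝ (inChart x q) (chartAt (Coord n) q q)) := by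
    have := hx.injective_mfderiv q
    rw [hx.mfderiv_eq] at this
    exact this
  have h1 : fderiv ℝ (chartChange p q) (chartAt (Coord n) p q) v = 0 := by
    apply h0
    rw [hv, map_zero]
  rw [← fderiv_chartChange_comp p q hq hqq v, h1, map_zero]

theorem IsC2Immersion.isUnitNormal_iff (hx : IsC2Immersion x) {p q : M₀}
    (hq : q ∈ (chartAt (Coord n) p).source) (μ : Sph n) :
    IsUnitNormal x q μ ↔ inner ℝ (μ : Ambient n) (x q : Ambient n) = 0 ∧ ∀ v : Coord n,
      inner ℝ (μ : Ambient n) (fderiv ℝ (inChart x p) (chartAt (Coord n) p q) v) = 0 := by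
  have hqq := mem_chart_source (Coord n) q
  have h0 : IsUnitNormal x q μ ↔ inner ℝ (μ : Ambient n) (x q : Ambient n) = 0 ∧ ∀ v : Coord n,
      inner ℝ (μ : Ambient n) (fderiv ℝ (inChart x q) (chartAt (Coord n) q q) v) = 0 := by
    unfold IsUnitNormal
    rw [hx.mfderiv_eq]
    exact Iff.rfl
  rw [h0]
  refine and_congr_right fun _ => ⟨fun h v => ?_, fun h v => ?_⟩
  · rw [hx.fderiv_inChart p q hq hqq]
    exact h _
  · have := h (fderiv ℝ (chartChange q p) (chartAt (Coord n) q q) v)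
    rwa [← hx.fderiv_inChart q p hqq hq] at this

theorem IsC2Immersion.inner_fderiv_self (hx : IsC2Immersion x) {p q : M₀}
    (hq : q ∈ (chartAt (Coord n) p).source) (v : Coord n) :
    inner ℝ (x q : Ambient n) (fderiv ℝ (inChart x p) (chartAt (Coord n) p q) v) = 0 := by
  have hd := ((hx.contDiffAt_inChart hq).differentiableAt (by norm_num)).hasFDerivAt
  have h1 := hd.inner ℝ hd
  have h2 : (fun u => inner ℝ (inChart x p u) (inChart x p u)) = fun _ => (1 : ℝ) := by
    funext u
    exact inner_self_sph _
  rw [h2] at h1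
  have h3 := DFunLike.congr_fun (h1.unique (hasFDerivAt_const 1 _)) v
  simpa [inChart_apply p hq, real_inner_comm] using h3

theorem IsC2Immersion.differentiableAt_fderiv (hx : IsC2Immersion x) {p q : M₀}
    (hq : q ∈ (chartAt (Coord n) p).source) :
    DifferentiableAt ℝ (fderiv ℝ (inChart x p)) (chartAt (Coord n) p q) :=
  ((hx.contDiffAt_inChart hq).fderiv_right (m := 1) (by norm_num)).differentiableAt (by norm_num)

/-- A change of chart adds to the second derivative a term in the image of the differential, which ν
annihilates. So definiteness, assumed only in the preferred chart at `q`, holds in every preferred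
chart around `q`. -/
theorem IsConvexNormal.second_neg (hν : IsConvexNormal x ν) (hx : IsC2Immersion x) {p q : M₀}
    (hq : q ∈ (chartAt (Coord n) p).source) {v : Coord n} (hv : v ≠ 0) :
    inner ℝ (fderiv ℝ (fderiv ℝ (inChart x p)) (chartAt (Coord n) p q) v v) (ν q : Ambient n)
      < 0 := by
  have hqq := mem_chart_source (Coord n) q
  set u := chartAt (Coord n) p q with hu
  set τ : Coord n → Coord n := chartChange p q with hτ
  have hτu : τ u = chartAt (Coord n) q q := chartChange_apply p q hq
  have hτ2 := contDiffAt_chartChange p q hq hqq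
  have hτ1 := (hτ2.differentiableAt (by norm_num)).hasFDerivAt
  have hτ3 := ((hτ2.fderiv_right (m := 1) (by norm_num)).differentiableAt (by norm_num)).hasFDerivAt
  have hfq := (hx.differentiableAt_fderiv hqq).hasFDerivAt
  rw [← hτu] at hfq
  have hcomp : HasFDerivAt (fun u' => fderiv ℝ (inChart x q) (τ u')) _ u := hfq.comp u hτ1
  have hcl := hcomp.clm_comp hτ3
  have heq : fderiv ℝ (inChart x p) =ᶠ[𝓝 u]
      fun u' => (fderiv ℝ (inChart x q) (τ u')).comp (fderiv ℝ τ u') := by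
    have hsrc : ∀ᶠ u' in 𝓝 u, (chartAt (Coord n) p).symm u' ∈ (chartAt (Coord n) q).source := by
      have hc : ContinuousAt (chartAt (Coord n) p).symm u :=
        (chartAt (Coord n) p).continuousAt_symm ((chartAt (Coord n) p).map_source hq)
      apply hc
      rw [(chartAt (Coord n) p).left_inv hq]
      exact (chartAt (Coord n) q).open_source.mem_nhds hqq
    filter_upwards [hsrc, (chartAt (Coord n) p).open_target.mem_nhds
      ((chartAt (Coord n) p).map_source hq)] with u' h1 h2
    ext1 w
    have := hx.fderiv_inChart p q ((chartAt (Coord n) p).map_target h2) h1 w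
    rw [(chartAt (Coord n) p).right_inv h2] at this
    rw [this]
    rfl
  rw [heq.fderiv_eq, hcl.fderiv]
  have hw : fderiv ℝ τ u v ≠ 0 := by
    intro h
    apply hv
    rw [← fderiv_chartChange_comp p q hq hqq v, ← hu, ← hτ, h, map_zero]
  have hpos := hν.pos q _ hw
  have horth := ((hx.isUnitNormal_iff hqq (ν q)).1 (hν.unitNormal q)).2
    (fderiv ℝ (fderiv ℝ τ) u v v)
  rw [secondFundForm] at hpos
  simp only [add_apply, ContinuousLinearMap.comp_apply,
    ContinuousLinearMap.compL_apply, ContinuousLinearMap.flip_apply, hτu, inner_add_left]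
  rw [real_inner_comm] at horth
  linarith

end LocalGeometry

/-! ### The frame of position, tangent space and normal; continuity of the normal -/

section NormalFrame

variable {n : ℕ} {M₀ : Type*} [TopologicalSpace M₀]
  [ChartedSpace (EuclideanSpace ℝ (Fin n)) M₀] {x ν : M₀ → Sph n}

/-- The differential of `x` at `p` in the preferred chart. -/
def jac (x : M₀ → Sph n) (p : M₀) : Coord n →L[ℝ] Ambient n :=
  fderiv ℝ (inChart x p) (chartAt (Coord n) p p)

/-- The second derivative of `x` at `p` in the preferred chart. -/
def hess (x : M₀ → Sph n) (p : M₀) : Coord n →L[ℝ] Coord n →L[ℝ] Ambient n :=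
  fderiv ℝ (fderiv ℝ (inChart x p)) (chartAt (Coord n) p p)

theorem IsConvexNormal.hess_neg (hν : IsConvexNormal x ν) (p : M₀) {v : Coord n} (hv : v ≠ 0) :
    inner ℝ (hess x p v v) (ν p : Ambient n) < 0 := by
  have := hν.pos p v hv
  rw [secondFundForm] at this
  exact neg_pos.1 this

theorem IsConvexNormal.inner_self (hν : IsConvexNormal x ν) (p : M₀) :
    inner ℝ (x p : Ambient n) (ν p : Ambient n) = 0 := by
  rw [real_inner_comm]
  exact (hν.unitNormal p).1

theorem IsStrictlyConvex.exists_convexNormal (h : IsStrictlyConvex x) :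
    ∃ ν : M₀ → Sph n, IsConvexNormal x ν := by
  choose ν h1 h2 using h
  exact ⟨ν, h1, h2⟩

theorem continuousAt_chart_center (p : M₀) : ContinuousAt (chartAt (Coord n) p) p :=
  (chartAt (Coord n) p).continuousAt (mem_chart_source _ p)

theorem chart_source_mem_nhds (p : M₀) : (chartAt (Coord n) p).source ∈ 𝓝 p :=
  (chartAt (Coord n) p).open_source.mem_nhds (mem_chart_source _ p)

variable [IsManifold (𝓡 n) 2 M₀]

theorem IsC2Immersion.jac_injective (hx : IsC2Immersion x) (p : M₀) :
    Function.Injective (jac x p) :=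
  hx.fderiv_injective (mem_chart_source (Coord n) p)

theorem IsC2Immersion.isUnitNormal_iff_jac (hx : IsC2Immersion x) (p : M₀) (μ : Sph n) :
    IsUnitNormal x p μ ↔ inner ℝ (μ : Ambient n) (x p : Ambient n) = 0 ∧ ∀ v : Coord n,
      inner ℝ (μ : Ambient n) (jac x p v) = 0 :=
  hx.isUnitNormal_iff (mem_chart_source (Coord n) p) μ

theorem IsC2Immersion.inner_jac_self (hx : IsC2Immersion x) (p : M₀) (v : Coord n) :
    inner ℝ (x p : Ambient n) (jac x p v) = 0 :=
  hx.inner_fderiv_self (mem_chart_source (Coord n) p) v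

/-- A point, the tangent space at the point and a unit normal span the ambient space. -/
theorem IsC2Immersion.exists_decomposition (hx : IsC2Immersion x) {p : M₀} {μ : Sph n}
    (hμ : IsUnitNormal x p μ) (y : Ambient n) :
    ∃ (a : ℝ) (V : Coord n) (b : ℝ),
      y = a • (x p : Ambient n) + jac x p V + b • (μ : Ambient n) := by
  obtain ⟨h1, h2⟩ := (hx.isUnitNormal_iff_jac p μ).1 hμ
  have h1' := real_inner_comm (μ : Ambient n) (x p : Ambient n)
  rw [h1] at h1'
  let T : (ℝ × Coord n × ℝ) →ₗ[ℝ] Ambient n :=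
    (LinearMap.toSpanSingleton ℝ _ (x p : Ambient n)).coprod
      ((jac x p : Coord n →ₗ[ℝ] Ambient n).coprod (LinearMap.toSpanSingleton ℝ _ (μ : Ambient n)))
  have hT : ∀ a V b, T (a, V, b) = a • (x p : Ambient n) + jac x p V + b • (μ : Ambient n) := by
    intro a V b
    simp [T, add_assoc]
  have hinj : Function.Injective T := by
    rw [injective_iff_map_eq_zero]
    rintro ⟨a, V, b⟩ h
    rw [hT] at h
    have e1 := congrArg (fun z => inner ℝ (x p : Ambient n) z) h
    have e2 := congrArg (fun z => inner ℝ (μ : Ambient n) z) h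
    simp only [inner_add_right, inner_smul_right, inner_self_sph, hx.inner_jac_self, h1, h1', h2,
      inner_zero_right] at e1 e2
    have ha : a = 0 := by linarith
    have hb : b = 0 := by linarith
    subst ha hb
    have hV : V = 0 := by
      apply hx.jac_injective p
      simpa using h
    simp [hV]
  -- The dimensions agree, 1 + n + 1 = n + 2, so injectivity suffices.
  have hsurj : Function.Surjective T := by
    rw [← LinearMap.injective_iff_surjective_of_finrank_eq_finrank (f := T)]
    · exact hinj
    · simp
      omega
  obtain ⟨⟨a, V, b⟩, h⟩ := hsurj y
  exact ⟨a, V, b, by rw [← hT, h]⟩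

theorem IsC2Immersion.exists_tangent_decomposition (hx : IsC2Immersion x) {p : M₀} {μ : Sph n}
    (hμ : IsUnitNormal x p μ) {y : Ambient n} (hy : inner ℝ y (μ : Ambient n) = 0) :
    ∃ (a : ℝ) (V : Coord n), y = a • (x p : Ambient n) + jac x p V := by
  obtain ⟨h1, h2⟩ := (hx.isUnitNormal_iff_jac p μ).1 hμ
  obtain ⟨a, V, b, h⟩ := hx.exists_decomposition hμ y
  have e := congrArg (fun z => inner ℝ (μ : Ambient n) z) h
  simp only [inner_add_right, inner_smul_right, inner_self_sph, h1, h2] at e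
  rw [real_inner_comm, hy] at e
  have hb : b = 0 := by linarith
  exact ⟨a, V, by rw [h, hb]; simp⟩

/-- A vector orthogonal to the hypersurface is a multiple of the unit normal. -/
theorem IsC2Immersion.eq_smul_normal (hx : IsC2Immersion x) {p : M₀} {μ : Sph n}
    (hμ : IsUnitNormal x p μ) {y : Ambient n} (hy : inner ℝ y (x p : Ambient n) = 0)
    (hy' : ∀ v, inner ℝ y (jac x p v) = 0) : ∃ b : ℝ, y = b • (μ : Ambient n) := by
  obtain ⟨h1, h2⟩ := (hx.isUnitNormal_iff_jac p μ).1 hμ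
  obtain ⟨a, V, b, h⟩ := hx.exists_decomposition hμ y
  have e1 := congrArg (fun z => inner ℝ (x p : Ambient n) z) h
  simp only [inner_add_right, inner_smul_right, inner_self_sph, hx.inner_jac_self,
    (real_inner_comm (μ : Ambient n) (x p : Ambient n)).trans h1] at e1
  rw [real_inner_comm, hy] at e1
  have ha : a = 0 := by linarith
  have e2 : inner ℝ y (jac x p V) = inner ℝ (jac x p V) (jac x p V) := by
    conv_lhs => rw [h, ha]
    simp only [inner_add_left, inner_smul_left, h2]
    simp
  rw [hy' V] at e2
  have hV : jac x p V = 0 := inner_self_eq_zero.1 e2.symm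
  exact ⟨b, by rw [h, ha, hV]; simp⟩

theorem IsC2Immersion.unitNormal_eq_or_neg (hx : IsC2Immersion x) {p : M₀} {μ μ' : Sph n}
    (hμ : IsUnitNormal x p μ) (hμ' : IsUnitNormal x p μ') :
    (μ' : Ambient n) = μ ∨ (μ' : Ambient n) = -μ := by
  obtain ⟨h1, h2⟩ := (hx.isUnitNormal_iff_jac p μ').1 hμ'
  obtain ⟨b, hb⟩ := hx.eq_smul_normal hμ h1 h2
  have hn := norm_sph μ'
  rw [hb, norm_smul, norm_sph, mul_one, Real.norm_eq_abs] at hn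
  rcases abs_eq (zero_le_one) |>.1 hn with h | h
  · left; rw [hb, h, one_smul]
  · right; rw [hb, h, neg_one_smul]

theorem IsConvexNormal.inner_jac (hν : IsConvexNormal x ν) (hx : IsC2Immersion x) (p : M₀)
    (v : Coord n) : inner ℝ (ν p : Ambient n) (jac x p v) = 0 :=
  ((hx.isUnitNormal_iff_jac p _).1 (hν.unitNormal p)).2 v

theorem IsC2Immersion.contDiffAt_center (hx : IsC2Immersion x) (p : M₀) :
    ContDiffAt ℝ 2 (inChart x p) (chartAt (Coord n) p p) :=
  hx.contDiffAt_inChart (mem_chart_source (Coord n) p)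

theorem IsC2Immersion.continuousAt_fderiv (hx : IsC2Immersion x) (p : M₀) :
    ContinuousAt (fderiv ℝ (inChart x p)) (chartAt (Coord n) p p) :=
  ((hx.contDiffAt_center p).fderiv_right (m := 1) (by norm_num)).continuousAt

theorem IsC2Immersion.continuousAt_fderiv_fderiv (hx : IsC2Immersion x) (p : M₀) :
    ContinuousAt (fderiv ℝ (fderiv ℝ (inChart x p))) (chartAt (Coord n) p p) :=
  (((hx.contDiffAt_center p).fderiv_right (m := 1) (by norm_num)).fderiv_right (m := 0)
    (by norm_num)).continuousAt

/-- Since ν is determined pointwise, its continuity comes from definiteness. A limit of ν at p is a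
unit normal at p against which the second derivative is negative semidefinite, so it is ±ν p; the
minus sign would contradict definiteness on a nonzero vector, and there is one because n ≥ 1. -/
theorem IsConvexNormal.continuous (hν : IsConvexNormal x ν) (hx : IsC2Immersion x) (hn : 1 ≤ n) :
    Continuous ν := by
  rw [continuous_iff_continuousAt]
  intro p
  rw [ContinuousAt, Filter.tendsto_iff_ultrafilter]
  intro g hg
  have hgp : (g : Filter M₀) ≤ 𝓝 p := hg
  obtain ⟨μ, -, hμ⟩ := isCompact_univ.ultrafilter_le_nhds (g.map ν) (by simp)
  have hμ' : Filter.Tendsto ν g (𝓝 μ) := hμ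
  have hμa : Filter.Tendsto (fun q => (ν q : Ambient n)) g (𝓝 (μ : Ambient n)) :=
    (continuous_subtype_val.tendsto μ).comp hμ'
  have hxg : Filter.Tendsto (fun q => (x q : Ambient n)) g (𝓝 (x p : Ambient n)) :=
    ((continuous_subtype_val.comp hx.continuous).tendsto p).mono_left hgp
  have hcg : Filter.Tendsto (chartAt (Coord n) p) g (𝓝 (chartAt (Coord n) p p)) :=
    (continuousAt_chart_center p).mono_left hgp
  have hsrc : ∀ᶠ q in g, q ∈ (chartAt (Coord n) p).source := hgp (chart_source_mem_nhds p)
  have hN : IsUnitNormal x p μ := by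
    rw [hx.isUnitNormal_iff_jac]
    constructor
    · refine tendsto_nhds_unique (hμa.inner hxg) ?_
      refine tendsto_const_nhds.congr fun q => ?_
      exact (hν.unitNormal q).1.symm
    · intro v
      have h1 : Filter.Tendsto (fun q => fderiv ℝ (inChart x p) (chartAt (Coord n) p q) v) g
          (𝓝 (jac x p v)) :=
        (((hx.continuousAt_fderiv p).clm_apply continuousAt_const).tendsto).comp hcg
      refine tendsto_nhds_unique (hμa.inner h1) ?_
      refine tendsto_const_nhds.congr' ?_
      filter_upwards [hsrc] with q hq
      exact (((hx.isUnitNormal_iff hq _).1 (hν.unitNormal q)).2 v).symm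
  have hle : ∀ v, inner ℝ (hess x p v v) (μ : Ambient n) ≤ 0 := by
    intro v
    have h1 : Filter.Tendsto
        (fun q => fderiv ℝ (fderiv ℝ (inChart x p)) (chartAt (Coord n) p q) v v) g
          (𝓝 (hess x p v v)) :=
      ((((hx.continuousAt_fderiv_fderiv p).clm_apply continuousAt_const).clm_apply
        continuousAt_const).tendsto).comp hcg
    refine le_of_tendsto (h1.inner hμa) ?_
    filter_upwards [hsrc] with q hq
    by_cases hv : v = 0
    · simp [hv]
    · exact (hν.second_neg hx hq hv).le
  have heq : μ = ν p := by
    rcases hx.unitNormal_eq_or_neg (hν.unitNormal p) hN with h | h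
    · exact Subtype.ext h
    · exfalso
      have hv : EuclideanSpace.single (⟨0, hn⟩ : Fin n) (1 : ℝ) ≠ 0 := by
        simp
      have h1 := hle (EuclideanSpace.single (⟨0, hn⟩ : Fin n) (1 : ℝ))
      have h2 := hν.hess_neg p hv
      rw [h, inner_neg_right] at h1
      linarith
  rw [← heq]
  exact hμ'

end NormalFrame

/-- Orthogonality turns ⟨g u₀, N u⟩ into -⟨g u - g u₀, N u⟩, where the increment of g is already of
first order; hence continuity of N is enough. No differentiability of the normal field is needed
anywhere. -/
theorem hasFDerivAt_inner_of_orthogonal {E F : Type*} [NormedAddCommGroup E] [NormedSpace ℝ E]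
    [NormedAddCommGroup F] [InnerProductSpace ℝ F] {N g : E → F} {g' : E →L[ℝ] F} {u₀ : E}
    (hN : ContinuousAt N u₀) (hg : HasFDerivAt g g' u₀)
    (h0 : ∀ᶠ u in 𝓝 u₀, inner ℝ (g u) (N u) = 0) :
    HasFDerivAt (fun u => inner ℝ (g u₀) (N u)) (-((innerSL ℝ (N u₀)).comp g')) u₀ := by
  rw [hasFDerivAt_iff_isLittleO]
  have h00 : inner ℝ (g u₀) (N u₀) = 0 := h0.self_of_nhds
  have h1 : (fun u => inner ℝ (g u - g u₀ - g' (u - u₀)) (N u)) =o[𝓝 u₀] fun u => u - u₀ := by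
    have hb : (fun u => ‖N u‖) =O[𝓝 u₀] fun _ => (1 : ℝ) :=
      (hN.norm.tendsto).isBigO_one ℝ
    have h3 := (hasFDerivAt_iff_isLittleO.1 hg).norm_norm.mul_isBigO hb
    refine (Asymptotics.IsBigO.of_bound 1 (Filter.Eventually.of_forall fun u => ?_)).trans_isLittleO
      (h3.trans_isBigO ?_)
    · rw [one_mul, norm_mul, norm_norm, norm_norm]
      exact norm_inner_le_norm _ _
    · simp only [mul_one]
      exact (Asymptotics.isBigO_refl _ _).norm_left
  have h2 : (fun u => inner ℝ (g' (u - u₀)) (N u - N u₀)) =o[𝓝 u₀] fun u => u - u₀ := by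
    have ha : (fun u => N u - N u₀) =o[𝓝 u₀] fun _ => (1 : ℝ) := by
      rw [Asymptotics.isLittleO_one_iff]
      have := hN.tendsto.sub_const (N u₀)
      rwa [sub_self] at this
    have hb : (fun u => g' (u - u₀)) =O[𝓝 u₀] fun u => u - u₀ := g'.isBigO_comp _ _
    have h3 := hb.norm_norm.mul_isLittleO ha.norm_left
    refine (Asymptotics.IsBigO.of_bound 1 (Filter.Eventually.of_forall fun u => ?_)).trans_isLittleO
      (h3.trans_isBigO ?_)
    · rw [one_mul, norm_mul, norm_norm, norm_norm]
      exact norm_inner_le_norm _ _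
    · simp only [mul_one]
      exact (Asymptotics.isBigO_refl _ _).norm_left
  refine ((h1.add h2).neg_left).congr' ?_ Filter.EventuallyEq.rfl
  filter_upwards [h0] with u hu
  simp only [inner_sub_left, inner_sub_right, hu, h00, neg_apply,
    ContinuousLinearMap.comp_apply, innerSL_apply_apply]
  rw [real_inner_comm (N u₀) (g' (u - u₀))]
  ring

/-! ### Heights over tangent great spheres and their derivatives -/

section Pairs

variable {n : ℕ} {M₀ : Type*} [TopologicalSpace M₀]
  [ChartedSpace (EuclideanSpace ℝ (Fin n)) M₀] {x ν : M₀ → Sph n}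

/-- The height of `x q` over the tangent great sphere at `p`, measured in direction `ν p`. -/
def height (x ν : M₀ → Sph n) (p q : M₀) : ℝ := inner ℝ (x q : Ambient n) (ν p : Ambient n)

/-- The straight ray starting at `p` in direction `V` in the preferred chart at `p`. -/
def chartRay (p : M₀) (V : Coord n) (s : ℝ) : M₀ :=
  (chartAt (Coord n) p).symm (chartAt (Coord n) p p + s • V)

theorem tendsto_ray (u V : Coord n) :
    Filter.Tendsto (fun s : ℝ => u + s • V) (𝓝[>] 0) (𝓝 u) := by
  have h : Continuous fun s : ℝ => u + s • V := by fun_prop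
  have := h.tendsto 0
  simp only [zero_smul, add_zero] at this
  exact this.mono_left nhdsWithin_le_nhds

theorem tendsto_chartAt_symm_center (p : M₀) :
    Filter.Tendsto (chartAt (Coord n) p).symm (𝓝 (chartAt (Coord n) p p)) (𝓝 p) := by
  have := (chartAt (Coord n) p).continuousAt_symm
    ((chartAt (Coord n) p).map_source (mem_chart_source _ p))
  rwa [ContinuousAt, (chartAt (Coord n) p).left_inv (mem_chart_source _ p)] at this

theorem tendsto_chartRay (p : M₀) (V : Coord n) :
    Filter.Tendsto (chartRay p V) (𝓝[>] 0) (𝓝 p) :=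
  (tendsto_chartAt_symm_center p).comp (tendsto_ray _ _)

theorem eventually_chart_target (p : M₀) :
    ∀ᶠ u in 𝓝 (chartAt (Coord n) p p), u ∈ (chartAt (Coord n) p).target :=
  (chartAt (Coord n) p).open_target.mem_nhds
    ((chartAt (Coord n) p).map_source (mem_chart_source _ p))

theorem eventually_chartRay_ne (p : M₀) {V : Coord n} (hV : V ≠ 0) :
    ∀ᶠ s in 𝓝[>] (0 : ℝ), chartRay p V s ≠ p := by
  filter_upwards [(tendsto_ray _ V).eventually (eventually_chart_target p), self_mem_nhdsWithin]
    with s hs hs0 h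
  have h1 : chartAt (Coord n) p (chartRay p V s) = chartAt (Coord n) p p + s • V :=
    (chartAt (Coord n) p).right_inv hs
  rw [h, left_eq_add, smul_eq_zero] at h1
  rcases h1 with h1 | h1
  · exact (ne_of_gt hs0) h1
  · exact hV h1

theorem eventually_pos_ray {E : Type*} [NormedAddCommGroup E] [NormedSpace ℝ E] {g : E → ℝ}
    {L : E →L[ℝ] ℝ} {u V : E} (hg : HasFDerivAt g L u) (hV : 0 < L V) :
    ∀ᶠ s in 𝓝[>] (0 : ℝ), g u < g (u + s • V) := by
  have hl : HasDerivAt (fun s : ℝ => u + s • V) V 0 := by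
    simpa using ((hasDerivAt_id (0 : ℝ)).smul_const V).const_add u
  have hg' : HasFDerivAt g L (u + (0 : ℝ) • V) := by simpa using hg
  have h1 : HasDerivAt (fun s : ℝ => g (u + s • V)) (L V) 0 := hg'.comp_hasDerivAt _ hl
  have h2 := (hasDerivWithinAt_iff_tendsto_slope.1 (h1.hasDerivWithinAt (s := Set.Ioi 0)))
  have h3 : Set.Ioi (0 : ℝ) \ {0} = Set.Ioi 0 := by simp
  rw [h3] at h2
  filter_upwards [h2.eventually (lt_mem_nhds hV), self_mem_nhdsWithin] with s hs hs0
  rw [slope_def_field] at hs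
  have hs0' : (0 : ℝ) < s := hs0
  rw [sub_zero, div_pos_iff_of_pos_right hs0'] at hs
  simpa using hs

/-- A function with positive derivative in direction `V` increases along `chartRay`. -/
theorem eventually_lt_chartRay {p : M₀} {g : M₀ → ℝ} {L : Coord n →L[ℝ] ℝ} {V : Coord n}
    (hg : HasFDerivAt (fun u => g ((chartAt (Coord n) p).symm u)) L (chartAt (Coord n) p p))
    (hV : 0 < L V) : ∀ᶠ s in 𝓝[>] (0 : ℝ), g p < g (chartRay p V s) := by
  have := eventually_pos_ray hg hV
  simpa only [(chartAt (Coord n) p).left_inv (mem_chart_source _ p), chartRay] using this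

theorem inChart_center (x : M₀ → Sph n) (p : M₀) :
    inChart x p (chartAt (Coord n) p p) = x p := inChart_apply p (mem_chart_source _ p)

theorem IsConvexNormal.height_self (hν : IsConvexNormal x ν) (p : M₀) : height x ν p p = 0 :=
  hν.inner_self p

variable [IsManifold (𝓡 n) 2 M₀]

theorem IsC2Immersion.hasFDerivAt_center (hx : IsC2Immersion x) (p : M₀) :
    HasFDerivAt (inChart x p) (jac x p) (chartAt (Coord n) p p) :=
  ((hx.contDiffAt_center p).differentiableAt (by norm_num)).hasFDerivAt

/-- The derivative of a linear function along the hypersurface. -/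
theorem IsC2Immersion.hasFDerivAt_inner (hx : IsC2Immersion x) (p : M₀) (w : Ambient n) :
    HasFDerivAt (fun u => inner ℝ w (x ((chartAt (Coord n) p).symm u) : Ambient n))
      ((innerSL ℝ w).comp (jac x p)) (chartAt (Coord n) p p) :=
  ((innerSL ℝ w).hasFDerivAt).comp _ (hx.hasFDerivAt_center p)

/-- The derivative of the height of a fixed point of the tangent great sphere at `p`, as the
tangent great sphere varies. -/
theorem IsConvexNormal.hasFDerivAt_inner (hν : IsConvexNormal x ν) (hx : IsC2Immersion x)
    (hc : Continuous ν) (p : M₀) {y : Ambient n} {a : ℝ} {Y : Coord n}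
    (hy : y = a • (x p : Ambient n) + jac x p Y) :
    ∃ L : Coord n →L[ℝ] ℝ,
      HasFDerivAt (fun u => inner ℝ y (ν ((chartAt (Coord n) p).symm u) : Ambient n)) L
        (chartAt (Coord n) p p) ∧
      ∀ V, L V = -inner ℝ (hess x p V Y) (ν p : Ambient n) := by
  have hps : (chartAt (Coord n) p).symm (chartAt (Coord n) p p) = p :=
    (chartAt (Coord n) p).left_inv (mem_chart_source _ p)
  have hN : ContinuousAt (fun u => (ν ((chartAt (Coord n) p).symm u) : Ambient n))
      (chartAt (Coord n) p p) := by
    have h1 := (continuous_subtype_val.comp hc).tendsto p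
    rw [ContinuousAt, hps]
    exact h1.comp (tendsto_chartAt_symm_center p)
  have h1 := hasFDerivAt_inner_of_orthogonal hN (hx.hasFDerivAt_center p)
    (Filter.Eventually.of_forall fun u => hν.inner_self _)
  have hD := ((hx.differentiableAt_fderiv (mem_chart_source (Coord n) p)).hasFDerivAt).clm_apply
    (hasFDerivAt_const Y _)
  have h2 := hasFDerivAt_inner_of_orthogonal hN hD (by
    filter_upwards [eventually_chart_target p] with u hu
    have hq := (chartAt (Coord n) p).map_target hu
    have := ((hx.isUnitNormal_iff hq _).1 (hν.unitNormal _)).2 Y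
    rw [(chartAt (Coord n) p).right_inv hu] at this
    rw [real_inner_comm]
    exact this)
  have h3 := (h1.const_mul a).add h2
  refine ⟨_, h3.congr_of_eventuallyEq (Filter.Eventually.of_forall fun u => ?_), fun V => ?_⟩
  · simp only [hy, inner_add_left, inner_smul_left, inChart_center]
    rfl
  · have h4 := hν.inner_jac hx p V
    have h5 := real_inner_comm (hess x p V Y) (ν p : Ambient n)
    rw [hess] at h5
    simp [hps, hess, h4, h5]

end Pairs

theorem continuous_height {n : ℕ} {M₀ : Type*} [TopologicalSpace M₀] {x ν : M₀ → Sph n}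
    (hx : Continuous x) (hc : Continuous ν) :
    Continuous fun z : M₀ × M₀ => height x ν z.1 z.2 := by
  unfold height
  exact ((continuous_subtype_val.comp hx).comp continuous_snd).inner
    ((continuous_subtype_val.comp hc).comp continuous_fst)

/-! ### Local strict convexity -/

section StrictPairs

variable {n : ℕ} {M₀ : Type*} [TopologicalSpace M₀]
  [ChartedSpace (EuclideanSpace ℝ (Fin n)) M₀] {x ν : M₀ → Sph n}

/-- The pairs `(p, q)` such that `q = p` or `x q` lies strictly inside the tangent hemisphere
at `p`. -/
def strictPairs (x ν : M₀ → Sph n) : Set (M₀ × M₀) :=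
  {z | z.1 = z.2 ∨ height x ν z.1 z.2 < 0}

theorem IsConvexNormal.height_nonpos (hν : IsConvexNormal x ν) {z : M₀ × M₀}
    (hz : z ∈ strictPairs x ν) : height x ν z.1 z.2 ≤ 0 := by
  rcases hz with h | h
  · rw [h, hν.height_self]
  · exact h.le

variable [IsManifold (𝓡 n) 2 M₀]

/-- The base point of the second derivative and that of the normal vary independently, because along
a segment second derivatives at all its points are paired with the normal at one end. Compactness of
the unit sphere of directions makes the radius uniform. -/
theorem IsConvexNormal.exists_second_neg_ball (hν : IsConvexNormal x ν) (hx : IsC2Immersion x)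
    (hc : Continuous ν) (p : M₀) :
    ∃ r > 0, Metric.ball (chartAt (Coord n) p p) r ⊆ (chartAt (Coord n) p).target ∧
      ∀ u ∈ Metric.ball (chartAt (Coord n) p p) r, ∀ u' ∈ Metric.ball (chartAt (Coord n) p p) r,
        ∀ v : Coord n, v ≠ 0 → inner ℝ (fderiv ℝ (fderiv ℝ (inChart x p)) u v v)
          (ν ((chartAt (Coord n) p).symm u') : Ambient n) < 0 := by
  set u₀ := chartAt (Coord n) p p with hu₀
  have hps : (chartAt (Coord n) p).symm u₀ = p :=
    (chartAt (Coord n) p).left_inv (mem_chart_source _ p)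
  have hN : ContinuousAt (fun u => (ν ((chartAt (Coord n) p).symm u) : Ambient n)) u₀ := by
    have h1 := (continuous_subtype_val.comp hc).tendsto p
    rw [ContinuousAt, hps]
    exact h1.comp (tendsto_chartAt_symm_center p)
  have key : ∀ᶠ z in 𝓝 ((u₀, u₀) : Coord n × Coord n), ∀ v ∈ Metric.sphere (0 : Coord n) 1,
      inner ℝ (fderiv ℝ (fderiv ℝ (inChart x p)) z.1 v v)
        (ν ((chartAt (Coord n) p).symm z.2) : Ambient n) < 0 := by
    refine (isCompact_sphere (0 : Coord n) 1).eventually_forall_of_forall_eventually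
      (x₀ := ((u₀, u₀) : Coord n × Coord n))
      (P := fun z v => inner ℝ (fderiv ℝ (fderiv ℝ (inChart x p)) z.1 v v)
        (ν ((chartAt (Coord n) p).symm z.2) : Ambient n) < 0) fun v hv => ?_
    have hv0 : v ≠ 0 := by
      rintro rfl
      simp at hv
    have hneg := hν.hess_neg p hv0
    have hD : ContinuousAt (fun z : (Coord n × Coord n) × Coord n =>
        fderiv ℝ (fderiv ℝ (inChart x p)) z.1.1) ((u₀, u₀), v) :=
      ContinuousAt.comp (x := ((u₀, u₀), v))
        (f := fun z : (Coord n × Coord n) × Coord n => z.1.1)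
        (hx.continuousAt_fderiv_fderiv p) (by fun_prop)
    have hN' : ContinuousAt (fun z : (Coord n × Coord n) × Coord n =>
        (ν ((chartAt (Coord n) p).symm z.1.2) : Ambient n)) ((u₀, u₀), v) :=
      ContinuousAt.comp (x := ((u₀, u₀), v))
        (f := fun z : (Coord n × Coord n) × Coord n => z.1.2) hN (by fun_prop)
    have hcont := ((hD.clm_apply continuous_snd.continuousAt).clm_apply
      continuous_snd.continuousAt).inner (𝕜 := ℝ) hN'
    refine hcont.eventually_lt_const ?_
    simpa [hps, hess, ← hu₀] using hneg
  rw [nhds_prod_eq] at key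
  obtain ⟨s, hs, t, ht, hst⟩ := Filter.mem_prod_iff.1 key
  obtain ⟨r, hr, hball⟩ := Metric.mem_nhds_iff.1
    (Filter.inter_mem (Filter.inter_mem hs ht) (eventually_chart_target p))
  refine ⟨r, hr, fun u hu => (hball hu).2, fun u hu u' hu' v hv => ?_⟩
  have h1 := hst (Set.mk_mem_prod (hball hu).1.1 (hball hu').1.2) (‖v‖⁻¹ • v) (by
    rw [mem_sphere_zero_iff_norm, norm_smul, norm_inv, norm_norm]
    exact inv_mul_cancel₀ (norm_ne_zero_iff.2 hv))
  simp only [map_smul, smul_apply, inner_smul_left] at h1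
  have hvpos : 0 < ‖v‖⁻¹ := inv_pos.2 (norm_pos_iff.2 hv)
  by_contra hcon
  rw [not_lt] at hcon
  have : 0 ≤ ‖v‖⁻¹ * (‖v‖⁻¹ * inner ℝ (fderiv ℝ (fderiv ℝ (inChart x p)) u v v)
      (ν ((chartAt (Coord n) p).symm u') : Ambient n)) := by positivity
  simp at h1
  linarith

theorem lt_zero_of_deriv_deriv_neg {g g₁ g₂ : ℝ → ℝ}
    (h0 : ∀ t ∈ Set.Icc (0 : ℝ) 1, HasDerivAt g (g₁ t) t)
    (h1 : ∀ t ∈ Set.Icc (0 : ℝ) 1, HasDerivAt g₁ (g₂ t) t)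
    (h2 : ∀ t ∈ Set.Icc (0 : ℝ) 1, g₂ t < 0) (hg : g 0 = 0) (hg₁ : g₁ 0 = 0) : g 1 < 0 := by
  have m0 : (0 : ℝ) ∈ Set.Icc (0 : ℝ) 1 := by simp
  have m1 : (1 : ℝ) ∈ Set.Icc (0 : ℝ) 1 := by simp
  have a1 : StrictAntiOn g₁ (Set.Icc 0 1) := by
    refine strictAntiOn_of_deriv_neg (convex_Icc 0 1)
      (fun t ht => (h1 t ht).continuousAt.continuousWithinAt) fun t ht => ?_
    have ht' := interior_subset ht
    rw [(h1 t ht').deriv]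
    exact h2 t ht'
  have a0 : StrictAntiOn g (Set.Icc 0 1) := by
    refine strictAntiOn_of_deriv_neg (convex_Icc 0 1)
      (fun t ht => (h0 t ht).continuousAt.continuousWithinAt) fun t ht => ?_
    have ht' := interior_subset ht
    rw [(h0 t ht').deriv, ← hg₁]
    rw [interior_Icc] at ht
    exact a1 m0 ht' ht.1
  rw [← hg]
  exact a0 m0 m1 one_pos

theorem inner_neg_of_second_deriv_neg {E F : Type*} [NormedAddCommGroup E] [NormedSpace ℝ E]
    [NormedAddCommGroup F] [InnerProductSpace ℝ F] {f : E → F} {u d : E} {N : F}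
    (h0 : ∀ t ∈ Set.Icc (0 : ℝ) 1, DifferentiableAt ℝ f (u + t • d))
    (h1 : ∀ t ∈ Set.Icc (0 : ℝ) 1, DifferentiableAt ℝ (fderiv ℝ f) (u + t • d))
    (h2 : ∀ t ∈ Set.Icc (0 : ℝ) 1, inner ℝ (fderiv ℝ (fderiv ℝ f) (u + t • d) d d) N < 0)
    (hf : inner ℝ (f u) N = 0) (hf' : inner ℝ (fderiv ℝ f u d) N = 0) :
    inner ℝ (f (u + d)) N < 0 := by
  have hline : ∀ t : ℝ, HasDerivAt (fun s : ℝ => u + s • d) d t := by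
    intro t
    simpa using ((hasDerivAt_id t).smul_const d).const_add u
  have h := lt_zero_of_deriv_deriv_neg
    (g := fun t => inner ℝ (f (u + t • d)) N)
    (g₁ := fun t => inner ℝ (fderiv ℝ f (u + t • d) d) N)
    (g₂ := fun t => inner ℝ (fderiv ℝ (fderiv ℝ f) (u + t • d) d d) N) ?_ ?_ h2 ?_ ?_
  · simpa using h
  · intro t ht
    have := ((h0 t ht).hasFDerivAt.comp_hasDerivAt t (hline t)).inner ℝ (hasDerivAt_const t N)
    simpa using this
  · intro t ht
    have h3 : HasDerivAt (fun s : ℝ => fderiv ℝ f (u + s • d))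
        (fderiv ℝ (fderiv ℝ f) (u + t • d) d) t :=
      (h1 t ht).hasFDerivAt.comp_hasDerivAt t (hline t)
    have h4 : HasDerivAt (fun s : ℝ => fderiv ℝ f (u + s • d) d)
        (fderiv ℝ (fderiv ℝ f) (u + t • d) d d) t := by
      simpa using h3.clm_apply (hasDerivAt_const t d)
    simpa using h4.inner ℝ (hasDerivAt_const t N)
  · simpa using hf
  · simpa using hf'

/-- Along the chart segment from q to q', the height over the tangent sphere at q starts with value
0 and slope 0 and is strictly concave. -/
theorem IsConvexNormal.exists_nhds_height_neg (hν : IsConvexNormal x ν) (hx : IsC2Immersion x)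
    (hc : Continuous ν) (p : M₀) :
    ∃ U ∈ 𝓝 p, ∀ q ∈ U, ∀ q' ∈ U, q ≠ q' → height x ν q q' < 0 := by
  obtain ⟨r, hr, hsub, hneg⟩ := hν.exists_second_neg_ball hx hc p
  set u₀ := chartAt (Coord n) p p with hu₀
  refine ⟨(chartAt (Coord n) p).source ∩ (chartAt (Coord n) p) ⁻¹' Metric.ball u₀ r,
    Filter.inter_mem (chart_source_mem_nhds p)
      (continuousAt_chart_center p (Metric.ball_mem_nhds _ hr)), ?_⟩
  rintro q ⟨hq, hqb⟩ q' ⟨hq', hqb'⟩ hne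
  set u := chartAt (Coord n) p q with hu
  set u' := chartAt (Coord n) p q' with hu'
  have hd : u' - u ≠ 0 := by
    intro h
    apply hne
    exact (chartAt (Coord n) p).injOn hq hq' (sub_eq_zero.1 h).symm
  have hmem : ∀ t ∈ Set.Icc (0 : ℝ) 1, u + t • (u' - u) ∈ Metric.ball u₀ r := by
    intro t ht
    exact (convex_ball u₀ r).add_smul_sub_mem hqb hqb' ht
  have hcd : ∀ t ∈ Set.Icc (0 : ℝ) 1, (chartAt (Coord n) p).symm (u + t • (u' - u)) ∈
      (chartAt (Coord n) p).source := fun t ht =>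
    (chartAt (Coord n) p).map_target (hsub (hmem t ht))
  have hri : ∀ t ∈ Set.Icc (0 : ℝ) 1, chartAt (Coord n) p
      ((chartAt (Coord n) p).symm (u + t • (u' - u))) = u + t • (u' - u) := fun t ht =>
    (chartAt (Coord n) p).right_inv (hsub (hmem t ht))
  have h := inner_neg_of_second_deriv_neg (f := inChart x p) (u := u) (d := u' - u)
    (N := (ν q : Ambient n)) (fun t ht => ?_) (fun t ht => ?_) (fun t ht => ?_) ?_ ?_
  · rwa [add_sub_cancel, hu', inChart_apply p hq'] at h
  · have h1 := (hx.contDiffAt_inChart (hcd t ht)).differentiableAt (by norm_num)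
    rwa [hri t ht] at h1
  · have h1 := hx.differentiableAt_fderiv (hcd t ht)
    rwa [hri t ht] at h1
  · have := hneg _ (hmem t ht) u hqb _ hd
    rwa [hu, (chartAt (Coord n) p).left_inv hq, ← hu] at this
  · rw [hu, inChart_apply p hq]
    exact hν.inner_self q
  · rw [real_inner_comm]
    exact ((hx.isUnitNormal_iff hq _).1 (hν.unitNormal q)).2 (u' - u)

/-- Off the diagonal this is continuity of the height; at the diagonal, where the height is 0, local
strict convexity replaces it. -/
theorem IsConvexNormal.isOpen_strictPairs (hν : IsConvexNormal x ν) (hx : IsC2Immersion x)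
    (hc : Continuous ν) : IsOpen (strictPairs x ν) := by
  rw [isOpen_iff_mem_nhds]
  rintro ⟨p, q⟩ h
  by_cases hlt : height x ν p q < 0
  · have h1 := (continuous_height hx.continuous hc).continuousAt (x := (p, q))
    filter_upwards [h1.eventually_lt_const hlt] with z hz
    exact Or.inr hz
  · obtain rfl : p = q := h.resolve_right hlt
    obtain ⟨U, hU, hneg⟩ := hν.exists_nhds_height_neg hx hc p
    filter_upwards [prod_mem_nhds hU hU] with z hz
    by_cases he : z.1 = z.2
    · exact Or.inl he
    · exact Or.inr (hneg _ hz.1 _ hz.2 he)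

/-- When the tangent sphere moves in direction V, the height of y changes at the rate given by the
second fundamental form on (V, Y), where Y is the tangential part of y. So V = Y increases it, and Y
≠ 0 since y ≠ ±x p. -/
theorem IsConvexNormal.exists_fderiv_pos (hν : IsConvexNormal x ν) (hx : IsC2Immersion x)
    (hc : Continuous ν) {p : M₀} {y : Sph n} (hy : inner ℝ (y : Ambient n) (ν p : Ambient n) = 0)
    (hne : y ≠ x p) (hne' : (y : Ambient n) ≠ -x p) :
    ∃ (a : ℝ) (Y : Coord n) (L : Coord n →L[ℝ] ℝ),
      (y : Ambient n) = a • (x p : Ambient n) + jac x p Y ∧ Y ≠ 0 ∧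
      HasFDerivAt (fun u => inner ℝ (y : Ambient n)
        (ν ((chartAt (Coord n) p).symm u) : Ambient n)) L (chartAt (Coord n) p p) ∧ 0 < L Y := by
  obtain ⟨a, Y, h⟩ := hx.exists_tangent_decomposition (hν.unitNormal p) hy
  obtain ⟨L, hL, hL'⟩ := hν.hasFDerivAt_inner hx hc p h
  have hY : Y ≠ 0 := by
    rintro rfl
    rw [map_zero, add_zero] at h
    have h1 := norm_sph y
    rw [h, norm_smul, norm_sph, mul_one, Real.norm_eq_abs] at h1
    rcases abs_eq (zero_le_one) |>.1 h1 with h2 | h2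
    · exact hne (Subtype.ext (by rw [h, h2, one_smul]))
    · exact hne' (by rw [h, h2, neg_one_smul])
  refine ⟨a, Y, L, h, hY, hL, ?_⟩
  rw [hL']
  linarith [hν.hess_neg p hY]

/-- A point of a tangent great sphere, other than the contact point, lies strictly outside some of
the neighbouring tangent hemispheres. -/
theorem IsConvexNormal.exists_inner_pos (hν : IsConvexNormal x ν) (hx : IsC2Immersion x)
    (hc : Continuous ν) (hn : 1 ≤ n) {p : M₀} {y : Sph n}
    (hy : inner ℝ (y : Ambient n) (ν p : Ambient n) = 0)
    (hne : y ≠ x p) {U : Set M₀} (hU : U ∈ 𝓝 p) :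
    ∃ q ∈ U, 0 < inner ℝ (y : Ambient n) (ν q : Ambient n) := by
  -- At the antipode of `x p` the first derivative vanishes; there the sign comes from `x p` lying
  -- strictly inside the neighbouring tangent hemispheres.
  by_cases hne' : (y : Ambient n) = -x p
  · obtain ⟨W, hW, hneg⟩ := hν.exists_nhds_height_neg hx hc p
    obtain ⟨v, hv⟩ : ∃ v : Coord n, v ≠ 0 :=
      ⟨EuclideanSpace.single (⟨0, hn⟩ : Fin n) (1 : ℝ), by simp⟩
    obtain ⟨s, hs, hs', hs''⟩ := ((eventually_chartRay_ne p hv).and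
      (((tendsto_chartRay p v).eventually hU).and ((tendsto_chartRay p v).eventually hW))).exists
    refine ⟨_, hs', ?_⟩
    rw [hne', inner_neg_left]
    exact neg_pos.2 (hneg _ hs'' _ (mem_of_mem_nhds hW) hs)
  obtain ⟨a, Y, L, -, -, hL, hLY⟩ := hν.exists_fderiv_pos hx hc hy hne hne'
  have h1 := eventually_lt_chartRay
    (g := fun q => inner ℝ (y : Ambient n) (ν q : Ambient n)) hL hLY
  obtain ⟨s, hs, hs'⟩ := (h1.and ((tendsto_chartRay p Y).eventually hU)).exists
  exact ⟨_, hs', by simpa only [hy] using hs⟩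

end StrictPairs

/-! ### Caps cut off by a hemisphere -/

section Caps

variable {n : ℕ} {M₀ : Type*} [TopologicalSpace M₀]

/-- The part of the hypersurface in the open hemisphere with pole `w`. -/
def cap (x : M₀ → Sph n) (w : Ambient n) : Set M₀ := {q | 0 < inner ℝ (x q : Ambient n) w}

theorem continuous_inner_sph {x : M₀ → Sph n} (hx : Continuous x) (w : Ambient n) :
    Continuous fun q => inner ℝ (x q : Ambient n) w :=
  (continuous_subtype_val.comp hx).inner continuous_const

theorem isOpen_cap {x : M₀ → Sph n} (hx : Continuous x) (w : Ambient n) : IsOpen (cap x w) :=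
  isOpen_lt continuous_const (continuous_inner_sph hx w)

/-- The radial contraction y ↦ c + r y / (1 + ‖y‖) carries the complement of the origin, which is
connected in dimension at least two, onto the punctured ball. -/
theorem isPreconnected_punctured_ball {E : Type*} [NormedAddCommGroup E] [NormedSpace ℝ E]
    (h : 1 < Module.rank ℝ E) (c : E) {r : ℝ} (hr : 0 < r) :
    IsPreconnected (Metric.ball c r \ {c}) := by
  have hc : Continuous fun y : E => c + (r / (1 + ‖y‖)) • y := by
    refine continuous_const.add (Continuous.smul ?_ continuous_id)
    exact continuous_const.div (by fun_prop) fun y => by positivity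
  have himg : (fun y : E => c + (r / (1 + ‖y‖)) • y) '' {0}ᶜ = Metric.ball c r \ {c} := by
    apply Set.Subset.antisymm
    · rintro _ ⟨y, hy, rfl⟩
      have hy0 : y ≠ 0 := hy
      have hy1 : 0 < ‖y‖ := norm_pos_iff.2 hy0
      refine ⟨?_, ?_⟩
      · rw [mem_ball_iff_norm, add_sub_cancel_left, norm_smul, Real.norm_eq_abs,
          abs_of_pos (by positivity), div_mul_eq_mul_div, div_lt_iff₀ (by positivity)]
        nlinarith
      · simp only [Set.mem_singleton_iff, add_eq_left, smul_eq_zero, not_or]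
        exact ⟨by positivity, hy0⟩
    · rintro u ⟨hu, hu'⟩
      have hz : ‖u - c‖ < r := mem_ball_iff_norm.1 hu
      have hz0 : u - c ≠ 0 := sub_ne_zero.2 hu'
      have hd : 0 < r - ‖u - c‖ := by linarith
      refine ⟨(r - ‖u - c‖)⁻¹ • (u - c), ?_, ?_⟩
      · simp only [Set.mem_compl_iff, Set.mem_singleton_iff, smul_eq_zero, not_or]
        exact ⟨by positivity, hz0⟩
      · simp only [norm_smul, norm_inv, Real.norm_eq_abs, abs_of_pos hd, smul_smul]
        have : r / (1 + (r - ‖u - c‖)⁻¹ * ‖u - c‖) * (r - ‖u - c‖)⁻¹ = 1 := by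
          field_simp
          ring
        rw [this, one_smul, add_sub_cancel]
  rw [← himg]
  exact (isConnected_compl_singleton_of_one_lt_rank h 0).isPreconnected.image _ hc.continuousOn

end Caps

/-! ### Local shape of a cap at its boundary -/

section Boundary

variable {n : ℕ} {M₀ : Type*} [TopologicalSpace M₀]
  [ChartedSpace (EuclideanSpace ℝ (Fin n)) M₀] {x ν : M₀ → Sph n}

theorem one_lt_rank_coord (hn : 2 ≤ n) : 1 < Module.rank ℝ (Coord n) := by
  apply Module.one_lt_rank_of_one_lt_finrank
  simpa using (show 1 < n from hn)

/-- The image of a small set in the chart at `p` lies in a given neighbourhood of `p`. -/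
theorem exists_chart_ball (p : M₀) {U : Set M₀} (hU : U ∈ 𝓝 p) :
    ∃ r > 0, Metric.ball (chartAt (Coord n) p p) r ⊆ (chartAt (Coord n) p).target ∧
      ∀ u ∈ Metric.ball (chartAt (Coord n) p p) r, (chartAt (Coord n) p).symm u ∈ U := by
  obtain ⟨r, hr, hball⟩ := Metric.mem_nhds_iff.1
    (Filter.inter_mem (tendsto_chartAt_symm_center (n := n) p hU) (eventually_chart_target p))
  exact ⟨r, hr, fun u hu => (hball hu).2, fun u hu => (hball hu).1⟩

theorem exists_nhds_chart_ball (p : M₀) {r : ℝ} (hr : 0 < r) :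
    ∃ N ∈ 𝓝 p, IsOpen N ∧ ∀ q ∈ N, q ∈ (chartAt (Coord n) p).source ∧
      chartAt (Coord n) p q ∈ Metric.ball (chartAt (Coord n) p p) r := by
  refine ⟨(chartAt (Coord n) p).source ∩ (chartAt (Coord n) p) ⁻¹' Metric.ball (chartAt (Coord n) p p) r, ?_, ?_, ?_⟩
  · exact Filter.inter_mem (chart_source_mem_nhds (n := n) p)
      (continuousAt_chart_center (n := n) p (Metric.ball_mem_nhds _ hr))
  · exact (chartAt (Coord n) p).isOpen_inter_preimage Metric.isOpen_ball
  · exact fun q hq => hq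

/-- For `n ≥ 2` small punctured neighbourhoods are connected. -/
theorem exists_nhds_punctured_preconnected (hn : 2 ≤ n) (p : M₀) {U : Set M₀} (hU : U ∈ 𝓝 p) :
    ∃ N ∈ 𝓝 p, N ⊆ U ∧ IsPreconnected (N \ {p}) := by
  obtain ⟨r, hr, hsub, hmem⟩ := exists_chart_ball (n := n) p hU
  have hpre := isPreconnected_punctured_ball (one_lt_rank_coord hn) (chartAt (Coord n) p p) hr
  refine ⟨(chartAt (Coord n) p).symm '' Metric.ball (chartAt (Coord n) p p) r, ?_, ?_, ?_⟩
  · obtain ⟨N, hN, -, hN'⟩ := exists_nhds_chart_ball (n := n) p hr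
    refine Filter.mem_of_superset hN fun q hq => ?_
    exact ⟨_, (hN' q hq).2, (chartAt (Coord n) p).left_inv (hN' q hq).1⟩
  · rintro _ ⟨u, hu, rfl⟩
    exact hmem u hu
  · have := hpre.image (chartAt (Coord n) p).symm
      ((chartAt (Coord n) p).continuousOn_symm.mono fun u hu => hsub hu.1)
    convert this using 1
    apply Set.Subset.antisymm
    · rintro _ ⟨⟨u, hu, rfl⟩, hne⟩
      refine ⟨u, ⟨hu, ?_⟩, rfl⟩
      rintro rfl
      exact hne ((chartAt (Coord n) p).left_inv (mem_chart_source _ p))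
    · rintro _ ⟨u, ⟨hu, hne⟩, rfl⟩
      refine ⟨⟨u, hu, rfl⟩, fun h => hne ?_⟩
      rw [Set.mem_singleton_iff] at h ⊢
      have h1 := (chartAt (Coord n) p).right_inv (hsub hu)
      rw [h] at h1
      exact h1.symm

variable [IsManifold (𝓡 n) 2 M₀]

theorem IsC2Immersion.exists_ball_deriv_pos (hx : IsC2Immersion x) {p : M₀} {w : Ambient n}
    {e : Coord n} (he : 0 < inner ℝ w (jac x p e)) :
    ∃ r > 0, Metric.ball (chartAt (Coord n) p p) r ⊆ (chartAt (Coord n) p).target ∧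
      ∀ u : Coord n, ∀ δ : ℝ, 0 < δ →
      (∀ t ∈ Set.Icc 0 δ, u + t • e ∈ Metric.ball (chartAt (Coord n) p p) r) →
      inner ℝ w (inChart x p u) < inner ℝ w (inChart x p (u + δ • e)) := by
  have hcont : ContinuousAt (fun u => inner ℝ w (fderiv ℝ (inChart x p) u e))
      (chartAt (Coord n) p p) :=
    continuousAt_const.inner ((hx.continuousAt_fderiv p).clm_apply continuousAt_const)
  have hpos : ∀ᶠ u in 𝓝 (chartAt (Coord n) p p), 0 < inner ℝ w (fderiv ℝ (inChart x p) u e) :=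
    hcont.eventually_const_lt he
  obtain ⟨r, hr, hball⟩ := Metric.mem_nhds_iff.1
    (Filter.inter_mem hpos (eventually_chart_target p))
  refine ⟨r, hr, fun u hu => (hball hu).2, fun u δ hδ hseg => ?_⟩
  have hd : ∀ t ∈ Set.Icc 0 δ, HasDerivAt (fun s : ℝ => inner ℝ w (inChart x p (u + s • e)))
      (inner ℝ w (fderiv ℝ (inChart x p) (u + t • e) e)) t := by
    intro t ht
    have h0 := (hball (hseg t ht)).2
    have h1 := ((hx.contDiffAt_inChart ((chartAt (Coord n) p).map_target h0)).differentiableAt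
      (by norm_num)).hasFDerivAt
    rw [(chartAt (Coord n) p).right_inv h0] at h1
    have hl : HasDerivAt (fun s : ℝ => u + s • e) e t := by
      simpa using ((hasDerivAt_id t).smul_const e).const_add u
    have h2 := h1.comp_hasDerivAt t hl
    simpa using (hasDerivAt_const t w).inner ℝ h2
  have hmono : StrictMonoOn (fun s : ℝ => inner ℝ w (inChart x p (u + s • e))) (Set.Icc 0 δ) := by
    refine strictMonoOn_of_deriv_pos (convex_Icc 0 δ)
      (fun t ht => (hd t ht).continuousAt.continuousWithinAt) fun t ht => ?_
    have ht' := interior_subset ht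
    rw [(hd t ht').deriv]
    exact (hball (hseg t ht')).1
  simpa using hmono (Set.left_mem_Icc.2 hδ.le) (Set.right_mem_Icc.2 hδ.le) hδ

/-- Near a boundary point which is not critical for the height in direction `w`, the cap is
connected and accumulates at all points where the height is nonnegative. -/
theorem IsC2Immersion.exists_nhds_cap_connected (hx : IsC2Immersion x) {p : M₀} {w : Ambient n}
    {e : Coord n} (hp : inner ℝ (x p : Ambient n) w = 0) (he : 0 < inner ℝ w (jac x p e)) :
    ∃ N ∈ 𝓝 p, IsOpen N ∧ ∃ c : M₀,
      (∀ q ∈ N ∩ cap x w, ∃ C ⊆ cap x w, IsPreconnected C ∧ q ∈ C ∧ c ∈ C) ∧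
      (∀ q ∈ N, 0 ≤ inner ℝ (x q : Ambient n) w → q ∈ closure (cap x w)) := by
  obtain ⟨r, hr, hsub, hinc⟩ := hx.exists_ball_deriv_pos he
  set u₀ := chartAt (Coord n) p p with hu₀
  have hcd : ∀ u ∈ Metric.ball u₀ r, DifferentiableAt ℝ (inChart x p) u := by
    intro u hu
    have h1 := (hx.contDiffAt_inChart ((chartAt (Coord n) p).map_target (hsub hu))).differentiableAt
      (by norm_num)
    rwa [(chartAt (Coord n) p).right_inv (hsub hu)] at h1
  obtain ⟨δ, hδ, hδr⟩ : ∃ δ > 0, δ * ‖e‖ < r / 2 := by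
    refine ⟨r / 2 / (‖e‖ + 1), by positivity, ?_⟩
    rw [div_mul_eq_mul_div, div_lt_iff₀ (by positivity)]
    nlinarith [norm_nonneg e]
  have hseg : ∀ u ∈ Metric.ball u₀ (r / 2), ∀ t ∈ Set.Icc 0 δ, u + t • e ∈ Metric.ball u₀ r := by
    intro u hu t ht
    rw [mem_ball_iff_norm] at hu ⊢
    have h1 : ‖t • e‖ ≤ δ * ‖e‖ := by
      rw [norm_smul, Real.norm_eq_abs, abs_of_nonneg ht.1]
      exact mul_le_mul_of_nonneg_right ht.2 (norm_nonneg _)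
    have h2 : u + t • e - u₀ = (u - u₀) + t • e := by abel
    rw [h2]
    linarith [norm_add_le (u - u₀) (t • e)]
  have htop : 0 < inner ℝ w (inChart x p (u₀ + δ • e)) := by
    have h1 := hinc u₀ δ hδ (hseg u₀ (Metric.mem_ball_self (by positivity)))
    rw [hu₀, inChart_center, real_inner_comm, hp] at h1
    exact h1
  have htc : ContinuousAt (fun u => inner ℝ w (inChart x p u)) (u₀ + δ • e) :=
    continuousAt_const.inner (hcd _ (hseg u₀ (Metric.mem_ball_self (by positivity)) δ
      (Set.right_mem_Icc.2 hδ.le))).continuousAt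
  obtain ⟨ρ', hρ', hρball⟩ := Metric.mem_nhds_iff.1 (htc.eventually_const_lt htop)
  set ρ := min ρ' (r / 2) with hρ
  have hρ0 : 0 < ρ := lt_min hρ' (by positivity)
  have hρr : Metric.ball u₀ ρ ⊆ Metric.ball u₀ (r / 2) := Metric.ball_subset_ball (min_le_right _ _)
  obtain ⟨N, hN, hNo, hN'⟩ := exists_nhds_chart_ball (n := n) p hρ0
  have hcapiff : ∀ u, (chartAt (Coord n) p).symm u ∈ cap x w ↔ 0 < inner ℝ w (inChart x p u) := by
    intro u
    rw [real_inner_comm]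
    rfl
  refine ⟨N, hN, hNo, (chartAt (Coord n) p).symm (u₀ + δ • e), ?_, ?_⟩
  · rintro q ⟨hq, hqc⟩
    obtain ⟨hqs, hqb⟩ := hN' q hq
    set u := chartAt (Coord n) p q with hu
    have hqpos : 0 < inner ℝ w (inChart x p u) := by
      rw [hu, inChart_apply p hqs, real_inner_comm]
      exact hqc
    -- A cap point q near p is joined to c inside the cap: first along e for time δ, which increases
    -- the height, then within a ball about u₀ + δ e on which the height is positive.
    set S : Set (Coord n) := (fun t : ℝ => u + t • e) '' Set.Icc 0 δ with hS
    set B : Set (Coord n) := Metric.ball (u₀ + δ • e) ρ with hB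
    have hSr : S ⊆ Metric.ball u₀ r := by
      rintro _ ⟨t, ht, rfl⟩
      exact hseg u (hρr hqb) t ht
    have hBr : B ⊆ Metric.ball u₀ r := by
      intro v hv
      rw [hB, mem_ball_iff_norm] at hv
      have h1 : v - δ • e ∈ Metric.ball u₀ (r / 2) := by
        apply hρr
        rw [mem_ball_iff_norm]
        rwa [sub_sub, add_comm (δ • e)]
      have := hseg _ h1 δ (Set.right_mem_Icc.2 hδ.le)
      rwa [sub_add_cancel] at this
    have hSp : IsPreconnected S :=
      isPreconnected_Icc.image _ (by fun_prop : Continuous fun t : ℝ => u + t • e).continuousOn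
    have hBp : IsPreconnected B := Metric.isPreconnected_ball
    have hcS : u + δ • e ∈ S := ⟨δ, Set.right_mem_Icc.2 hδ.le, rfl⟩
    have hcB : u + δ • e ∈ B := by
      rw [hB, mem_ball_iff_norm, add_sub_add_right_eq_sub]
      exact mem_ball_iff_norm.1 hqb
    refine ⟨(chartAt (Coord n) p).symm '' (S ∪ B), ?_, ?_, ?_, ?_⟩
    · rintro _ ⟨v, hv, rfl⟩
      rw [hcapiff]
      rcases hv with ⟨t, ht, rfl⟩ | hv
      · rcases ht.1.eq_or_lt with h0 | h0
        · simpa [← h0] using hqpos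
        · exact hqpos.trans (hinc u t h0 fun s hs =>
            hseg u (hρr hqb) s ⟨hs.1, hs.2.trans ht.2⟩)
      · exact hρball (Metric.ball_subset_ball (min_le_left _ _) hv)
    · refine (IsPreconnected.union _ hcS hcB hSp hBp).image _ ?_
      exact (chartAt (Coord n) p).continuousOn_symm.mono
        ((Set.union_subset hSr hBr).trans hsub)
    · exact ⟨u, Or.inl ⟨0, Set.left_mem_Icc.2 hδ.le, by simp⟩,
        (chartAt (Coord n) p).left_inv hqs⟩
    · exact ⟨u₀ + δ • e, Or.inr (Metric.mem_ball_self hρ0), rfl⟩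
  · intro q hq hq0
    obtain ⟨hqs, hqb⟩ := hN' q hq
    set u := chartAt (Coord n) p q with hu
    have hq0' : 0 ≤ inner ℝ w (inChart x p u) := by
      rw [hu, inChart_apply p hqs, real_inner_comm]
      exact hq0
    have hlim : Filter.Tendsto (fun t : ℝ => (chartAt (Coord n) p).symm (u + t • e)) (𝓝[>] 0)
        (𝓝 q) := by
      have h1 := (chartAt (Coord n) p).continuousAt_symm ((chartAt (Coord n) p).map_source hqs)
      rw [ContinuousAt, (chartAt (Coord n) p).left_inv hqs] at h1
      exact h1.comp (tendsto_ray _ _)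
    refine mem_closure_of_tendsto hlim ?_
    filter_upwards [Ioo_mem_nhdsGT hδ] with t ht
    rw [hcapiff]
    exact hq0'.trans_lt (hinc u t ht.1 fun s hs =>
      hseg u (hρr hqb) s ⟨hs.1, hs.2.trans ht.2.le⟩)

end Boundary

/-! ### Components of superlevel sets depending on a parameter -/

section Topological

theorem mem_connectedComponentIn_of_mem_closure {X : Type*} [TopologicalSpace X]
    [LocallyConnectedSpace X] {U : Set X} (hU : IsOpen U) {p q : X} (hq : q ∈ U)
    (hcl : q ∈ closure (connectedComponentIn U p)) : q ∈ connectedComponentIn U p := by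
  have h1 : connectedComponentIn U q ∈ 𝓝 q := connectedComponentIn_mem_nhds (hU.mem_nhds hq)
  obtain ⟨z, hz, hz'⟩ := mem_closure_iff_nhds.1 hcl _ h1
  rw [connectedComponentIn_eq hz', ← connectedComponentIn_eq hz]
  exact mem_connectedComponentIn hq

/-- If a compact set `K` is open in a superlevel set, then connected components of nearby
superlevel sets which meet `K` in a given point stay close to `K`. -/
theorem eventually_connectedComponentIn_subset {X : Type*} [TopologicalSpace X] [CompactSpace X]
    [T2Space X] {g : ℝ → X → ℝ} (hg : Continuous fun z : ℝ × X => g z.1 z.2) {θ : ℝ} {K U : Set X}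
    (hK : IsClosed K) (hopen : ∀ p ∈ K, ∃ N ∈ 𝓝 p, ∀ q ∈ N, 0 ≤ g θ q → q ∈ K)
    (hU : IsOpen U) (hKU : K ⊆ U) {p₀ : X} (hp₀ : p₀ ∈ K) :
    ∀ᶠ θ' in 𝓝 θ, connectedComponentIn {q | 0 < g θ' q} p₀ ⊆ U := by
  choose! N hN hN' using hopen
  set V : Set X := (⋃ p ∈ K, interior (N p)) ∩ U with hV
  have hVo : IsOpen V := (isOpen_biUnion fun p _ => isOpen_interior).inter hU
  have hKV : K ⊆ V := fun p hp =>
    ⟨Set.mem_biUnion hp (mem_interior_iff_mem_nhds.2 (hN p hp)), hKU hp⟩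
  obtain ⟨W, hWo, hKW, hWV⟩ := normal_exists_closure_subset hK hVo hKV
  have hneg : ∀ q ∈ frontier W, g θ q < 0 := by
    intro q hq
    by_contra hcon
    rw [not_lt] at hcon
    have hqV := hWV (frontier_subset_closure hq)
    obtain ⟨p, hp, hqp⟩ := Set.mem_iUnion₂.1 hqV.1
    have hqK := hN' p hp q (interior_subset hqp) hcon
    rw [hWo.frontier_eq] at hq
    exact hq.2 (hKW hqK)
  have hev : ∀ᶠ θ' in 𝓝 θ, ∀ q ∈ frontier W, g θ' q < 0 := by
    refine (isClosed_frontier.isCompact).eventually_forall_of_forall_eventually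
      (P := fun θ' q => g θ' q < 0) fun q hq => ?_
    exact hg.continuousAt.eventually_lt_const (hneg q hq)
  filter_upwards [hev] with θ' hθ'
  by_cases hmem : p₀ ∈ {q | 0 < g θ' q}
  · refine Set.Subset.trans ?_ (subset_closure.trans (hWV.trans Set.inter_subset_right))
    refine isPreconnected_connectedComponentIn.subset_left_of_subset_union hWo
      isClosed_closure.isOpen_compl
      (disjoint_compl_right.mono_left subset_closure) ?_
      ⟨p₀, mem_connectedComponentIn hmem, hKW hp₀⟩
    intro q hq
    by_contra hcon
    rw [Set.mem_union, not_or, Set.mem_compl_iff, not_not] at hcon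
    have h1 := hθ' q (by rw [hWo.frontier_eq]; exact ⟨hcon.2, hcon.1⟩)
    have h2 : q ∈ {q | 0 < g θ' q} := connectedComponentIn_subset _ _ hq
    change 0 < g θ' q at h2
    linarith
  · rw [connectedComponentIn_eq_empty hmem]
    exact Set.empty_subset _

/-- A point of a component of an open superlevel set stays in the component of nearby superlevel
sets. -/
theorem eventually_mem_connectedComponentIn {X : Type*} [TopologicalSpace X]
    [LocallyPathConnectedSpace X] {g : ℝ → X → ℝ} (hg : Continuous fun z : ℝ × X => g z.1 z.2) {θ : ℝ}
    {p₀ q : X} (hq : q ∈ connectedComponentIn {q | 0 < g θ q} p₀) :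
    ∀ᶠ θ' in 𝓝 θ, q ∈ connectedComponentIn {q | 0 < g θ' q} p₀ := by
  have hp₀ : p₀ ∈ {q | 0 < g θ q} := by
    rw [← connectedComponentIn_nonempty_iff]
    exact ⟨q, hq⟩
  have hcont : Continuous (g θ) := hg.comp (Continuous.prodMk_right θ)
  have hopen : IsOpen (connectedComponentIn {q | 0 < g θ q} p₀) :=
    (isOpen_lt continuous_const hcont).connectedComponentIn
  have hpath : IsPathConnected (connectedComponentIn {q | 0 < g θ q} p₀) :=
    hopen.isConnected_iff_isPathConnected.1 (isConnected_connectedComponentIn_iff.2 hp₀)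
  -- A path from p₀ to q has compact image, so g stays positive along it for nearby parameters.
  obtain ⟨γ, hγ⟩ := hpath.joinedIn p₀ (mem_connectedComponentIn hp₀) q hq
  have hcomp : IsCompact (Set.range γ) := isCompact_range γ.continuous
  have hev : ∀ᶠ θ' in 𝓝 θ, ∀ z ∈ Set.range γ, 0 < g θ' z := by
    refine hcomp.eventually_forall_of_forall_eventually (P := fun θ' z => 0 < g θ' z) ?_
    rintro _ ⟨t, rfl⟩
    have h : γ t ∈ {q | 0 < g θ q} := connectedComponentIn_subset _ _ (hγ t)
    exact hg.continuousAt.eventually_const_lt h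
  filter_upwards [hev] with θ' hθ'
  have hpre : IsPreconnected (Set.range γ) := isPreconnected_range γ.continuous
  exact hpre.subset_connectedComponentIn ⟨0, γ.source⟩ hθ' ⟨1, γ.target⟩

end Topological

/-! ### The closure of a component of a cap -/

section Component

variable {n : ℕ} {M₀ : Type*} [TopologicalSpace M₀]
  [ChartedSpace (EuclideanSpace ℝ (Fin n)) M₀] {x ν : M₀ → Sph n} [IsManifold (𝓡 n) 2 M₀]

theorem IsC2Immersion.isUnitNormal_of_forall_nonpos (hx : IsC2Immersion x) {p : M₀} {w : Sph n}
    (hp : inner ℝ (x p : Ambient n) (w : Ambient n) = 0)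
    (h : ∀ e, inner ℝ (w : Ambient n) (jac x p e) ≤ 0) : IsUnitNormal x p w := by
  rw [hx.isUnitNormal_iff_jac]
  refine ⟨by rw [real_inner_comm, hp], fun v => le_antisymm (h v) ?_⟩
  have := h (-v)
  rw [map_neg, inner_neg_right] at this
  linarith

/-- The points of the closure of a component of a cap: either the component, regular boundary
points or minima of the height. -/
theorem IsConvexNormal.closure_component_cases (hν : IsConvexNormal x ν) (hx : IsC2Immersion x)
    (hc : Continuous ν) (hn : 2 ≤ n) {w : Sph n} {p₀ p : M₀}
    (hp : p ∈ closure (connectedComponentIn (cap x w) p₀))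
    (hpD : p ∉ connectedComponentIn (cap x w) p₀) :
    inner ℝ (x p : Ambient n) (w : Ambient n) = 0 ∧
    ((∃ e, 0 < inner ℝ (w : Ambient n) (jac x p e) ∧
      ∃ N ∈ 𝓝 p, N ∩ cap x w ⊆ connectedComponentIn (cap x w) p₀ ∧
        ∀ q ∈ N, 0 ≤ inner ℝ (x q : Ambient n) (w : Ambient n) →
          q ∈ closure (connectedComponentIn (cap x w) p₀)) ∨
      ((w : Ambient n) = -ν p ∧ ∃ N ∈ 𝓝 p, N \ {p} ⊆ connectedComponentIn (cap x w) p₀)) := by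
  have : LocallyConnectedSpace M₀ := ChartedSpace.locallyConnectedSpace (Coord n) M₀
  set D := connectedComponentIn (cap x w) p₀ with hD
  have hDcap : D ⊆ cap x w := connectedComponentIn_subset _ _
  have hpcap : p ∉ cap x w := fun h =>
    hpD (mem_connectedComponentIn_of_mem_closure (isOpen_cap hx.continuous _) h hp)
  have hp0 : inner ℝ (x p : Ambient n) (w : Ambient n) = 0 := by
    refine le_antisymm (not_lt.1 hpcap) ?_
    have hclosed : IsClosed {q | 0 ≤ inner ℝ (x q : Ambient n) (w : Ambient n)} :=
      isClosed_le continuous_const (continuous_inner_sph hx.continuous _)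
    have hsub : D ⊆ {q | 0 ≤ inner ℝ (x q : Ambient n) (w : Ambient n)} := fun q hq =>
      le_of_lt (show 0 < inner ℝ (x q : Ambient n) (w : Ambient n) from hDcap hq)
    exact closure_minimal hsub hclosed hp
  refine ⟨hp0, ?_⟩
  by_cases hreg : ∃ e, 0 < inner ℝ (w : Ambient n) (jac x p e)
  · left
    obtain ⟨e, he⟩ := hreg
    refine ⟨e, he, ?_⟩
    obtain ⟨N, hN, hNo, c, h1, h2⟩ := hx.exists_nhds_cap_connected hp0 he
    obtain ⟨z, hz, hzD⟩ := mem_closure_iff_nhds.1 hp N hN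
    obtain ⟨C, hC, hCp, hzC, hcC⟩ := h1 z ⟨hz, hDcap hzD⟩
    have hcD : c ∈ D := by
      rw [hD, connectedComponentIn_eq hzD]
      exact hCp.subset_connectedComponentIn hzC hC hcC
    have hsub : N ∩ cap x w ⊆ D := by
      intro q hq
      obtain ⟨C', hC', hCp', hqC', hcC'⟩ := h1 q hq
      rw [hD, connectedComponentIn_eq hcD]
      exact hCp'.subset_connectedComponentIn hcC' hC' hqC'
    refine ⟨N, hN, hsub, fun q hq hq0 => ?_⟩
    have h3 := h2 q hq hq0
    rw [mem_closure_iff_nhds] at h3 ⊢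
    intro t ht
    obtain ⟨y, hy, hy'⟩ := h3 (t ∩ N) (Filter.inter_mem ht (hNo.mem_nhds hq))
    exact ⟨y, hy.1, hsub ⟨hy.2, hy'⟩⟩
  -- Without a direction of increase w is a unit normal at p, so w = ±ν p. If w = ν p, points near p
  -- lie outside the cap. If w = -ν p, a punctured neighbourhood lies in the cap, and for n ≥ 2 it
  -- can be taken connected.
  · right
    push Not at hreg
    have hun := hx.isUnitNormal_of_forall_nonpos hp0 hreg
    obtain ⟨U, hU, hneg⟩ := hν.exists_nhds_height_neg hx hc p
    have hpU := mem_of_mem_nhds hU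
    rcases hx.unitNormal_eq_or_neg (hν.unitNormal p) hun with h | h
    · exfalso
      obtain ⟨z, hz, hzD⟩ := mem_closure_iff_nhds.1 hp U hU
      have hne : p ≠ z := by
        rintro rfl
        exact hpD hzD
      have h1 := hneg p hpU z hz hne
      have h2 : 0 < inner ℝ (x z : Ambient n) (w : Ambient n) := hDcap hzD
      rw [h] at h2
      exact absurd h1 (not_lt.2 h2.le)
    · refine ⟨h, ?_⟩
      obtain ⟨N, hN, hNU, hNp⟩ := exists_nhds_punctured_preconnected hn p hU
      refine ⟨N, hN, ?_⟩
      obtain ⟨z, hz, hzD⟩ := mem_closure_iff_nhds.1 hp N hN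
      have hne : z ≠ p := by
        rintro rfl
        exact hpD hzD
      rw [hD, connectedComponentIn_eq hzD]
      refine hNp.subset_connectedComponentIn ⟨hz, hne⟩ ?_
      rintro q ⟨hq, hqp⟩
      have h1 := hneg p hpU q (hNU hq) (Ne.symm hqp)
      change 0 < inner ℝ (x q : Ambient n) (w : Ambient n)
      rw [h, inner_neg_right]
      exact neg_pos.2 h1

/-- This is the hypothesis `hopen` of `eventually_connectedComponentIn_subset` with K the closure of
a component. -/
theorem IsConvexNormal.closure_component_open (hν : IsConvexNormal x ν) (hx : IsC2Immersion x)
    (hc : Continuous ν) (hn : 2 ≤ n) {w : Sph n} {p₀ p : M₀}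
    (hp : p ∈ closure (connectedComponentIn (cap x w) p₀)) :
    ∃ N ∈ 𝓝 p, ∀ q ∈ N, 0 ≤ inner ℝ (x q : Ambient n) (w : Ambient n) →
      q ∈ closure (connectedComponentIn (cap x w) p₀) := by
  have : LocallyConnectedSpace M₀ := ChartedSpace.locallyConnectedSpace (Coord n) M₀
  by_cases hpD : p ∈ connectedComponentIn (cap x w) p₀
  · exact ⟨_, (isOpen_cap hx.continuous _).connectedComponentIn.mem_nhds hpD,
      fun q hq _ => subset_closure hq⟩
  · obtain ⟨-, ⟨e, -, N, hN, -, h⟩ | ⟨-, N, hN, h⟩⟩ :=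
      hν.closure_component_cases hx hc hn hp hpD
    · exact ⟨N, hN, h⟩
    · refine ⟨N, hN, fun q hq _ => ?_⟩
      by_cases hqp : q = p
      · rw [hqp]
        exact hp
      · exact subset_closure (h ⟨hq, hqp⟩)

end Component

/-! ### Two sheets touching from the same side -/

section DoublePoints

variable {n : ℕ} {M₀ : Type*} [TopologicalSpace M₀]
  [ChartedSpace (EuclideanSpace ℝ (Fin n)) M₀] {x ν : M₀ → Sph n} [IsManifold (𝓡 n) 2 M₀]

theorem IsC2Immersion.eq_zero_of_orthogonal (hx : IsC2Immersion x) {p : M₀} {μ : Sph n}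
    (hμ : IsUnitNormal x p μ) {y : Ambient n} (h1 : inner ℝ y (x p : Ambient n) = 0)
    (h2 : inner ℝ y (μ : Ambient n) = 0) (h3 : ∀ v, inner ℝ y (jac x p v) = 0) : y = 0 := by
  obtain ⟨b, hb⟩ := hx.eq_smul_normal hμ h1 h3
  rw [hb, inner_smul_left, inner_self_sph] at h2
  have hb0 : b = 0 := by simpa using h2
  rw [hb, hb0, zero_smul]

/-- A curve through `r` whose image has prescribed tangential components with respect to a frame
at a point `p` at which `x` and `ν` have the same values as at `r`. -/
theorem IsConvexNormal.exists_tangential_curve (hν : IsConvexNormal x ν) (hx : IsC2Immersion x)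
    {p r : M₀} (hxr : x r = x p) (hνr : ν r = ν p) {V : Coord n} (hV : V ≠ 0) :
    ∃ a : ℝ → M₀, Filter.Tendsto a (𝓝[>] 0) (𝓝 r) ∧ (∀ᶠ s in 𝓝[>] (0 : ℝ), a s ≠ r) ∧
      (∀ w : Ambient n, inner ℝ (x r : Ambient n) w = 0 → 0 < inner ℝ w (jac x p V) →
        ∀ᶠ s in 𝓝[>] (0 : ℝ), 0 < inner ℝ (x (a s) : Ambient n) w) ∧
      ∀ᶠ s in 𝓝[>] (0 : ℝ), ∀ Z, inner ℝ (x (a s) : Ambient n) (jac x p Z) =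
        s * inner ℝ (jac x p V) (jac x p Z) := by
  -- The adjoint of `jac x p` records tangential components at p. Position and normal at r and p
  -- agree, hence so do the tangent spaces, and `Lp` composed with x is a local diffeomorphism at r.
  -- The curve is the preimage of a ray from the origin.
  set Lp : Ambient n →L[ℝ] Coord n := ContinuousLinearMap.adjoint (jac x p) with hLp
  have hL : ∀ y Z, inner ℝ (Lp y) Z = inner ℝ y (jac x p Z) := fun y Z =>
    ContinuousLinearMap.adjoint_inner_left _ _ _
  have hLzero : ∀ y, inner ℝ y (x p : Ambient n) = 0 → inner ℝ y (ν p : Ambient n) = 0 →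
      Lp y = 0 → y = 0 := by
    intro y h1 h2 h3
    refine hx.eq_zero_of_orthogonal (hν.unitNormal p) h1 h2 fun v => ?_
    rw [← hL, h3, inner_zero_left]
  have hjx : ∀ V', inner ℝ (jac x r V') (x p : Ambient n) = 0 := by
    intro V'
    rw [real_inner_comm, ← hxr]
    exact hx.inner_jac_self r V'
  have hjν : ∀ V', inner ℝ (jac x r V') (ν p : Ambient n) = 0 := by
    intro V'
    rw [real_inner_comm, ← hνr]
    exact hν.inner_jac hx r V'
  have hpx : inner ℝ (jac x p V) (x p : Ambient n) = 0 := by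
    rw [real_inner_comm]
    exact hx.inner_jac_self p V
  have hpν : inner ℝ (jac x p V) (ν p : Ambient n) = 0 := by
    rw [real_inner_comm]
    exact hν.inner_jac hx p V
  set A : Coord n →L[ℝ] Coord n := Lp.comp (jac x r) with hA
  have hinj : Function.Injective A := by
    rw [injective_iff_map_eq_zero]
    intro v hv
    have := hLzero (jac x r v) (hjx v) (hjν v) hv
    exact hx.jac_injective r (by rw [this, map_zero])
  let Ae : Coord n ≃L[ℝ] Coord n :=
    (LinearEquiv.ofInjectiveEndo (A : Coord n →ₗ[ℝ] Coord n) hinj).toContinuousLinearEquiv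
  have hAe : ∀ v, Ae v = A v := fun v => rfl
  have hAe' : (Ae : Coord n →L[ℝ] Coord n) = A := by
    ext1 v
    rfl
  set u₀ := chartAt (Coord n) r r with hu₀
  have hΦ : HasStrictFDerivAt (fun u => Lp (inChart x r u)) (Ae : Coord n →L[ℝ] Coord n) u₀ := by
    rw [hAe']
    exact Lp.hasStrictFDerivAt.comp u₀ ((hx.contDiffAt_center r).hasStrictFDerivAt (by norm_num))
  set ψ := hΦ.localInverse (fun u => Lp (inChart x r u)) Ae u₀ with hψ
  have hψd : HasFDerivAt ψ (Ae.symm : Coord n →L[ℝ] Coord n) (Lp (inChart x r u₀)) :=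
    hΦ.to_localInverse.hasFDerivAt
  have hψ0 : ψ (Lp (inChart x r u₀)) = u₀ := hΦ.localInverse_apply_image
  have hψr : ∀ᶠ z in 𝓝 (Lp (inChart x r u₀)), Lp (inChart x r (ψ z)) = z :=
    hΦ.eventually_right_inverse
  set c := Lp (jac x p V) with hcdef
  have hc0 : c ≠ 0 := by
    intro h
    have h1 := hLzero _ hpx hpν h
    exact hV (hx.jac_injective p (by rw [h1, map_zero]))
  have hdir : jac x r (Ae.symm c) = jac x p V := by
    have h1 : A (Ae.symm c) = c := by rw [← hAe, Ae.apply_symm_apply]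
    rw [← sub_eq_zero]
    apply hLzero
    · rw [inner_sub_left, hjx, hpx, sub_zero]
    · rw [inner_sub_left, hjν, hpν, sub_zero]
    · rw [map_sub, sub_eq_zero]
      exact h1
  have hL0 : Lp (inChart x r u₀) = 0 := by
    refine ext_inner_right ℝ fun Z => ?_
    rw [hL, hu₀, inChart_center, hxr, hx.inner_jac_self, inner_zero_left]
  have hψt : Filter.Tendsto (fun s : ℝ => ψ (Lp (inChart x r u₀) + s • c)) (𝓝[>] 0) (𝓝 u₀) := by
    have h1 := hψd.continuousAt.tendsto
    rw [hψ0] at h1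
    exact h1.comp (tendsto_ray _ c)
  refine ⟨fun s => (chartAt (Coord n) r).symm (ψ (Lp (inChart x r u₀) + s • c)), ?_, ?_, ?_, ?_⟩
  · exact (tendsto_chartAt_symm_center r).comp hψt
  · filter_upwards [(tendsto_ray _ c).eventually hψr, hψt.eventually (eventually_chart_target r),
      self_mem_nhdsWithin] with s hs1 hs2 hs3 heq
    have h1 := (chartAt (Coord n) r).right_inv hs2
    rw [heq] at h1
    rw [← h1, ← hu₀, left_eq_add, smul_eq_zero] at hs1
    rcases hs1 with h | h
    · exact (ne_of_gt hs3) h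
    · exact hc0 h
  · intro w hw hpos
    have hf : HasFDerivAt (inChart x r) (jac x r) (ψ (Lp (inChart x r u₀))) := by
      rw [hψ0]
      exact hx.hasFDerivAt_center r
    have h1 := ((innerSL ℝ w).hasFDerivAt).comp _ (hf.comp _ hψd)
    have h2 := eventually_pos_ray (V := c) h1 (by
      simp only [ContinuousLinearMap.comp_apply, innerSL_apply_apply]
      erw [hdir]
      exact hpos)
    filter_upwards [h2] with s hs
    have h0 : inner ℝ w (inChart x r u₀) = 0 := by
      rw [hu₀, inChart_center, real_inner_comm]
      exact hw
    simp only [Function.comp, innerSL_apply_apply, hψ0, h0] at hs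
    rw [real_inner_comm]
    exact hs
  · filter_upwards [(tendsto_ray _ c).eventually hψr] with s hs Z
    have h1 : inner ℝ (Lp (inChart x r (ψ (Lp (inChart x r u₀) + s • c)))) Z =
        s * inner ℝ (jac x p V) (jac x p Z) := by
      rw [hs, hL0, zero_add, inner_smul_left, hcdef, hL]
      rfl
    rw [hL] at h1
    exact h1

/-- Used for a difference l x p + m ν p of two unit vectors near x p. Being orthogonal to their sum,
it satisfies the first equation, which forces |l| ≤ |m| / 4. The terms with l are then too small to
matter, and the last two inequalities require opposite signs of m. -/
theorem sheets_arithmetic {l m k₁ k₂ a₁ a₂ b₁ b₂ : ℝ} (h : l * k₁ + m * k₂ = 0) (hk₁ : 1 < k₁)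
    (hk₂ : |k₂| < 1 / 4) (ha₁ : |a₁| < 1 / 4) (ha₂ : 1 / 2 < a₂) (hb₁ : |b₁| < 1 / 4)
    (hb₂ : 1 / 2 < b₂) (hpos : 0 < l * a₁ + m * a₂) (hneg : l * b₁ + m * b₂ < 0) : False := by
  have hl : |l| ≤ |m| / 4 := by
    have h1 : |l * k₁| = |m * k₂| := by
      rw [← abs_neg (m * k₂)]
      congr 1
      linarith
    rw [abs_mul, abs_mul, abs_of_pos (by linarith : 0 < k₁)] at h1
    nlinarith [abs_nonneg l, abs_nonneg m]
  have hla : |l * a₁| ≤ |m| / 16 := by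
    rw [abs_mul]
    nlinarith [abs_nonneg l, abs_nonneg m, abs_nonneg a₁]
  have hlb : |l * b₁| ≤ |m| / 16 := by
    rw [abs_mul]
    nlinarith [abs_nonneg l, abs_nonneg m, abs_nonneg b₁]
  rw [abs_le] at hla hlb
  rcases le_total 0 m with hm | hm
  · rw [abs_of_nonneg hm] at hla hlb
    nlinarith
  · rw [abs_of_nonpos hm] at hla hlb
    nlinarith

/-- Two sheets of the hypersurface which touch from the same side cannot lie strictly inside each
other's tangent hemispheres. -/
theorem IsConvexNormal.not_eventually_height_neg (hν : IsConvexNormal x ν) (hx : IsC2Immersion x)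
    (hc : Continuous ν) {p q : M₀} (hxq : x q = x p) (hνq : ν q = ν p) {V : Coord n}
    {a b : ℝ → M₀} (ha : Filter.Tendsto a (𝓝[>] 0) (𝓝 p)) (hb : Filter.Tendsto b (𝓝[>] 0) (𝓝 q))
    (ha' : ∀ᶠ s in 𝓝[>] (0 : ℝ), ∀ Z, inner ℝ (x (a s) : Ambient n) (jac x p Z) =
        s * inner ℝ (jac x p V) (jac x p Z))
    (hb' : ∀ᶠ s in 𝓝[>] (0 : ℝ), ∀ Z, inner ℝ (x (b s) : Ambient n) (jac x p Z) =
        s * inner ℝ (jac x p V) (jac x p Z))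
    (hneg : ∀ᶠ s in 𝓝[>] (0 : ℝ), height x ν (a s) (b s) < 0 ∧ height x ν (b s) (a s) < 0) :
    False := by
  have cx := continuous_subtype_val.comp hx.continuous
  have cν := continuous_subtype_val.comp hc
  have txa : Filter.Tendsto (fun s => (x (a s) : Ambient n)) (𝓝[>] 0) (𝓝 (x p : Ambient n)) :=
    (cx.tendsto p).comp ha
  have txb : Filter.Tendsto (fun s => (x (b s) : Ambient n)) (𝓝[>] 0) (𝓝 (x p : Ambient n)) := by
    rw [← hxq]
    exact (cx.tendsto q).comp hb
  have tνa : Filter.Tendsto (fun s => (ν (a s) : Ambient n)) (𝓝[>] 0) (𝓝 (ν p : Ambient n)) :=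
    (cν.tendsto p).comp ha
  have tνb : Filter.Tendsto (fun s => (ν (b s) : Ambient n)) (𝓝[>] 0) (𝓝 (ν p : Ambient n)) := by
    rw [← hνq]
    exact (cν.tendsto q).comp hb
  have t1 := (txa.add txb).inner (𝕜 := ℝ)
    (tendsto_const_nhds (x := (x p : Ambient n)) (f := 𝓝[>] (0 : ℝ)))
  have t2 := ((txa.add txb).inner (𝕜 := ℝ)
    (tendsto_const_nhds (x := (ν p : Ambient n)) (f := 𝓝[>] (0 : ℝ)))).abs
  have t3 := ((tendsto_const_nhds (x := (x p : Ambient n)) (f := 𝓝[>] (0 : ℝ))).inner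
    (𝕜 := ℝ) tνa).abs
  have t4 := (tendsto_const_nhds (x := (ν p : Ambient n)) (f := 𝓝[>] (0 : ℝ))).inner (𝕜 := ℝ) tνa
  have t5 := ((tendsto_const_nhds (x := (x p : Ambient n)) (f := 𝓝[>] (0 : ℝ))).inner
    (𝕜 := ℝ) tνb).abs
  have t6 := (tendsto_const_nhds (x := (ν p : Ambient n)) (f := 𝓝[>] (0 : ℝ))).inner (𝕜 := ℝ) tνb
  have e1 := hν.inner_self p
  simp only [inner_add_left, inner_self_sph, e1] at t1 t2 t3 t4 t5 t6
  obtain ⟨s, hs⟩ := ((((t1.eventually_const_lt (u := 1) (by norm_num)).and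
    (t2.eventually_lt_const (u := 1 / 4) (by norm_num))).and
    ((t3.eventually_lt_const (u := 1 / 4) (by norm_num)).and
    (t4.eventually_const_lt (u := 1 / 2) (by norm_num)))).and
    (((t5.eventually_lt_const (u := 1 / 4) (by norm_num)).and
    (t6.eventually_const_lt (u := 1 / 2) (by norm_num))).and
    ((ha'.and hb').and hneg))).exists
  obtain ⟨⟨⟨k1, k2⟩, k3, k4⟩, ⟨k5, k6⟩, ⟨k7, k8⟩, k9, k10⟩ := hs
  -- The two points have equal tangential components at p, so their difference has no tangential
  -- part W. Paired with the two normals it gives -height(a, b) > 0 and height(b, a) < 0.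
  obtain ⟨l, W, m, hd⟩ := hx.exists_decomposition (hν.unitNormal p)
    ((x (a s) : Ambient n) - (x (b s) : Ambient n))
  have hW : jac x p W = 0 := by
    have h1 := congrArg (fun y => inner ℝ y (jac x p W)) hd
    simp only [inner_sub_left, inner_add_left, inner_smul_left, k7, k8, hx.inner_jac_self,
      hν.inner_jac hx] at h1
    apply inner_self_eq_zero (𝕜 := ℝ).1
    simpa using h1.symm
  rw [hW, add_zero] at hd
  have hsum := congrArg (fun y => inner ℝ y ((x (a s) : Ambient n) + (x (b s) : Ambient n))) hd
  have hAa := congrArg (fun y => inner ℝ y (ν (a s) : Ambient n)) hd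
  have hAb := congrArg (fun y => inner ℝ y (ν (b s) : Ambient n)) hd
  have e2 := hν.inner_self (a s)
  have e3 := hν.inner_self (b s)
  have e4 := real_inner_comm (x (a s) : Ambient n) (x (b s) : Ambient n)
  have c1 := real_inner_comm (x p : Ambient n) (x (a s) : Ambient n)
  have c2 := real_inner_comm (x p : Ambient n) (x (b s) : Ambient n)
  have c3 := real_inner_comm (ν p : Ambient n) (x (a s) : Ambient n)
  have c4 := real_inner_comm (ν p : Ambient n) (x (b s) : Ambient n)
  simp only [inner_sub_left, inner_add_left, inner_add_right, inner_smul_left, inner_self_sph,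
    conj_trivial, e2, e3] at hsum hAa hAb
  unfold height at k9 k10
  refine sheets_arithmetic (l := l) (m := m) ?_ k1 k2 k3 k4 k5 k6 ?_ ?_
  · rw [← c1, ← c2, ← c3, ← c4] at *
    linarith
  · linarith
  · linarith

end DoublePoints

/-! ### Strictness passes from a component to its closure -/

section StrictConvexity

variable {n : ℕ} {M₀ : Type*} [TopologicalSpace M₀] {x ν : M₀ → Sph n}

theorem inner_nonneg_of_mem_closure (hx : Continuous x) {w : Ambient n} {p₀ p : M₀}
    (hp : p ∈ closure (connectedComponentIn (cap x w) p₀)) :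
    0 ≤ inner ℝ (x p : Ambient n) w :=
  closure_minimal (s := connectedComponentIn (cap x w) p₀)
    (t := {q | 0 ≤ inner ℝ (x q : Ambient n) w})
    (fun q hq => (show 0 < inner ℝ (x q : Ambient n) w from
      connectedComponentIn_subset (cap x w) p₀ hq).le)
    (isClosed_le continuous_const (continuous_inner_sph hx w)) hp

variable [ChartedSpace (EuclideanSpace ℝ (Fin n)) M₀]

theorem IsConvexNormal.height_nonpos_of_mem_closure (hν : IsConvexNormal x ν) (hx : Continuous x)
    (hc : Continuous ν) {D : Set M₀} (hD : D ×ˢ D ⊆ strictPairs x ν) {p q : M₀}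
    (hp : p ∈ closure D) (hq : q ∈ closure D) : height x ν p q ≤ 0 := by
  have h : (p, q) ∈ closure (D ×ˢ D) := by
    rw [closure_prod_eq]
    exact ⟨hp, hq⟩
  exact closure_minimal (fun z hz => hν.height_nonpos (hD hz))
    (isClosed_le (continuous_height hx hc) continuous_const) h

variable [IsManifold (𝓡 n) 2 M₀]

/-- The weak inequalities against w and ν p₀ hold for x p and for -x p, so x p is orthogonal to both
and lies on the tangent sphere at p₀ away from x p₀. By `IsConvexNormal.exists_inner_pos` it is then
strictly outside the tangent hemisphere at some point of the component. -/
theorem IsConvexNormal.height_ne_zero_of_antipodal (hν : IsConvexNormal x ν)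
    (hx : IsC2Immersion x) (hc : Continuous ν) (hn : 1 ≤ n) {w : Sph n} {p₀ : M₀} {a b : ℝ}
    (hw : (w : Ambient n) = a • (ν p₀ : Ambient n) + b • (x p₀ : Ambient n)) (hb : 0 < b)
    (hD : connectedComponentIn (cap x w) p₀ ×ˢ connectedComponentIn (cap x w) p₀ ⊆
      strictPairs x ν) {p q : M₀}
    (hp : p ∈ closure (connectedComponentIn (cap x w) p₀))
    (hq : q ∈ closure (connectedComponentIn (cap x w) p₀))
    (hpq : (x q : Ambient n) = -x p) : False := by
  have : LocallyConnectedSpace M₀ := ChartedSpace.locallyConnectedSpace (Coord n) M₀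
  have hp₀ : p₀ ∈ cap x w := by
    change 0 < inner ℝ (x p₀ : Ambient n) (w : Ambient n)
    rw [hw, inner_add_right, inner_smul_right, inner_smul_right, hν.inner_self, inner_self_sph]
    simpa using hb
  have hD₀ := mem_connectedComponentIn hp₀
  have hle : ∀ {s t}, s ∈ closure (connectedComponentIn (cap x w) p₀) →
      t ∈ closure (connectedComponentIn (cap x w) p₀) → height x ν s t ≤ 0 :=
    fun hs ht => hν.height_nonpos_of_mem_closure hx.continuous hc hD hs ht
  have h1 := inner_nonneg_of_mem_closure hx.continuous hp
  have h2 := inner_nonneg_of_mem_closure hx.continuous hq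
  have h3 := hle (subset_closure hD₀) hp
  have h4 := hle (subset_closure hD₀) hq
  rw [height] at h3 h4
  rw [hpq, inner_neg_left] at h2 h4
  have h5 : inner ℝ (x p : Ambient n) (ν p₀ : Ambient n) = 0 := by linarith
  have h6 : inner ℝ (x p : Ambient n) (w : Ambient n) = 0 := by linarith
  rw [hw, inner_add_right, inner_smul_right, inner_smul_right, h5, mul_zero, zero_add,
    mul_eq_zero] at h6
  have hne : x p ≠ x p₀ := by
    intro h
    rcases h6 with h6 | h6
    · exact hb.ne' h6
    · rw [h, inner_self_sph] at h6
      exact one_ne_zero h6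
  obtain ⟨s, hs, hs'⟩ := hν.exists_inner_pos hx hc hn h5 hne
    ((isOpen_cap hx.continuous (w : Ambient n)).connectedComponentIn.mem_nhds hD₀)
  exact absurd (hle (subset_closure hs) hp) (not_le.2 hs')

/-- If x q were on the tangent sphere at p, moving p in a direction V with L V > 0 would place x q
outside a tangent hemisphere. This contradicts the weak inequality as soon as V points into the
component, so such a V is sought for each type of point p. -/
theorem IsConvexNormal.height_ne_zero_of_independent (hν : IsConvexNormal x ν)
    (hx : IsC2Immersion x) (hc : Continuous ν) (hn : 2 ≤ n) {w : Sph n} {p₀ : M₀}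
    (hD : connectedComponentIn (cap x w) p₀ ×ˢ connectedComponentIn (cap x w) p₀ ⊆
      strictPairs x ν) {p q : M₀}
    (hp : p ∈ closure (connectedComponentIn (cap x w) p₀))
    (hq : q ∈ closure (connectedComponentIn (cap x w) p₀))
    (hne : x q ≠ x p) (hne' : (x q : Ambient n) ≠ -x p) : height x ν p q ≠ 0 := by
  have : LocallyConnectedSpace M₀ := ChartedSpace.locallyConnectedSpace (Coord n) M₀
  intro h0
  obtain ⟨a, Y, L, hY, hY0, hL, hLY⟩ := hν.exists_fderiv_pos hx hc h0 hne hne'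
  suffices h : ∃ V, 0 < L V ∧ ∀ᶠ s in 𝓝[>] (0 : ℝ),
      chartRay p V s ∈ connectedComponentIn (cap x w) p₀ by
    obtain ⟨V, hV, hV'⟩ := h
    obtain ⟨s, hs, hs'⟩ := ((eventually_lt_chartRay
      (g := fun z => inner ℝ (x q : Ambient n) (ν z : Ambient n)) hL hV).and hV').exists
    have h1 := hν.height_nonpos_of_mem_closure hx.continuous hc hD (subset_closure hs') hq
    rw [height] at h0 h1
    rw [h0] at hs
    exact absurd h1 (not_le.2 hs)
  by_cases hpD : p ∈ connectedComponentIn (cap x w) p₀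
  · exact ⟨Y, hLY, (tendsto_chartRay p Y).eventually
      ((isOpen_cap hx.continuous (w : Ambient n)).connectedComponentIn.mem_nhds hpD)⟩
  obtain ⟨hGp, ⟨e, he, N, hN, hND, -⟩ | ⟨-, N, hN, hND⟩⟩ :=
    hν.closure_component_cases hx hc hn hp hpD
  -- As x q is in the closed hemisphere, Y points weakly into the cap. Adding ε e makes it point
  -- strictly inward, and ε is so small that ε |L e| < L Y.
  · have hGq := inner_nonneg_of_mem_closure hx.continuous hq
    rw [hY, inner_add_left, inner_smul_left, hGp, mul_zero, zero_add, real_inner_comm] at hGq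
    obtain ⟨ε, hε, hLε⟩ : ∃ ε > 0, 0 < L Y + ε * L e := by
      refine ⟨L Y / (2 * (|L e| + 1)), by positivity, ?_⟩
      have h2 : L Y / (2 * (|L e| + 1)) * |L e| < L Y := by
        rw [div_mul_eq_mul_div, div_lt_iff₀ (by positivity)]
        nlinarith [abs_nonneg (L e)]
      have h3 : -(L Y / (2 * (|L e| + 1)) * |L e|) ≤ L Y / (2 * (|L e| + 1)) * L e := by
        rw [← mul_neg]
        exact mul_le_mul_of_nonneg_left (neg_abs_le _) (by positivity)
      linarith
    refine ⟨Y + ε • e, by simpa using hLε, ?_⟩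
    have h1 := eventually_lt_chartRay (V := Y + ε • e)
      (g := fun z => inner ℝ (w : Ambient n) (x z : Ambient n)) (hx.hasFDerivAt_inner p w) (by
        simp only [ContinuousLinearMap.comp_apply, innerSL_apply_apply, map_add, map_smul,
          smul_eq_mul]
        have := mul_pos hε he
        linarith)
    filter_upwards [h1, (tendsto_chartRay p (Y + ε • e)).eventually hN] with s hs hs'
    refine hND ⟨hs', ?_⟩
    change 0 < inner ℝ (x _ : Ambient n) (w : Ambient n)
    rw [real_inner_comm] at hGp ⊢
    rwa [hGp] at hs
  · refine ⟨Y, hLY, ?_⟩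
    filter_upwards [eventually_chartRay_ne p hY0, (tendsto_chartRay p Y).eventually hN]
      with s hs hs'
    exact hND ⟨hs', hs⟩

/-- A case of Farkas' lemma: f must vanish on the kernel of g, since otherwise adding kernel vectors
to e would make f positive where g is positive. -/
theorem exists_eq_neg_mul_of_pos_imp_nonpos {E : Type*} [AddCommGroup E] [Module ℝ E]
    (f g : E →ₗ[ℝ] ℝ) (h : ∀ v, 0 < g v → f v ≤ 0) {e : E} (he : 0 < g e) :
    ∃ κ : ℝ, 0 ≤ κ ∧ ∀ v, f v = -κ * g v := by
  have hker : ∀ v, g v = 0 → f v ≤ 0 := by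
    intro v hv
    by_contra hcon
    rw [not_le] at hcon
    -- The coefficient gives f the value 1 at this vector.
    have h1 := h (e + ((1 - f e) / f v) • v) (by simpa [hv] using he)
    rw [map_add, map_smul, smul_eq_mul, div_mul_cancel₀ _ hcon.ne'] at h1
    linarith
  have hker' : ∀ v, g v = 0 → f v = 0 := by
    intro v hv
    have h1 := hker v hv
    have h2 := hker (-v) (by simp [hv])
    rw [map_neg] at h2
    linarith
  refine ⟨-(f e / g e), ?_, fun v => ?_⟩
  · rw [← neg_div]
    exact div_nonneg (neg_nonneg.2 (h e he)) he.le
  · have h1 := hker' (v - (g v / g e) • e) (by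
      rw [map_sub, map_smul, smul_eq_mul, div_mul_cancel₀ _ he.ne', sub_self])
    rw [map_sub, map_smul, smul_eq_mul] at h1
    field_simp at h1 ⊢
    linarith

/-- The height takes both signs along ±e, and a small punctured neighbourhood is connected for n ≥
2, so the intermediate value theorem applies without passing through p. -/
theorem IsC2Immersion.exists_inner_eq_zero (hx : IsC2Immersion x) (hn : 2 ≤ n) {p : M₀}
    {w : Ambient n} (hp : inner ℝ (x p : Ambient n) w = 0) {e : Coord n}
    (he : 0 < inner ℝ w (jac x p e)) {U : Set M₀} (hU : U ∈ 𝓝 p) :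
    ∃ z ∈ U, z ≠ p ∧ inner ℝ (x z : Ambient n) w = 0 := by
  obtain ⟨N, hN, hNU, hpre⟩ := exists_nhds_punctured_preconnected hn p hU
  have he0 : e ≠ 0 := by
    rintro rfl
    simp at he
  obtain ⟨s, hs1, hs2, hs3⟩ := ((eventually_chartRay_ne p he0).and
    (((tendsto_chartRay p e).eventually hN).and (eventually_lt_chartRay (V := e)
      (g := fun z => inner ℝ w (x z : Ambient n)) (hx.hasFDerivAt_inner p w) he))).exists
  obtain ⟨t, ht1, ht2, ht3⟩ := ((eventually_chartRay_ne p (neg_ne_zero.2 he0)).and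
    (((tendsto_chartRay p (-e)).eventually hN).and (eventually_lt_chartRay (V := -e)
      (g := fun z => inner ℝ (-w) (x z : Ambient n)) (hx.hasFDerivAt_inner p (-w)) (by
        simpa using he)))).exists
  have hp' : inner ℝ w (x p : Ambient n) = 0 := by rw [real_inner_comm, hp]
  rw [hp'] at hs3
  simp only [inner_neg_left, hp'] at ht3
  obtain ⟨z, hz, hz'⟩ := hpre.intermediate_value ⟨ht2, ht1⟩ ⟨hs2, hs1⟩
    ((continuous_inner_sph hx.continuous w).continuousOn)
    (show (0 : ℝ) ∈ _ from ⟨by rw [real_inner_comm]; linarith, by rw [real_inner_comm]; linarith⟩)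
  exact ⟨z, hNU hz.1, hz.2, hz'⟩

section DoublePoint

variable {w : Sph n} {p₀ p q : M₀}

/-- All points near p lie on the nonpositive side of ν q, so ν q is normal at p, hence ±ν p; local
strict convexity at p rules out the minus sign. -/
theorem IsConvexNormal.normal_eq_of_critical (hν : IsConvexNormal x ν) (hx : IsC2Immersion x)
    (hc : Continuous ν) (hn : 1 ≤ n) {D : Set M₀} (hD : D ×ˢ D ⊆ strictPairs x ν)
    (hq : q ∈ closure D) (hxq : x q = x p) {N : Set M₀} (hN : N ∈ 𝓝 p) (hND : N \ {p} ⊆ D) :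
    ν q = ν p := by
  have h0 : inner ℝ (ν q : Ambient n) (x p : Ambient n) = 0 := by
    rw [← hxq, real_inner_comm, hν.inner_self]
  have hle : ∀ z ∈ D, inner ℝ (ν q : Ambient n) (x z : Ambient n) ≤ 0 := by
    intro z hz
    have := hν.height_nonpos_of_mem_closure hx.continuous hc hD hq (subset_closure hz)
    rwa [height, real_inner_comm] at this
  have hray : ∀ V : Coord n, V ≠ 0 → ∀ᶠ s in 𝓝[>] (0 : ℝ), chartRay p V s ∈ D := by
    intro V hV
    filter_upwards [eventually_chartRay_ne p hV, (tendsto_chartRay p V).eventually hN] with s hs hs'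
    exact hND ⟨hs', hs⟩
  have hunit : IsUnitNormal x p (ν q) := by
    refine hx.isUnitNormal_of_forall_nonpos (by rw [real_inner_comm, h0]) fun V => ?_
    by_contra hcon
    rw [not_le] at hcon
    have hV : V ≠ 0 := by
      rintro rfl
      simp at hcon
    obtain ⟨s, hs, hs'⟩ := ((hray V hV).and (eventually_lt_chartRay (V := V)
      (g := fun z => inner ℝ (ν q : Ambient n) (x z : Ambient n))
      (hx.hasFDerivAt_inner p (ν q)) hcon)).exists
    rw [h0] at hs'
    exact absurd (hle _ hs) (not_le.2 hs')
  rcases hx.unitNormal_eq_or_neg (hν.unitNormal p) hunit with h | h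
  · exact Subtype.ext h
  · exfalso
    obtain ⟨W, hW, hneg⟩ := hν.exists_nhds_height_neg hx hc p
    obtain ⟨V, hV⟩ : ∃ v : Coord n, v ≠ 0 :=
      ⟨EuclideanSpace.single (⟨0, hn⟩ : Fin n) (1 : ℝ), by simp⟩
    obtain ⟨s, hs, hs', hs''⟩ := ((hray V hV).and
      ((eventually_chartRay_ne p hV).and ((tendsto_chartRay p V).eventually hW))).exists
    have h1 := hle _ hs
    have h2 := hneg p (mem_of_mem_nhds hW) _ hs'' hs'.symm
    rw [h, inner_neg_left, real_inner_comm] at h1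
    rw [height] at h2
    linarith

/-- Near p the component fills the side where ⟨x, w⟩ > 0, and ν q is nonpositive there. So ν q
equals -κ w on the tangent space at p, and ν q + κ w is a multiple α of ν p. A nearby zero of ⟨x, w⟩
other than p excludes α < 0. If α = 0, pairing with the image of e' at q gives κ = 0 and then ν q =
0. -/
theorem IsConvexNormal.normal_add_smul_eq_of_regular (hν : IsConvexNormal x ν)
    (hx : IsC2Immersion x) (hc : Continuous ν) (hn : 2 ≤ n)
    (hD : connectedComponentIn (cap x w) p₀ ×ˢ connectedComponentIn (cap x w) p₀ ⊆
      strictPairs x ν)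
    (hq : q ∈ closure (connectedComponentIn (cap x w) p₀)) (hxq : x q = x p)
    (hGp : inner ℝ (x p : Ambient n) (w : Ambient n) = 0)
    {e : Coord n} (he : 0 < inner ℝ (w : Ambient n) (jac x p e))
    {N : Set M₀} (hN : N ∈ 𝓝 p) (hND : N ∩ cap x w ⊆ connectedComponentIn (cap x w) p₀)
    (hN' : ∀ q ∈ N, 0 ≤ inner ℝ (x q : Ambient n) (w : Ambient n) →
      q ∈ closure (connectedComponentIn (cap x w) p₀))
    {e' : Coord n} (he' : 0 < inner ℝ (w : Ambient n) (jac x q e')) :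
    ∃ κ α : ℝ, 0 ≤ κ ∧ 0 < α ∧ (∀ v, inner ℝ (ν q : Ambient n) (jac x p v) =
      -κ * inner ℝ (w : Ambient n) (jac x p v)) ∧
      (ν q : Ambient n) + κ • (w : Ambient n) = α • (ν p : Ambient n) := by
  have h0 : inner ℝ (ν q : Ambient n) (x p : Ambient n) = 0 := by
    rw [← hxq, real_inner_comm, hν.inner_self]
  have hGp' : inner ℝ (w : Ambient n) (x p : Ambient n) = 0 := by rw [real_inner_comm, hGp]
  have hle : ∀ z ∈ closure (connectedComponentIn (cap x w) p₀),
      inner ℝ (ν q : Ambient n) (x z : Ambient n) ≤ 0 := by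
    intro z hz
    have := hν.height_nonpos_of_mem_closure hx.continuous hc hD hq hz
    rwa [height, real_inner_comm] at this
  obtain ⟨κ, hκ, hf⟩ := exists_eq_neg_mul_of_pos_imp_nonpos
    ((innerSL ℝ (ν q : Ambient n)).comp (jac x p)).toLinearMap
    ((innerSL ℝ (w : Ambient n)).comp (jac x p)).toLinearMap (fun V hV => by
      by_contra hcon
      rw [not_le] at hcon
      obtain ⟨s, hs1, hs2, hs3⟩ := (((tendsto_chartRay p V).eventually hN).and
        ((eventually_lt_chartRay (V := V)
          (g := fun z => inner ℝ (w : Ambient n) (x z : Ambient n))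
          (hx.hasFDerivAt_inner p w) hV).and (eventually_lt_chartRay (V := V)
          (g := fun z => inner ℝ (ν q : Ambient n) (x z : Ambient n))
          (hx.hasFDerivAt_inner p (ν q)) hcon))).exists
      rw [hGp', real_inner_comm] at hs2
      rw [h0] at hs3
      exact absurd (hle _ (subset_closure (hND ⟨hs1, hs2⟩))) (not_le.2 hs3)) he
  replace hf : ∀ v, inner ℝ (ν q : Ambient n) (jac x p v) =
      -κ * inner ℝ (w : Ambient n) (jac x p v) := hf
  obtain ⟨α, hα⟩ := hx.eq_smul_normal (hν.unitNormal p)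
    (y := (ν q : Ambient n) + κ • (w : Ambient n))
    (by rw [inner_add_left, inner_smul_left, h0, hGp']; simp)
    (fun v => by rw [inner_add_left, inner_smul_left, hf v]; simp)
  refine ⟨κ, α, hκ, ?_, hf, hα⟩
  rcases lt_trichotomy α 0 with h | h | h
  · exfalso
    obtain ⟨W, hW, hneg⟩ := hν.exists_nhds_height_neg hx hc p
    obtain ⟨z, hz, hzp, hGz⟩ := hx.exists_inner_eq_zero hn hGp he (Filter.inter_mem hN hW)
    have h1 := hle z (hN' z hz.1 hGz.ge)
    have h2 := hneg p (mem_of_mem_nhds hW) z hz.2 (Ne.symm hzp)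
    have h3 := congrArg (fun y => inner ℝ (x z : Ambient n) y) hα
    simp only [inner_add_right, inner_smul_right, hGz] at h3
    rw [height] at h2
    rw [real_inner_comm] at h1
    nlinarith
  · exfalso
    rw [h, zero_smul] at hα
    have h1 := congrArg (fun y => inner ℝ y (jac x q e')) hα
    simp only [inner_add_left, inner_smul_left, hν.inner_jac hx, inner_zero_left] at h1
    have hκ0 : κ = 0 := by
      rcases (by simpa using h1 : κ = 0 ∨ inner ℝ (w : Ambient n) (jac x q e') = 0) with h | h
      · exact h
      · exact absurd h he'.ne'
    rw [hκ0, zero_smul, add_zero] at hα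
    have := norm_sph (ν q)
    rw [hα, norm_zero] at this
    exact zero_ne_one this
  · exact h

variable [T2Space M₀]

/-- Within the cap a double point has height 0 and contradicts strictness at once. On the boundary
the two sheets are shown to share their normal and are then followed into the component along curves
with equal tangential components, where they would lie strictly inside each other's tangent
hemispheres. -/
theorem IsConvexNormal.not_double_point (hν : IsConvexNormal x ν) (hx : IsC2Immersion x)
    (hc : Continuous ν) (hn : 2 ≤ n)
    (hD : connectedComponentIn (cap x w) p₀ ×ˢ connectedComponentIn (cap x w) p₀ ⊆
      strictPairs x ν)
    (hp : p ∈ closure (connectedComponentIn (cap x w) p₀))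
    (hq : q ∈ closure (connectedComponentIn (cap x w) p₀)) (hxq : x q = x p) (hpq : p ≠ q) :
    False := by
  have : LocallyConnectedSpace M₀ := ChartedSpace.locallyConnectedSpace (Coord n) M₀
  set D := connectedComponentIn (cap x w) p₀ with hDdef
  have hcapD : ∀ z ∈ closure D, z ∈ cap x w → z ∈ D := fun z hz hz' =>
    mem_connectedComponentIn_of_mem_closure (isOpen_cap hx.continuous _) hz' hz
  have hcap : p ∈ cap x w ↔ q ∈ cap x w := by
    unfold cap
    change 0 < inner ℝ (x p : Ambient n) (w : Ambient n) ↔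
      0 < inner ℝ (x q : Ambient n) (w : Ambient n)
    rw [hxq]
  have hstrict : ∀ {s t}, s ∈ D → t ∈ D → s ≠ t → height x ν s t < 0 :=
    fun hs ht hne => (hD (Set.mk_mem_prod hs ht)).resolve_left hne
  have hpcap : p ∉ cap x w := by
    intro h
    have h1 := hstrict (hcapD p hp h) (hcapD q hq (hcap.1 h)) hpq
    rw [height, hxq, hν.inner_self] at h1
    exact lt_irrefl _ h1
  have hpD : p ∉ D := fun h => hpcap (connectedComponentIn_subset _ _ h)
  have hqD : q ∉ D := fun h => hpcap (hcap.2 (connectedComponentIn_subset _ _ h))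
  obtain ⟨hGp, hcp⟩ := hν.closure_component_cases hx hc hn hp hpD
  obtain ⟨hGq, hcq⟩ := hν.closure_component_cases hx hc hn hq hqD
  have hνq : ν q = ν p := by
    rcases hcp with ⟨e, he, N, hN, hND, hN'⟩ | ⟨-, N, hN, hND⟩
    · rcases hcq with ⟨e', he', N', hN₁, hND₁, hN₁'⟩ | ⟨-, N', hN₁, hND₁⟩
      · obtain ⟨κ, α, hκ, hα, hf, h1⟩ := hν.normal_add_smul_eq_of_regular hx hc hn hD hq hxq hGp he
          hN hND hN' he'
        obtain ⟨κ', α', hκ', hα', -, h2⟩ := hν.normal_add_smul_eq_of_regular hx hc hn hD hp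
          hxq.symm hGq he' hN₁ hND₁ hN₁' he
        -- Pairing with the image of e yields κ' + α' κ = 0. Since κ, κ' ≥ 0 and α' > 0, κ vanishes
        -- and the normals agree.
        have h3 := congrArg (fun y => inner ℝ y (jac x p e)) h2
        simp only [inner_add_left, inner_smul_left, hν.inner_jac hx, hf] at h3
        simp only [conj_trivial, zero_add] at h3
        have h4 : κ' + α' * κ = 0 := by
          have : (κ' + α' * κ) * inner ℝ (w : Ambient n) (jac x p e) = 0 := by linarith
          exact (mul_eq_zero.1 this).resolve_right he.ne'
        have h5 : κ = 0 := by
          by_contra h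
          have := mul_pos hα' (lt_of_le_of_ne hκ (Ne.symm h))
          linarith
        rw [h5, zero_smul, add_zero] at h1
        have h6 := norm_sph (ν q)
        rw [h1, norm_smul, norm_sph, mul_one, Real.norm_eq_abs, abs_of_pos hα] at h6
        rw [h6, one_smul] at h1
        exact Subtype.ext h1
      · exact (hν.normal_eq_of_critical hx hc (by omega) hD hp hxq.symm hN₁ hND₁).symm
    · exact hν.normal_eq_of_critical hx hc (by omega) hD hq hxq hN hND
  -- A direction along which both sheets enter D: e if both points are regular, any nonzero vector
  -- if both are critical. In a mixed case w would be normal to both sheets, hence both critical.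
  obtain ⟨V, hV, hVp, hVq⟩ : ∃ V : Coord n, V ≠ 0 ∧
      (∀ a : ℝ → M₀, Filter.Tendsto a (𝓝[>] 0) (𝓝 p) → (∀ᶠ s in 𝓝[>] (0 : ℝ), a s ≠ p) →
        (∀ w : Ambient n, inner ℝ (x p : Ambient n) w = 0 → 0 < inner ℝ w (jac x p V) →
        ∀ᶠ s in 𝓝[>] (0 : ℝ), 0 < inner ℝ (x (a s) : Ambient n) w) →
        ∀ᶠ s in 𝓝[>] (0 : ℝ), a s ∈ D) ∧
      (∀ a : ℝ → M₀, Filter.Tendsto a (𝓝[>] 0) (𝓝 q) → (∀ᶠ s in 𝓝[>] (0 : ℝ), a s ≠ q) →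
        (∀ w : Ambient n, inner ℝ (x q : Ambient n) w = 0 → 0 < inner ℝ w (jac x p V) →
        ∀ᶠ s in 𝓝[>] (0 : ℝ), 0 < inner ℝ (x (a s) : Ambient n) w) →
        ∀ᶠ s in 𝓝[>] (0 : ℝ), a s ∈ D) := by
    rcases hcp with ⟨e, he, N, hN, hND, -⟩ | ⟨hwp, N, hN, hND⟩
    · rcases hcq with ⟨e', he', N', hN₁, hND₁, -⟩ | ⟨hwq, -⟩
      · refine ⟨e, ?_, fun a ha _ h => ?_, fun a ha _ h => ?_⟩
        · rintro rfl
          simp at he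
        · filter_upwards [ha.eventually hN, h w hGp he] with s hs hs'
          exact hND ⟨hs, hs'⟩
        · filter_upwards [ha.eventually hN₁, h w hGq he] with s hs hs'
          exact hND₁ ⟨hs, hs'⟩
      · rw [hwq, hνq, inner_neg_left, hν.inner_jac hx, neg_zero] at he
        exact absurd he (lt_irrefl _)
    · rcases hcq with ⟨e', he', -⟩ | ⟨-, N', hN₁, hND₁⟩
      · rw [hwp, ← hνq, inner_neg_left, hν.inner_jac hx, neg_zero] at he'
        exact absurd he' (lt_irrefl _)
      · refine ⟨EuclideanSpace.single (⟨0, by omega⟩ : Fin n) (1 : ℝ), by simp,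
          fun a ha h _ => ?_, fun a ha h _ => ?_⟩
        · filter_upwards [ha.eventually hN, h] with s hs hs'
          exact hND ⟨hs, hs'⟩
        · filter_upwards [ha.eventually hN₁, h] with s hs hs'
          exact hND₁ ⟨hs, hs'⟩
  obtain ⟨a, ha, ha1, ha2, ha3⟩ := hν.exists_tangential_curve hx (r := p) rfl rfl hV
  obtain ⟨b, hb, hb1, hb2, hb3⟩ := hν.exists_tangential_curve hx hxq hνq hV
  refine hν.not_eventually_height_neg hx hc hxq hνq ha hb ha3 hb3 ?_
  obtain ⟨A, B, hA, hB, hpA, hqB, hAB⟩ := t2_separation hpq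
  filter_upwards [hVp a ha ha1 ha2, hVq b hb hb1 hb2, ha.eventually (hA.mem_nhds hpA),
    hb.eventually (hB.mem_nhds hqB)] with s h1 h2 h3 h4
  have hne : a s ≠ b s := fun h => Set.disjoint_left.1 hAB h3 (h ▸ h4)
  exact ⟨hstrict h1 h2 hne, hstrict h2 h1 hne.symm⟩

/-- Strict convexity of a component of a cap extends to its closure. -/
theorem IsConvexNormal.closure_subset_strictPairs (hν : IsConvexNormal x ν)
    (hx : IsC2Immersion x) (hc : Continuous ν) (hn : 2 ≤ n) {a b : ℝ}
    (hw : (w : Ambient n) = a • (ν p₀ : Ambient n) + b • (x p₀ : Ambient n)) (hb : 0 < b)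
    (hD : connectedComponentIn (cap x w) p₀ ×ˢ connectedComponentIn (cap x w) p₀ ⊆
      strictPairs x ν) :
    closure (connectedComponentIn (cap x w) p₀) ×ˢ closure (connectedComponentIn (cap x w) p₀) ⊆
      strictPairs x ν := by
  rintro ⟨p, q⟩ ⟨hp, hq⟩
  by_cases hpq : p = q
  · exact Or.inl hpq
  refine Or.inr (lt_of_le_of_ne
    (hν.height_nonpos_of_mem_closure hx.continuous hc hD hp hq) ?_)
  by_cases h1 : x q = x p
  · exact (hν.not_double_point hx hc hn hD hp hq h1 hpq).elim
  by_cases h2 : (x q : Ambient n) = -x p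
  · exact (hν.height_ne_zero_of_antipodal hx hc (by omega) hw hb hD hp hq h2).elim
  exact hν.height_ne_zero_of_independent hx hc hn hD hp hq h1 h2

end DoublePoint

end StrictConvexity

/-! ### The rotating hemisphere, n ≥ 2 -/

section Sweep

variable {n : ℕ} {M₀ : Type*} [TopologicalSpace M₀]
  [ChartedSpace (EuclideanSpace ℝ (Fin n)) M₀] {x ν : M₀ → Sph n}

/-- The point at angle `θ` on the great circle from `u` through the orthogonal point `v`. -/
def circlePoint {u v : Sph n} (h : inner ℝ (u : Ambient n) (v : Ambient n) = 0) (θ : ℝ) : Sph n :=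
  ⟨Real.cos θ • (u : Ambient n) + Real.sin θ • (v : Ambient n), by
    rw [mem_sphere_zero_iff_norm, ← sq_eq_sq₀ (norm_nonneg _) zero_le_one,
      norm_add_sq_real, norm_smul, norm_smul, norm_sph, norm_sph, inner_smul_left,
      inner_smul_right, h]
    simp⟩

/-- The pole at angle `θ` on the great circle from `ν p₀` through `x p₀`. -/
def sweepPole (hν : IsConvexNormal x ν) (p₀ : M₀) (θ : ℝ) : Sph n :=
  circlePoint (hν.unitNormal p₀).1 θ

theorem inner_sweepPole (hν : IsConvexNormal x ν) (p₀ q : M₀) (θ : ℝ) :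
    inner ℝ (x q : Ambient n) (sweepPole hν p₀ θ : Ambient n) =
      Real.cos θ * height x ν p₀ q + Real.sin θ * inner ℝ (x q : Ambient n) (x p₀ : Ambient n) := by
  rw [sweepPole, circlePoint, inner_add_right, inner_smul_right, inner_smul_right, height]

/-- The component of `p₀` in the cap at angle `θ`. -/
def sweepComponent (hν : IsConvexNormal x ν) (p₀ : M₀) (θ : ℝ) : Set M₀ :=
  connectedComponentIn (cap x (sweepPole hν p₀ θ)) p₀

theorem continuous_inner_sweepPole (hν : IsConvexNormal x ν) (hx : Continuous x) (p₀ : M₀) :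
    Continuous fun z : ℝ × M₀ => inner ℝ (x z.2 : Ambient n) (sweepPole hν p₀ z.1 : Ambient n) := by
  have h1 : Continuous fun z : ℝ × M₀ => (x z.2 : Ambient n) :=
    (continuous_subtype_val.comp hx).comp continuous_snd
  refine h1.inner ?_
  unfold sweepPole circlePoint
  fun_prop

theorem mem_cap_sweepPole (hν : IsConvexNormal x ν) (p₀ : M₀) {θ : ℝ} (h : 0 < Real.sin θ) :
    p₀ ∈ cap x (sweepPole hν p₀ θ) := by
  change 0 < inner ℝ (x p₀ : Ambient n) (sweepPole hν p₀ θ : Ambient n)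
  rw [inner_sweepPole, hν.height_self, inner_self_sph]
  simpa using h

variable [IsManifold (𝓡 n) 2 M₀] [T2Space M₀] [CompactSpace M₀]

/-- A connectedness argument in θ. The good angles form a closed set, as points of a component
persist for nearby angles. Good angles in (0, π) are interior: the closure of the component is
compact with only strict pairs, and the tube lemma gives it a neighbourhood which contains the
nearby components. At θ = 0 the point p₀ is not in the open cap, and {p₀} replaces the closure. -/
theorem IsConvexNormal.sweepComponent_strict (hν : IsConvexNormal x ν) (hx : IsC2Immersion x)
    (hc : Continuous ν) (hn : 2 ≤ n) (p₀ : M₀) {θ : ℝ} (hθ : θ ∈ Set.Ico 0 Real.pi) :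
    sweepComponent hν p₀ θ ×ˢ sweepComponent hν p₀ θ ⊆ strictPairs x ν := by
  have : LocallyPathConnectedSpace M₀ := ChartedSpace.locallyPathConnectedSpace (Coord n) M₀
  set g : ℝ → M₀ → ℝ := fun θ q => inner ℝ (x q : Ambient n) (sweepPole hν p₀ θ : Ambient n)
    with hgdef
  have hg : Continuous fun z : ℝ × M₀ => g z.1 z.2 :=
    continuous_inner_sweepPole hν hx.continuous p₀
  set S := {θ : ℝ | sweepComponent hν p₀ θ ×ˢ sweepComponent hν p₀ θ ⊆ strictPairs x ν} with hS
  have hclosed : closure S ⊆ S := by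
    rintro θ hθ ⟨p, q⟩ ⟨hp, hq⟩
    obtain ⟨θ', ⟨h1, h2⟩, h3⟩ := mem_closure_iff_nhds.1 hθ _
      ((eventually_mem_connectedComponentIn hg (q := p) hp).and
        (eventually_mem_connectedComponentIn hg (q := q) hq))
    exact h3 ⟨h1, h2⟩
  have key : ∀ θ : ℝ, ∀ K : Set M₀, IsClosed K → p₀ ∈ K →
      (∀ p ∈ K, ∃ N ∈ 𝓝 p, ∀ q ∈ N,
        0 ≤ inner ℝ (x q : Ambient n) (sweepPole hν p₀ θ : Ambient n) → q ∈ K) →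
      K ×ˢ K ⊆ strictPairs x ν → θ ∈ interior S := by
    intro θ K hK hp₀ hopen hKs
    obtain ⟨u, v, hu, hv, hKu, hKv, huv⟩ := generalized_tube_lemma hK.isCompact hK.isCompact
      (hν.isOpen_strictPairs hx hc) hKs
    rw [mem_interior_iff_mem_nhds]
    filter_upwards [eventually_connectedComponentIn_subset (g := g) hg hK hopen (hu.inter hv)
      (Set.subset_inter hKu hKv) hp₀] with θ' hθ' z hz
    exact huv ⟨(hθ' hz.1).1, (hθ' hz.2).2⟩
  have h0 : (0 : ℝ) ∈ interior S := by
    refine key 0 {p₀} isClosed_singleton rfl ?_ ?_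
    · rintro p rfl
      obtain ⟨U, hU, hneg⟩ := hν.exists_nhds_height_neg hx hc p
      refine ⟨U, hU, fun q hq h => ?_⟩
      by_contra hqp
      rw [inner_sweepPole, Real.cos_zero, Real.sin_zero, one_mul, zero_mul, add_zero] at h
      exact absurd h (not_le.2 (hneg p (mem_of_mem_nhds hU) q hq (Ne.symm hqp)))
    · rintro ⟨p, q⟩ ⟨hp, hq⟩
      exact Or.inl (hp.trans hq.symm)
  have h := isPreconnected_Ico.subset_of_closure_inter_subset (s := Set.Ico 0 Real.pi)
    (u := interior S) isOpen_interior ⟨0, ⟨le_rfl, Real.pi_pos⟩, h0⟩ ?_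
  · exact interior_subset (h hθ)
  · rintro θ ⟨hθ, hθ1, hθ2⟩
    rcases hθ1.eq_or_lt with rfl | hθ1
    · exact h0
    have hθS : θ ∈ S := hclosed (closure_mono interior_subset hθ)
    have hsin := Real.sin_pos_of_pos_of_lt_pi hθ1 hθ2
    exact key θ (closure (sweepComponent hν p₀ θ)) isClosed_closure
      (subset_closure (mem_connectedComponentIn (mem_cap_sweepPole hν p₀ hsin)))
      (fun p hp => hν.closure_component_open hx hc hn hp)
      (hν.closure_subset_strictPairs hx hc hn (w := sweepPole hν p₀ θ) rfl hsin hθS)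

/-- If the closure is never everything it is not open, so it contains a zero z θ of the height in
the direction of the pole. A limit y of z θ as θ → π lies on the tangent sphere at p₀, satisfies ⟨x
y, x p₀⟩ ≤ 0, and is weakly inside the tangent hemispheres at all points of a fixed neighbourhood N
of p₀. This contradicts `IsConvexNormal.exists_inner_pos`. -/
theorem IsConvexNormal.exists_closure_sweepComponent_eq_univ [ConnectedSpace M₀]
    (hν : IsConvexNormal x ν) (hx : IsC2Immersion x)
    (hc : Continuous ν) (hn : 2 ≤ n) (p₀ : M₀) :
    ∃ θ ∈ Set.Ioo 0 Real.pi, closure (sweepComponent hν p₀ θ) = Set.univ := by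
  have : LocallyConnectedSpace M₀ := ChartedSpace.locallyConnectedSpace (Coord n) M₀
  by_contra! hcon
  have hz : ∀ θ ∈ Set.Ioo 0 Real.pi, ∃ z ∈ closure (sweepComponent hν p₀ θ),
      inner ℝ (x z : Ambient n) (sweepPole hν p₀ θ : Ambient n) = 0 := by
    intro θ hθ
    by_contra! hne
    refine hcon θ hθ (IsClopen.eq_univ ⟨isClosed_closure, isOpen_iff_mem_nhds.2 fun p hp => ?_⟩
      ⟨p₀, subset_closure (mem_connectedComponentIn
        (mem_cap_sweepPole hν p₀ (Real.sin_pos_of_pos_of_lt_pi hθ.1 hθ.2)))⟩)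
    obtain ⟨N, hN, hN'⟩ := hν.closure_component_open hx hc hn hp
    have h1 := lt_of_le_of_ne (inner_nonneg_of_mem_closure hx.continuous hp) (hne p hp).symm
    filter_upwards [hN, (isOpen_cap hx.continuous _).mem_nhds h1] with q hq hq'
    exact hN' q hq (le_of_lt hq')
  choose! z hz hGz using hz
  obtain ⟨U, hU, hneg⟩ := hν.exists_nhds_height_neg hx hc p₀
  have hUp : p₀ ∈ interior U := mem_interior_iff_mem_nhds.2 hU
  have hcap : p₀ ∈ cap x (x p₀) := by
    change 0 < inner ℝ (x p₀ : Ambient n) (x p₀ : Ambient n)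
    rw [inner_self_sph]
    exact one_pos
  set N := connectedComponentIn (interior U ∩ cap x (x p₀)) p₀ with hN
  have hNnhds : N ∈ 𝓝 p₀ :=
    connectedComponentIn_mem_nhds ((isOpen_interior.inter (isOpen_cap hx.continuous _)).mem_nhds
      ⟨hUp, hcap⟩)
  have hheight : ∀ q ∈ U, height x ν p₀ q ≤ 0 := by
    intro q hq
    by_cases h : p₀ = q
    · rw [← h, hν.height_self]
    · exact (hneg p₀ (mem_of_mem_nhds hU) q hq h).le
  -- For θ > π / 2 the coefficient cos θ is negative, so both terms of the height favour points of
  -- N: one neighbourhood serves all these θ.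
  have hNsub : ∀ θ ∈ Set.Ioo (Real.pi / 2) Real.pi, N ⊆ sweepComponent hν p₀ θ := by
    intro θ hθ
    refine isPreconnected_connectedComponentIn.subset_connectedComponentIn
      (mem_connectedComponentIn ⟨hUp, hcap⟩) fun q hq => ?_
    obtain ⟨hq1, hq2⟩ := connectedComponentIn_subset _ _ hq
    change 0 < inner ℝ (x q : Ambient n) (sweepPole hν p₀ θ : Ambient n)
    rw [inner_sweepPole]
    have h1 := hheight q (interior_subset hq1)
    have h2 : Real.cos θ < 0 := Real.cos_neg_of_pi_div_two_lt_of_lt hθ.1 (by linarith [hθ.2, Real.pi_pos])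
    have h3 := Real.sin_pos_of_pos_of_lt_pi (by linarith [hθ.1, Real.pi_pos]) hθ.2
    have h4 := mul_pos h3 hq2
    nlinarith
  have hmem : Set.Ioo (Real.pi / 2) Real.pi ∈ 𝓝[<] Real.pi :=
    Ioo_mem_nhdsLT (by linarith [Real.pi_pos])
  have hfor : ∀ θ ∈ Set.Ioo (Real.pi / 2) Real.pi, ∀ p ∈ N, height x ν p (z θ) ≤ 0 := by
    intro θ hθ p hp
    have hθ' : θ ∈ Set.Ioo 0 Real.pi := ⟨by linarith [hθ.1, Real.pi_pos], hθ.2⟩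
    exact hν.height_nonpos_of_mem_closure hx.continuous hc
      (hν.sweepComponent_strict hx hc hn p₀ ⟨hθ'.1.le, hθ'.2⟩)
      (subset_closure (hNsub θ hθ hp)) (hz θ hθ')
  set 𝒰 : Ultrafilter ℝ := Ultrafilter.of (𝓝[<] Real.pi) with h𝒰
  have h𝒰le : (𝒰 : Filter ℝ) ≤ 𝓝[<] Real.pi := Ultrafilter.of_le _
  obtain ⟨y, hy⟩ : ∃ y, Filter.Tendsto z 𝒰 (𝓝 y) := ⟨_, (𝒰.map z).le_nhds_lim⟩
  have hheight_cont : ∀ p, Continuous (height x ν p) := fun p =>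
    (continuous_height hx.continuous hc).comp (Continuous.prodMk_right p)
  have hyN : ∀ p ∈ N, height x ν p y ≤ 0 := by
    intro p hp
    refine le_of_tendsto (((hheight_cont p).tendsto y).comp hy) ?_
    filter_upwards [h𝒰le hmem] with θ hθ
    exact hfor θ hθ p hp
  have hθt : Filter.Tendsto (fun θ : ℝ => θ) 𝒰 (𝓝 Real.pi) := h𝒰le.trans nhdsWithin_le_nhds
  have hy0 : height x ν p₀ y = 0 := by
    have h1 := ((continuous_inner_sweepPole hν hx.continuous p₀).tendsto (Real.pi, y)).comp
      (hθt.prodMk_nhds hy)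
    have h2 := tendsto_nhds_unique_of_eventuallyEq h1
      (tendsto_const_nhds (x := (0 : ℝ)) (f := (𝒰 : Filter ℝ))) (by
        filter_upwards [h𝒰le hmem] with θ hθ
        exact hGz θ ⟨by linarith [hθ.1, Real.pi_pos], hθ.2⟩)
    simpa [inner_sweepPole] using h2
  have hyx : inner ℝ (x y : Ambient n) (x p₀ : Ambient n) ≤ 0 := by
    refine le_of_tendsto (((continuous_inner_sph hx.continuous _).tendsto y).comp hy) ?_
    filter_upwards [h𝒰le hmem] with θ hθ
    have hθ' : θ ∈ Set.Ioo 0 Real.pi := ⟨by linarith [hθ.1, Real.pi_pos], hθ.2⟩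
    have h1 := hGz θ hθ'
    rw [inner_sweepPole] at h1
    have h2 : Real.cos θ < 0 := Real.cos_neg_of_pi_div_two_lt_of_lt hθ.1 (by linarith [hθ.2, Real.pi_pos])
    have h3 := Real.sin_pos_of_pos_of_lt_pi hθ'.1 hθ'.2
    have h4 := hfor θ hθ p₀ (mem_of_mem_nhds hNnhds)
    have h5 := mul_nonneg_of_nonpos_of_nonpos h2.le h4
    by_contra h6
    rw [not_le] at h6
    have h7 := mul_pos h3 h6
    simp only [Function.comp_apply] at h7
    linarith
  have hne : x y ≠ x p₀ := by
    intro h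
    rw [h, inner_self_sph] at hyx
    linarith
  obtain ⟨q, hq, hq'⟩ := hν.exists_inner_pos hx hc (by omega) hy0 hne hNnhds
  exact absurd (hyN q hq) (not_le.2 hq')

/-- Every tangent great sphere of a closed strictly convex hypersurface of dimension at least two
supports the hypersurface strictly. -/
theorem IsConvexNormal.height_neg [ConnectedSpace M₀] (hν : IsConvexNormal x ν)
    (hx : IsC2Immersion x) (hc : Continuous ν) (hn : 2 ≤ n) {p q : M₀} (hpq : p ≠ q) :
    height x ν p q < 0 := by
  obtain ⟨θ, hθ, h⟩ := hν.exists_closure_sweepComponent_eq_univ hx hc hn p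
  have h1 := hν.closure_subset_strictPairs hx hc hn (w := sweepPole hν p θ) rfl
    (Real.sin_pos_of_pos_of_lt_pi hθ.1 hθ.2)
    (hν.sweepComponent_strict hx hc hn p ⟨hθ.1.le, hθ.2⟩)
  have h2 : (p, q) ∈ strictPairs x ν := by
    apply h1
    change (p, q) ∈ closure (sweepComponent hν p θ) ×ˢ closure (sweepComponent hν p θ)
    rw [h]
    exact ⟨trivial, trivial⟩
  exact h2.resolve_left hpq

end Sweep

/-! ### Crossing arcs and first failures on the real line -/

section Crossing

open Filter Set

/-- An injective continuous function on an open interval, decreasing from `∞` to `-∞`, has a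
continuous inverse. -/
theorem exists_continuous_inverse_Ioo {r : ℝ → ℝ} {b : ℝ} (hb : 0 < b)
    (hr : ContinuousOn r (Ioo 0 b)) (hinj : InjOn r (Ioo 0 b))
    (h0 : Tendsto r (𝓝[>] 0) atTop) (h1 : Tendsto r (𝓝[<] b) atBot) :
    ∃ τ : ℝ → ℝ, Continuous τ ∧ (∀ y, τ y ∈ Ioo 0 b ∧ r (τ y) = y) ∧
      Tendsto τ atTop (𝓝[>] 0) ∧ Tendsto τ atBot (𝓝[<] b) := by
  have hanti : ∀ s ∈ Ioo 0 b, ∀ t ∈ Ioo 0 b, s < t → r t < r s := by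
    intro s hs t ht hst
    obtain ⟨s₀, hs₀, hs₀'⟩ := ((h0.eventually_ge_atTop (r t)).and
      (Ioo_mem_nhdsGT hs.1)).exists
    have hsub : Icc s₀ t ⊆ Ioo 0 b := fun u hu =>
      ⟨hs₀'.1.trans_le hu.1, hu.2.trans_lt ht.2⟩
    exact ContinuousOn.strictAntiOn_of_injOn_Icc (hs₀'.2.trans hst).le hs₀ (hr.mono hsub)
      (hinj.mono hsub) ⟨hs₀'.2.le, hst.le⟩ ⟨(hs₀'.2.trans hst).le, le_rfl⟩ hst
  have hmono : StrictMono fun t : Ioo 0 b => -r t := fun s t hst =>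
    neg_lt_neg (hanti s s.2 t t.2 hst)
  have hsurj : Function.Surjective fun t : Ioo 0 b => -r t := by
    intro y
    obtain ⟨t, ht, hty⟩ := ContinuousOn.surjOn_of_tendsto' (nonempty_Ioo.2 hb) hr
      ((tendsto_comp_coe_Ioo_atBot hb).2 h0) ((tendsto_comp_coe_Ioo_atTop hb).2 h1)
      (mem_univ (-y))
    exact ⟨⟨t, ht⟩, by simp [hty]⟩
  set iso := hmono.orderIsoOfSurjective _ hsurj with hiso
  have happ : ∀ t, iso t = -r t := fun t => rfl
  refine ⟨fun y => iso.symm (-y), ?_, fun y => ⟨(iso.symm (-y)).2, ?_⟩, ?_, ?_⟩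
  · exact continuous_subtype_val.comp (iso.symm.continuous.comp continuous_neg)
  · have := iso.apply_symm_apply (-y)
    rw [happ] at this
    exact neg_injective this
  · have h2 : Tendsto (fun t : Ioo 0 b => (t : ℝ)) atBot (𝓝[>] 0) := (map_coe_Ioo_atBot hb).le
    exact h2.comp (iso.symm.tendsto_atBot.comp tendsto_neg_atTop_atBot)
  · have h2 : Tendsto (fun t : Ioo 0 b => (t : ℝ)) atTop (𝓝[<] b) := (map_coe_Ioo_atTop hb).le
    exact h2.comp (iso.symm.tendsto_atTop.comp tendsto_neg_atBot_atTop)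

/-- Two arcs in a half plane, given in homogeneous coordinates, which leave a boundary point in
opposite directions and arrive at infinity on opposite sides, have a common point. -/
theorem exists_crossing {c₁ d₁ e₁ c₂ d₂ e₂ : ℝ → ℝ} {b₁ b₂ : ℝ} (hb₁ : 0 < b₁) (hb₂ : 0 < b₂)
    (hc₁ : Continuous c₁) (hd₁ : Continuous d₁) (he₁ : Continuous e₁)
    (hc₂ : Continuous c₂) (hd₂ : Continuous d₂) (he₂ : Continuous e₂)
    (hneg₁ : ∀ t ∈ Ioo 0 b₁, e₁ t < 0) (hneg₂ : ∀ t ∈ Ioo 0 b₂, e₂ t < 0)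
    (hc₁0 : 0 < c₁ 0) (hd₁0 : d₁ 0 = 0) (hc₂0 : 0 < c₂ 0) (hd₂0 : d₂ 0 = 0)
    (hr₁ : Tendsto (fun t => d₁ t / -e₁ t) (𝓝[>] 0) atTop)
    (hr₂ : Tendsto (fun t => d₂ t / -e₂ t) (𝓝[>] 0) atBot)
    (he₁b : e₁ b₁ = 0) (hd₁b : d₁ b₁ < 0) (he₂b : e₂ b₂ = 0) (hd₂b : 0 < d₂ b₂)
    (hinj : InjOn (fun t => d₁ t / -e₁ t) (Ioo 0 b₁)) :
    ∃ t₁ ∈ Ioo 0 b₁, ∃ t₂ ∈ Ioo 0 b₂,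
      d₁ t₁ / -e₁ t₁ = d₂ t₂ / -e₂ t₂ ∧ c₁ t₁ / -e₁ t₁ = c₂ t₂ / -e₂ t₂ := by
  have hdiv : ∀ {g e : ℝ → ℝ} {b : ℝ}, Continuous g → Continuous e →
      (∀ t ∈ Ioo 0 b, e t < 0) → ContinuousOn (fun t => g t / -e t) (Ioo 0 b) :=
    fun hg he hneg => hg.continuousOn.div he.neg.continuousOn
      fun t ht => (neg_pos.2 (hneg t ht)).ne'
  have hinv : ∀ {e : ℝ → ℝ} {b : ℝ}, 0 < b → Continuous e → (∀ t ∈ Ioo 0 b, e t < 0) →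
      e b = 0 → Tendsto (fun t => (-e t)⁻¹) (𝓝[<] b) atTop := by
    intro e b hb he hneg heb
    refine Tendsto.inv_tendsto_nhdsGT_zero (tendsto_nhdsWithin_iff.2 ⟨?_, ?_⟩)
    · have := (he.tendsto b).neg
      rw [heb, neg_zero] at this
      exact this.mono_left nhdsWithin_le_nhds
    · filter_upwards [Ioo_mem_nhdsLT hb] with t ht
      exact neg_pos.2 (hneg t ht)
  have hr₁b : Tendsto (fun t => d₁ t / -e₁ t) (𝓝[<] b₁) atBot :=
    ((hd₁.tendsto b₁).mono_left nhdsWithin_le_nhds).neg_mul_atTop hd₁b (hinv hb₁ he₁ hneg₁ he₁b)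
  have hr₂b : Tendsto (fun t => d₂ t / -e₂ t) (𝓝[<] b₂) atTop :=
    ((hd₂.tendsto b₂).mono_left nhdsWithin_le_nhds).pos_mul_atTop hd₂b (hinv hb₂ he₂ hneg₂ he₂b)
  obtain ⟨τ, hτ, hτr, hτtop, hτbot⟩ :=
    exists_continuous_inverse_Ioo hb₁ (hdiv hd₁ he₁ hneg₁) hinj hr₁ hr₁b
  have hd₁pos : ∀ᶠ t in 𝓝[>] 0, 0 < d₁ t := by
    filter_upwards [hr₁.eventually_gt_atTop 0, Ioo_mem_nhdsGT hb₁] with t ht ht'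
    exact (div_pos_iff_of_pos_right (neg_pos.2 (hneg₁ t ht'))).1 ht
  have hd₂neg : ∀ᶠ t in 𝓝[>] 0, d₂ t < 0 := by
    filter_upwards [hr₂.eventually_lt_atBot 0, Ioo_mem_nhdsGT hb₂] with t ht ht'
    by_contra hcon
    exact absurd ht (not_lt.2 (div_nonneg (not_lt.1 hcon) (neg_pos.2 (hneg₂ t ht')).le))
  have hw₁0 : Tendsto (fun t => c₁ t / d₁ t) (𝓝[>] 0) atTop := by
    refine ((hc₁.tendsto 0).mono_left nhdsWithin_le_nhds).pos_mul_atTop hc₁0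
      (Tendsto.inv_tendsto_nhdsGT_zero (tendsto_nhdsWithin_iff.2 ⟨?_, hd₁pos⟩))
    have := hd₁.tendsto 0
    rw [hd₁0] at this
    exact this.mono_left nhdsWithin_le_nhds
  have hw₂0 : Tendsto (fun t => c₂ t / d₂ t) (𝓝[>] 0) atBot := by
    refine ((hc₂.tendsto 0).mono_left nhdsWithin_le_nhds).pos_mul_atBot hc₂0
      (tendsto_inv_nhdsLT_zero.comp (tendsto_nhdsWithin_iff.2 ⟨?_, hd₂neg⟩))
    have := hd₂.tendsto 0
    rw [hd₂0] at this
    exact this.mono_left nhdsWithin_le_nhds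
  have hw₁b : Tendsto (fun t => c₁ t / d₁ t) (𝓝[<] b₁) (𝓝 (c₁ b₁ / d₁ b₁)) :=
    ((hc₁.tendsto b₁).div (hd₁.tendsto b₁) hd₁b.ne).mono_left nhdsWithin_le_nhds
  have hw₂b : Tendsto (fun t => c₂ t / d₂ t) (𝓝[<] b₂) (𝓝 (c₂ b₂ / d₂ b₂)) :=
    ((hc₂.tendsto b₂).div (hd₂.tendsto b₂) hd₂b.ne').mono_left nhdsWithin_le_nhds
  set r₂ : ℝ → ℝ := fun t => d₂ t / -e₂ t with hr₂def
  -- The first arc is a graph over r = d / -e, and τ inverts r; g is the gap between the second arc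
  -- and this graph. Its signs near the two ends are read off from g = r₂ (c₂ / d₂ - c₁ / d₁),
  -- because the quotients c / d have limits in [-∞, ∞] there.
  set g : ℝ → ℝ := fun t => c₂ t / -e₂ t - c₁ (τ (r₂ t)) / -e₁ (τ (r₂ t)) with hg
  have hgc : ContinuousOn g (Ioo 0 b₂) := by
    refine (hdiv hc₂ he₂ hneg₂).sub ?_
    exact (hdiv hc₁ he₁ hneg₁).comp (hτ.comp_continuousOn (hdiv hd₂ he₂ hneg₂))
      fun t _ => (hτr (r₂ t)).1
  have hgeq : ∀ t ∈ Ioo 0 b₂, r₂ t ≠ 0 →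
      g t = r₂ t * (c₂ t / d₂ t - c₁ (τ (r₂ t)) / d₁ (τ (r₂ t))) := by
    intro t ht h0
    have h1 := (hτr (r₂ t)).2
    have h2 := hneg₂ t ht
    have h3 := hneg₁ _ (hτr (r₂ t)).1
    have h4 : d₂ t ≠ 0 := by
      intro h
      exact h0 (by simp [hr₂def, h])
    have h5 : d₁ (τ (r₂ t)) ≠ 0 := by
      intro h
      rw [h, zero_div] at h1
      exact h0 h1.symm
    have key : ∀ c d e : ℝ, d ≠ 0 → c / -e = d / -e * (c / d) := fun c d e hd => by
      rw [div_mul_div_comm, mul_comm d c, mul_div_mul_right _ _ hd]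
    have h6 := key (c₁ (τ (r₂ t))) _ (e₁ (τ (r₂ t))) h5
    rw [h1] at h6
    change c₂ t / -e₂ t - c₁ (τ (r₂ t)) / -e₁ (τ (r₂ t)) = _
    rw [mul_sub, h6, key (c₂ t) (d₂ t) (e₂ t) h4]
  obtain ⟨s, hs, hgs⟩ : ∃ s ∈ Ioo 0 b₂, 0 < g s := by
    have h1 := hw₁b.comp (hτbot.comp hr₂)
    obtain ⟨t, ht1, ht2, ht3, ht4⟩ := ((h1.eventually_const_lt (sub_one_lt _)).and
      ((hw₂0.eventually_lt_atBot (c₁ b₁ / d₁ b₁ - 1)).and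
        ((hr₂.eventually_lt_atBot 0).and (Ioo_mem_nhdsGT hb₂)))).exists
    refine ⟨t, ht4, ?_⟩
    rw [hgeq t ht4 ht3.ne]
    simp only [Function.comp_apply] at ht1
    exact mul_pos_of_neg_of_neg ht3 (by linarith)
  obtain ⟨s', hs', hgs'⟩ : ∃ s ∈ Ioo 0 b₂, g s < 0 := by
    have h1 := hw₁0.comp (hτtop.comp hr₂b)
    obtain ⟨t, ht1, ht2, ht3, ht4⟩ := ((h1.eventually_gt_atTop (c₂ b₂ / d₂ b₂ + 1)).and
      ((hw₂b.eventually_lt_const (lt_add_one _)).and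
        ((hr₂b.eventually_gt_atTop 0).and (Ioo_mem_nhdsLT hb₂)))).exists
    refine ⟨t, ht4, ?_⟩
    rw [hgeq t ht4 ht3.ne']
    simp only [Function.comp_apply] at ht1
    exact mul_neg_of_pos_of_neg ht3 (by linarith)
  obtain ⟨t, ht, ht0⟩ := isPreconnected_Ioo.intermediate_value hs' hs hgc
    (show (0 : ℝ) ∈ _ from ⟨hgs'.le, hgs.le⟩)
  exact ⟨τ (r₂ t), (hτr _).1, t, ht, (hτr _).2, (sub_eq_zero.1 ht0).symm⟩

/-- The first failure of a negativity condition which holds near the diagonal. -/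
theorem exists_first_zero {φ : ℝ → ℝ → ℝ} (hφ : Continuous fun z : ℝ × ℝ => φ z.1 z.2)
    (hdiag : ∀ t, ∃ ε > 0, ∀ s ∈ Metric.ball t ε, ∀ t' ∈ Metric.ball t ε, s < t' → φ s t' < 0)
    {s t : ℝ} (hs : 0 ≤ s) (hst : s < t) (h : 0 ≤ φ s t) :
    ∃ s₁ t₁, 0 ≤ s₁ ∧ s₁ < t₁ ∧ t₁ ≤ t ∧ φ s₁ t₁ = 0 ∧ ∀ s' ∈ Ico 0 t₁, φ s' t₁ ≤ 0 := by
  choose ε hε hneg using hdiag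
  set O : Set (ℝ × ℝ) := ⋃ u, Metric.ball u (ε u) ×ˢ Metric.ball u (ε u) with hO
  have hOo : IsOpen O := isOpen_iUnion fun u => Metric.isOpen_ball.prod Metric.isOpen_ball
  have hOneg : ∀ z ∈ O, z.1 < z.2 → φ z.1 z.2 < 0 := by
    intro z hz hlt
    obtain ⟨u, hu⟩ := mem_iUnion.1 hz
    exact hneg u _ hu.1 _ hu.2 hlt
  have hOdiag : ∀ u, (u, u) ∈ O := fun u =>
    mem_iUnion.2 ⟨u, Metric.mem_ball_self (hε u), Metric.mem_ball_self (hε u)⟩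
  -- Removing the open neighbourhood O of the diagonal leaves a compact set of failures off the
  -- diagonal; the first failure minimises the second coordinate on it.
  set B : Set (ℝ × ℝ) := (Icc 0 t ×ˢ Icc 0 t) ∩ ({z | z.1 ≤ z.2} ∩ {z | 0 ≤ φ z.1 z.2} ∩ Oᶜ)
    with hB
  have hBc : IsCompact B := (isCompact_Icc.prod isCompact_Icc).inter_right
    (((isClosed_le continuous_fst continuous_snd).inter (isClosed_le continuous_const hφ)).inter
      hOo.isClosed_compl)
  have hmem : ∀ s' t', 0 ≤ s' → s' < t' → t' ≤ t → 0 ≤ φ s' t' → (s', t') ∈ B := by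
    intro s' t' h1 h2 h3 h4
    exact ⟨⟨⟨h1, h2.le.trans h3⟩, ⟨h1.trans h2.le, h3⟩⟩, ⟨h2.le, h4⟩,
      fun hO => absurd h4 (not_le.2 (hOneg _ hO h2))⟩
  obtain ⟨⟨s₁, t₁⟩, hz, hmin⟩ := hBc.exists_isMinOn ⟨_, hmem s t hs hst le_rfl h⟩
    continuous_snd.continuousOn
  obtain ⟨⟨⟨h1, -⟩, -, h2⟩, ⟨h3, h4⟩, h5⟩ := hz
  simp only [] at h1 h2
  have hlt : s₁ < t₁ := lt_of_le_of_ne h3 (by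
    rintro rfl
    exact h5 (hOdiag s₁))
  have hle : ∀ s' ∈ Ico 0 t₁, φ s' t₁ ≤ 0 := by
    intro s' hs'
    have hc : Continuous fun t' => φ s' t' := hφ.comp (Continuous.prodMk_right s')
    refine le_of_tendsto ((hc.tendsto t₁).mono_left (nhdsWithin_le_nhds (s := Iio t₁))) ?_
    filter_upwards [Ioo_mem_nhdsLT hs'.2] with t' ht'
    by_contra hcon
    exact absurd (hmin (hmem s' t' hs'.1 ht'.1 (ht'.2.le.trans h2) (not_le.1 hcon).le))
      (not_le.2 ht'.2)
  exact ⟨s₁, t₁, h1, hlt, h2, le_antisymm (hle s₁ ⟨h1, hlt⟩) h4, hle⟩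

theorem eventually_pos_of_hasDerivAt {g : ℝ → ℝ} {g' s : ℝ} (h : HasDerivAt g g' s) (h0 : g s = 0)
    (hg' : 0 < g') : ∀ᶠ t in 𝓝[>] s, 0 < g t := by
  have h1 := (hasDerivAt_iff_tendsto_slope.1 h).mono_left
    (nhdsWithin_mono s (fun t (ht : s < t) => ht.ne'))
  filter_upwards [h1.eventually_const_lt hg', self_mem_nhdsWithin] with t ht ht'
  rw [slope_def_field, h0, sub_zero] at ht
  exact (div_pos_iff_of_pos_right (sub_pos.2 ht')).1 ht

theorem eventually_neg_of_hasDerivAt {g : ℝ → ℝ} {g' s : ℝ} (h : HasDerivAt g g' s) (h0 : g s = 0)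
    (hg' : 0 < g') : ∀ᶠ t in 𝓝[<] s, g t < 0 := by
  have h1 := (hasDerivAt_iff_tendsto_slope.1 h).mono_left
    (nhdsWithin_mono s (fun t (ht : t < s) => ht.ne))
  filter_upwards [h1.eventually_const_lt hg', self_mem_nhdsWithin] with t ht ht'
  rw [slope_def_field, h0, sub_zero] at ht
  by_contra hcon
  exact absurd ht (not_lt.2 (div_nonpos_of_nonneg_of_nonpos (not_lt.1 hcon) (sub_neg.2 ht').le))

/-- The numerator vanishes to exactly first order and the denominator to higher order, so the
quotient of the slopes diverges. -/
theorem tendsto_div_neg_atTop {d e : ℝ → ℝ} {d' : ℝ} (hd : HasDerivAt d d' 0)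
    (he : HasDerivAt e 0 0) (hd0 : d 0 = 0) (he0 : e 0 = 0) (hd' : 0 < d')
    (hneg : ∀ᶠ t in 𝓝[>] 0, e t < 0) : Tendsto (fun t => d t / -e t) (𝓝[>] 0) atTop := by
  have hsub : 𝓝[>] (0 : ℝ) ≤ 𝓝[≠] 0 := nhdsWithin_mono 0 (fun t (ht : 0 < t) => ht.ne')
  have h1 := (hasDerivAt_iff_tendsto_slope.1 hd).mono_left hsub
  have h2 := ((hasDerivAt_iff_tendsto_slope.1 he).mono_left hsub).neg
  rw [neg_zero] at h2
  have h3 : Tendsto (fun t => (-slope e 0 t)⁻¹) (𝓝[>] 0) atTop := by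
    refine Tendsto.inv_tendsto_nhdsGT_zero (tendsto_nhdsWithin_iff.2 ⟨h2, ?_⟩)
    filter_upwards [hneg, self_mem_nhdsWithin] with t ht ht'
    rw [slope_def_field, he0, sub_zero, sub_zero]
    exact neg_pos.2 (div_neg_of_neg_of_pos ht ht')
  refine (h1.pos_mul_atTop hd' h3).congr' ?_
  filter_upwards [hneg, self_mem_nhdsWithin] with t ht ht'
  have : t ≠ 0 := (show 0 < t from ht').ne'
  rw [slope_def_field, slope_def_field, he0, hd0]
  field_simp [ht.ne]
  simp

end Crossing

/-! ### Simple closed convex curves on the two-sphere -/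

section ConvexCurves

open Filter Set

variable {E : Type*} [NormedAddCommGroup E] [InnerProductSpace ℝ E] {X T N : ℝ → E} {L : ℝ}

/-- A periodic curve `X` on the unit sphere of a three-dimensional space, without double points,
with unit tangent `T` and unit normal `N`, which is curved away from `N`. -/
structure IsConvexFrame (X T N : ℝ → E) (L : ℝ) : Prop where
  hasDerivAt : ∀ t, HasDerivAt X (T t) t
  continuous_normal : Continuous N
  norm_curve : ∀ t, ‖X t‖ = 1
  norm_tangent : ∀ t, ‖T t‖ = 1
  norm_normal : ∀ t, ‖N t‖ = 1
  inner_tangent : ∀ t, inner ℝ (X t) (T t) = 0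
  inner_normal : ∀ t, inner ℝ (X t) (N t) = 0
  inner_tangent_normal : ∀ t, inner ℝ (T t) (N t) = 0
  expand : ∀ t y, y = inner ℝ y (X t) • X t + inner ℝ y (T t) • T t + inner ℝ y (N t) • N t
  hasDerivAt_normal : ∀ t y, inner ℝ y (N t) = 0 →
    ∃ k > 0, HasDerivAt (fun s => inner ℝ y (N s)) (k * inner ℝ y (T t)) t
  local_neg : ∀ t, ∃ ε > 0, ∀ s ∈ Metric.ball t ε, ∀ s' ∈ Metric.ball t ε, s ≠ s' →
    inner ℝ (X s') (N s) < 0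
  periodic : Function.Periodic X L
  periodic_normal : Function.Periodic N L
  pos : 0 < L
  ne : ∀ s t, s < t → t < s + L → X s ≠ X t

namespace IsConvexFrame

theorem shift (h : IsConvexFrame X T N L) (a : ℝ) :
    IsConvexFrame (fun t => X (a + t)) (fun t => T (a + t)) (fun t => N (a + t)) L where
  hasDerivAt t := (h.hasDerivAt (a + t)).comp_const_add a t
  continuous_normal := h.continuous_normal.comp (continuous_const.add continuous_id)
  norm_curve t := h.norm_curve _
  norm_tangent t := h.norm_tangent _
  norm_normal t := h.norm_normal _
  inner_tangent t := h.inner_tangent _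
  inner_normal t := h.inner_normal _
  inner_tangent_normal t := h.inner_tangent_normal _
  expand t := h.expand _
  hasDerivAt_normal t y hy := by
    obtain ⟨k, hk, hd⟩ := h.hasDerivAt_normal (a + t) y hy
    exact ⟨k, hk, hd.comp_const_add a t⟩
  local_neg t := by
    obtain ⟨ε, hε, hneg⟩ := h.local_neg (a + t)
    refine ⟨ε, hε, fun s hs s' hs' hne => hneg _ ?_ _ ?_ fun he => hne (add_left_cancel he)⟩
    · rwa [Metric.mem_ball, dist_add_left]
    · rwa [Metric.mem_ball, dist_add_left]
  periodic t := by simpa [add_assoc] using h.periodic (a + t)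
  periodic_normal t := by simpa [add_assoc] using h.periodic_normal (a + t)
  pos := h.pos
  ne s t h1 h2 := h.ne _ _ (by linarith) (by linarith)

/-- Reversal changes the tangent but not the normal, so the backward arc from a point obeys the
results for the forward arc. -/
theorem reverse (h : IsConvexFrame X T N L) :
    IsConvexFrame (fun t => X (-t)) (fun t => -T (-t)) (fun t => N (-t)) L where
  hasDerivAt t := by
    simpa [Function.comp_def] using (h.hasDerivAt (-t)).scomp t (hasDerivAt_neg t)
  continuous_normal := h.continuous_normal.comp continuous_neg
  norm_curve t := h.norm_curve _
  norm_tangent t := by rw [norm_neg, h.norm_tangent]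
  norm_normal t := h.norm_normal _
  inner_tangent t := by rw [inner_neg_right, h.inner_tangent, neg_zero]
  inner_normal t := h.inner_normal _
  inner_tangent_normal t := by rw [inner_neg_left, h.inner_tangent_normal, neg_zero]
  expand t y := by
    rw [inner_neg_right, neg_smul_neg]
    exact h.expand _ y
  hasDerivAt_normal t y hy := by
    obtain ⟨k, hk, hd⟩ := h.hasDerivAt_normal (-t) y hy
    refine ⟨k, hk, ?_⟩
    simpa [Function.comp_def] using hd.scomp t (hasDerivAt_neg t)
  local_neg t := by
    obtain ⟨ε, hε, hneg⟩ := h.local_neg (-t)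
    refine ⟨ε, hε, fun s hs s' hs' hne => hneg _ ?_ _ ?_ fun he => hne (neg_injective he)⟩
    · rwa [Metric.mem_ball, dist_neg_neg]
    · rwa [Metric.mem_ball, dist_neg_neg]
  periodic t := by
    have := h.periodic (-t - L)
    simp only [sub_add_cancel] at this
    change X (-(t + L)) = X (-t)
    rw [neg_add']
    exact this.symm
  periodic_normal t := by
    have := h.periodic_normal (-t - L)
    simp only [sub_add_cancel] at this
    change N (-(t + L)) = N (-t)
    rw [neg_add']
    exact this.symm
  pos := h.pos
  ne s t h1 h2 := (h.ne (-t) (-s) (by linarith) (by linarith)).symm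

theorem continuous (h : IsConvexFrame X T N L) : Continuous X :=
  continuous_iff_continuousAt.2 fun t => (h.hasDerivAt t).continuousAt

theorem continuous_inner (h : IsConvexFrame X T N L) :
    Continuous fun z : ℝ × ℝ => inner ℝ (X z.2) (N z.1) :=
  (h.continuous.comp continuous_snd).inner (h.continuous_normal.comp continuous_fst)

theorem eq_of_inner_eq_zero (h : IsConvexFrame X T N L) {t : ℝ} {y : E} (hy : ‖y‖ = 1)
    (hN : inner ℝ y (N t) = 0) (hT : inner ℝ y (T t) = 0) : y = X t ∨ y = -X t := by
  have h1 := h.expand t y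
  rw [hN, hT, zero_smul, zero_smul, add_zero, add_zero] at h1
  have h2 : |inner ℝ y (X t)| = 1 := by
    rw [h1, norm_smul, h.norm_curve, mul_one, Real.norm_eq_abs] at hy
    exact hy
  rcases abs_eq (zero_le_one) |>.1 h2 with h3 | h3
  · left
    rw [h1, h3, one_smul]
  · right
    rw [h1, h3, neg_one_smul]

/-- A point of a tangent great circle, different from the point of contact, lies outside some
nearby tangent great circle. -/
theorem exists_pos (h : IsConvexFrame X T N L) {s : ℝ} {y : E} (hy : ‖y‖ = 1)
    (hN : inner ℝ y (N s) = 0) (hne : X s ≠ y) {a b : ℝ} (hs : s ∈ Ioo a b) :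
    ∃ s' ∈ Ioo a b, 0 < inner ℝ y (N s') := by
  rcases lt_trichotomy (inner ℝ y (T s)) 0 with hT | hT | hT
  · obtain ⟨k, hk, hd⟩ := h.hasDerivAt_normal s (-y) (by rw [inner_neg_left, hN, neg_zero])
    rw [inner_neg_left] at hd
    obtain ⟨s', h1, h2⟩ := ((eventually_neg_of_hasDerivAt hd (by rw [inner_neg_left, hN, neg_zero])
      (mul_pos hk (neg_pos.2 hT))).and (Ioo_mem_nhdsLT hs.1)).exists
    refine ⟨s', ⟨h2.1, h2.2.trans hs.2⟩, ?_⟩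
    rwa [inner_neg_left, neg_lt_zero] at h1
  · rcases h.eq_of_inner_eq_zero hy hN hT with h1 | h1
    · exact absurd h1.symm hne
    · obtain ⟨ε, hε, hneg⟩ := h.local_neg s
      obtain ⟨s', h2, h3, h4⟩ := (Filter.nonempty_of_mem (inter_mem (Ioo_mem_nhdsGT hs.2)
        (inter_mem (self_mem_nhdsWithin (s := Ioi s))
          (mem_nhdsWithin_of_mem_nhds (Metric.ball_mem_nhds s hε)))))
      refine ⟨s', ⟨hs.1.trans h2.1, h2.2⟩, ?_⟩
      rw [h1, inner_neg_left]
      exact neg_pos.2 (hneg s' h4 s (Metric.mem_ball_self hε) (ne_of_gt h3))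
  · obtain ⟨k, hk, hd⟩ := h.hasDerivAt_normal s y hN
    obtain ⟨s', h1, h2⟩ := ((eventually_pos_of_hasDerivAt hd hN (mul_pos hk hT)).and
      (Ioo_mem_nhdsGT hs.2)).exists
    exact ⟨s', ⟨hs.1.trans h2.1, h2.2⟩, h1⟩

section Arc

variable {b : ℝ} (h : IsConvexFrame X T N L) (hb : b ≤ L)
  (harc : ∀ t ∈ Ioo 0 b, inner ℝ (X t) (N 0) < 0)

include h hb harc

/-- At a first failure (s₁, t₁), X t₁ is on the tangent circle at s₁ and not outside any tangent
circle at s' in [0, t₁). The hypothesis on the arc excludes s₁ = 0; for s₁ > 0 turning the tangent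
circle slightly puts X t₁ outside, by `exists_pos`. -/
theorem forward_neg {s t : ℝ} (hs : 0 ≤ s) (hst : s < t) (ht : t < b) :
    inner ℝ (X t) (N s) < 0 := by
  by_contra hcon
  obtain ⟨s₁, t₁, h1, h2, h3, h4, h5⟩ := exists_first_zero (φ := fun s t => inner ℝ (X t) (N s))
    h.continuous_inner (fun t => by
      obtain ⟨ε, hε, hneg⟩ := h.local_neg t
      exact ⟨ε, hε, fun s hs s' hs' hlt => hneg s hs s' hs' hlt.ne⟩) hs hst (not_lt.1 hcon)
  rcases h1.eq_or_lt with rfl | h1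
  · exact absurd h4 (harc t₁ ⟨h2, by linarith⟩).ne
  · obtain ⟨s', hs', hpos⟩ := h.exists_pos (h.norm_curve t₁) h4 (h.ne s₁ t₁ h2 (by linarith))
      (show s₁ ∈ Ioo 0 t₁ from ⟨h1, h2⟩)
    exact absurd (h5 s' ⟨hs'.1.le, hs'.2⟩) (not_le.2 hpos)

variable (hbpos : 0 < b) (hbL : b < L) (hzero : inner ℝ (X b) (N 0) = 0)

theorem forward_nonpos_end {s : ℝ} (hs : s ∈ Ico 0 b) : inner ℝ (X b) (N s) ≤ 0 := by
  have hc : Continuous fun t => inner ℝ (X t) (N s) := h.continuous.inner continuous_const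
  refine le_of_tendsto ((hc.tendsto b).mono_left (nhdsWithin_le_nhds (s := Iio b))) ?_
  filter_upwards [Ioo_mem_nhdsLT hs.2] with t ht
  exact (h.forward_neg hb harc hs.1 ht.1 ht.2).le

include hbL

theorem forward_neg_end {s : ℝ} (hs : s ∈ Ioo 0 b) : inner ℝ (X b) (N s) < 0 := by
  refine lt_of_le_of_ne (h.forward_nonpos_end hb harc ⟨hs.1.le, hs.2⟩) fun h0 => ?_
  obtain ⟨s', hs', hpos⟩ := h.exists_pos (h.norm_curve b) h0
    (h.ne s b hs.2 (by linarith [hs.1])) hs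
  exact absurd (h.forward_nonpos_end hb harc ⟨hs'.1.le, hs'.2⟩) (not_le.2 hpos)

include hbpos hzero

/-- The arc returns to its initial tangent circle behind X 0. A positive value would put X b outside
the tangent circles just after 0. Value 0 means X b = ±X 0, excluded by the absence of double points
and by local convexity. -/
theorem inner_tangent_end_neg : inner ℝ (X b) (T 0) < 0 := by
  have hle := fun s hs => h.forward_nonpos_end hb harc (s := s) hs
  by_contra hcon
  rcases (not_lt.1 hcon).eq_or_lt with h0 | h0
  · rcases h.eq_of_inner_eq_zero (h.norm_curve b) hzero h0.symm with h1 | h1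
    · exact h.ne 0 b hbpos (by linarith) h1.symm
    · obtain ⟨ε, hε, hneg⟩ := h.local_neg 0
      obtain ⟨s, h2, h3⟩ := Filter.nonempty_of_mem (inter_mem (Ioo_mem_nhdsGT hbpos)
          (mem_nhdsWithin_of_mem_nhds (Metric.ball_mem_nhds (0 : ℝ) hε)))
      have h4 := hneg s h3 0 (Metric.mem_ball_self hε) h2.1.ne'
      have h5 := hle s ⟨h2.1.le, h2.2⟩
      rw [h1, inner_neg_left] at h5
      linarith
  · obtain ⟨k, hk, hd⟩ := h.hasDerivAt_normal 0 (X b) hzero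
    obtain ⟨s, h1, h2⟩ := ((eventually_pos_of_hasDerivAt hd hzero (mul_pos hk h0)).and
      (Ioo_mem_nhdsGT hbpos)).exists
    exact absurd (hle s ⟨h2.1.le, h2.2⟩) (not_le.2 h1)

/-- At a first failure (s₁, t₁) with s₁ > 0, ⟨X s, N t₁⟩ has a local maximum at s₁, so N t₁ is a
multiple of N s₁, and ⟨X t₁, N t₁⟩ = 0 contradicts `forward_neg`. If s₁ = 0, expanding X b in X 0
and T 0 gives ⟨X b, N t₁⟩ ≥ 0, against `forward_neg_end`. -/
theorem backward_neg {t : ℝ} (ht : t ∈ Ioo 0 b) : inner ℝ (X 0) (N t) < 0 := by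
  by_contra hcon
  obtain ⟨s₁, t₁, h1, h2, h3, h4, h5⟩ := exists_first_zero (φ := fun s t => inner ℝ (X s) (N t))
    ((h.continuous.comp continuous_fst).inner (h.continuous_normal.comp continuous_snd))
    (fun t => by
      obtain ⟨ε, hε, hneg⟩ := h.local_neg t
      exact ⟨ε, hε, fun s hs s' hs' hlt => hneg s' hs' s hs hlt.ne'⟩) le_rfl ht.1 (not_lt.1 hcon)
  have hd := (h.hasDerivAt s₁).inner ℝ (hasDerivAt_const s₁ (N t₁))
  simp only [inner_zero_right, zero_add] at hd
  rcases h1.eq_or_lt with rfl | h1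
  · have h6 : inner ℝ (T 0) (N t₁) ≤ 0 := by
      by_contra hT
      obtain ⟨s, h7, h8⟩ := ((eventually_pos_of_hasDerivAt hd h4 (not_le.1 hT)).and
        (Ioo_mem_nhdsGT h2)).exists
      exact absurd (h5 s ⟨h8.1.le, h8.2⟩) (not_le.2 h7)
    have h7 := h.forward_neg_end hb harc hbL (s := t₁) ⟨h2, by linarith [ht.2]⟩
    rw [h.expand 0 (X b), hzero, zero_smul, add_zero, inner_add_left, inner_smul_left,
      inner_smul_left, h4] at h7
    have h8 := h.inner_tangent_end_neg hb harc hbpos hbL hzero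
    have h9 := mul_nonneg_of_nonpos_of_nonpos h8.le h6
    simp only [conj_trivial, mul_zero, zero_add] at h7
    linarith
  · have hmax : IsLocalMax (fun s => inner ℝ (X s) (N t₁)) s₁ := by
      filter_upwards [Ioo_mem_nhds h1 h2] with s hs
      rw [h4]
      exact h5 s ⟨hs.1.le, hs.2⟩
    have hT := hmax.hasDerivAt_eq_zero hd
    have h6 := h.expand s₁ (N t₁)
    rw [real_inner_comm, h4, real_inner_comm (T s₁), hT, zero_smul, zero_smul, zero_add,
      zero_add] at h6
    have h7 := h.inner_normal t₁
    rw [h6, inner_smul_right] at h7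
    rcases mul_eq_zero.1 h7 with h8 | h8
    · have h9 := h.norm_normal t₁
      rw [h6, h8, zero_smul, norm_zero] at h9
      exact zero_ne_one h9
    · exact absurd h8 (h.forward_neg hb harc h1.le h2 (by linarith [ht.2])).ne

end Arc

/-- By Rolle, equal values produce a critical point t of the ratio. There some nonzero combination
of X t and T t is a multiple of X 0, so the tangent circle at t passes through X 0, which `hback`
forbids. Geometrically, the projected arc has no vertical tangent. -/
theorem injOn_ratio (h : IsConvexFrame X T N L) {b : ℝ}
    (harc : ∀ t ∈ Ioo 0 b, inner ℝ (X t) (N 0) < 0)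
    (hback : ∀ t ∈ Ioo 0 b, inner ℝ (X 0) (N t) < 0) :
    InjOn (fun t => inner ℝ (X t) (T 0) / -inner ℝ (X t) (N 0)) (Ioo 0 b) := by
  have hd : ∀ y t, HasDerivAt (fun s => inner ℝ (X s) y) (inner ℝ (T t) y) t := by
    intro y t
    simpa using (h.hasDerivAt t).inner ℝ (hasDerivAt_const t y)
  have key : ∀ t ∈ Ioo 0 b, inner ℝ (T t) (T 0) * -inner ℝ (X t) (N 0) -
      inner ℝ (X t) (T 0) * -inner ℝ (T t) (N 0) ≠ 0 := by
    intro t ht h0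
    set z := inner ℝ (X t) (N 0) • T t - inner ℝ (T t) (N 0) • X t with hz
    have h1 := h.expand 0 z
    have h2 : inner ℝ z (T 0) = 0 := by
      rw [hz, inner_sub_left, inner_smul_left, inner_smul_left]
      simp only [conj_trivial]
      linarith
    have h3 : inner ℝ z (N 0) = 0 := by
      rw [hz, inner_sub_left, inner_smul_left, inner_smul_left]
      simp only [conj_trivial]
      ring
    rw [h2, h3, zero_smul, zero_smul, add_zero, add_zero] at h1
    have h4 : inner ℝ z (N t) = 0 := by
      rw [hz, inner_sub_left, inner_smul_left, inner_smul_left, h.inner_tangent_normal,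
        h.inner_normal]
      simp
    rw [h1, inner_smul_left] at h4
    rcases mul_eq_zero.1 h4 with h5 | h5
    · rw [conj_trivial] at h5
      rw [h5, zero_smul] at h1
      have h6 : inner ℝ z (T t) = inner ℝ (X t) (N 0) := by
        rw [hz, inner_sub_left, inner_smul_left, inner_smul_left, h.inner_tangent,
          real_inner_self_eq_norm_sq, h.norm_tangent]
        simp
      rw [h1, inner_zero_left] at h6
      exact (harc t ht).ne h6.symm
    · exact (hback t ht).ne h5
  intro s hs t ht hst
  by_contra hne
  wlog hlt : s < t generalizing s t
  · exact this ht hs hst.symm (Ne.symm hne) (lt_of_le_of_ne (not_lt.1 hlt) (Ne.symm hne))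
  have hsub : Icc s t ⊆ Ioo 0 b := fun u hu => ⟨hs.1.trans_le hu.1, hu.2.trans_lt ht.2⟩
  have hder : ∀ u ∈ Icc s t, HasDerivAt
      (fun t => inner ℝ (X t) (T 0) / -inner ℝ (X t) (N 0))
      ((inner ℝ (T u) (T 0) * -inner ℝ (X u) (N 0) -
        inner ℝ (X u) (T 0) * -inner ℝ (T u) (N 0)) / (-inner ℝ (X u) (N 0)) ^ 2) u :=
    fun u hu => (hd _ u).div (hd _ u).neg (neg_pos.2 (harc u (hsub hu))).ne'
  obtain ⟨u, hu, h0⟩ := exists_hasDerivAt_eq_zero hlt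
    (fun u hu => (hder u hu).continuousAt.continuousWithinAt) hst
    (fun u hu => hder u (Ioo_subset_Icc_self hu))
  rcases div_eq_zero_iff.1 h0 with h1 | h1
  · exact key u (hsub (Ioo_subset_Icc_self hu)) h1
  · exact (pow_ne_zero 2 (neg_pos.2 (harc u (hsub (Ioo_subset_Icc_self hu)))).ne') h1

/-- Equal central projections mean positive proportionality, and both points have norm one. -/
theorem eq_of_ratio_eq (h : IsConvexFrame X T N L) {s t : ℝ}
    (hs : inner ℝ (X s) (N 0) < 0) (ht : inner ℝ (X t) (N 0) < 0)
    (h1 : inner ℝ (X s) (T 0) / -inner ℝ (X s) (N 0) = inner ℝ (X t) (T 0) / -inner ℝ (X t) (N 0))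
    (h2 : inner ℝ (X s) (X 0) / -inner ℝ (X s) (N 0) = inner ℝ (X t) (X 0) / -inner ℝ (X t) (N 0)) :
    X s = X t := by
  set m := inner ℝ (X s) (N 0) / inner ℝ (X t) (N 0) with hm
  have hm0 : 0 < m := div_pos_of_neg_of_neg hs ht
  have key : ∀ c c' e e' : ℝ, e < 0 → e' < 0 → c / -e = c' / -e' → c = e / e' * c' := by
    intro c c' e e' he he' h
    rw [div_eq_div_iff (by linarith) (by linarith)] at h
    field_simp [he'.ne]
    linarith
  have h3 : X s = m • X t := by
    rw [h.expand 0 (X s)]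
    conv_rhs => rw [h.expand 0 (X t)]
    rw [smul_add, smul_add, smul_smul, smul_smul, smul_smul, key _ _ _ _ hs ht h1,
      key _ _ _ _ hs ht h2, ← hm]
    congr 2
    rw [hm, div_mul_cancel₀ _ ht.ne]
  have h4 := h.norm_curve s
  rw [h3, norm_smul, h.norm_curve, mul_one, Real.norm_eq_abs, abs_of_pos hm0] at h4
  rw [h3, h4, one_smul]

theorem exists_first_return (h : IsConvexFrame X T N L) {t₀ : ℝ} (ht₀ : 0 < t₀)
    (h0 : inner ℝ (X t₀) (N 0) = 0) :
    ∃ b, 0 < b ∧ b ≤ t₀ ∧ inner ℝ (X b) (N 0) = 0 ∧ ∀ t ∈ Ioo 0 b, inner ℝ (X t) (N 0) < 0 := by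
  obtain ⟨ε, hε, hneg⟩ := h.local_neg 0
  have hc : Continuous fun t => inner ℝ (X t) (N 0) := h.continuous.inner continuous_const
  have hnear : ∀ t, 0 < t → t < ε → inner ℝ (X t) (N 0) < 0 := fun t h1 h2 =>
    hneg 0 (Metric.mem_ball_self hε) t (by simpa [abs_of_pos h1] using h2) h1.ne
  have hεt : ε ≤ t₀ := by
    by_contra hcon
    exact (hnear t₀ ht₀ (not_le.1 hcon)).ne h0
  set S := Icc ε t₀ ∩ {t | inner ℝ (X t) (N 0) = 0} with hS
  have hSc : IsCompact S := isCompact_Icc.inter_right (isClosed_eq hc continuous_const)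
  obtain ⟨b, ⟨hb1, hb2⟩, hmin⟩ := hSc.exists_isMinOn ⟨t₀, ⟨hεt, le_rfl⟩, h0⟩
    continuous_id.continuousOn
  refine ⟨b, hε.trans_le hb1.1, hb1.2, hb2, fun t ht => ?_⟩
  by_contra hcon
  have h1 : ε / 2 ≤ t := by
    by_contra h2
    exact hcon (hnear t ht.1 (by linarith))
  obtain ⟨u, hu, hu0⟩ := isPreconnected_Icc.intermediate_value
    (show ε / 2 ∈ Icc (ε / 2) t from ⟨le_rfl, h1⟩) (show t ∈ Icc (ε / 2) t from ⟨h1, le_rfl⟩)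
    hc.continuousOn
    (show (0 : ℝ) ∈ _ from ⟨(hnear _ (by linarith) (by linarith)).le, not_lt.1 hcon⟩)
  have hu1 : ε ≤ u := by
    by_contra h2
    exact (hnear u (by linarith [hu.1]) (not_le.1 h2)).ne hu0
  have h3 : b ≤ u := hmin ⟨⟨hu1, by linarith [hu.2, ht.2, hb1.2]⟩, hu0⟩
  linarith [hu.2, ht.2]

/-- A closed convex curve without double points lies strictly inside its tangent great circles. -/
theorem inner_neg_zero (h : IsConvexFrame X T N L) {t : ℝ} (ht : t ∈ Ioo 0 L) :
    inner ℝ (X t) (N 0) < 0 := by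
  have hL : inner ℝ (X L) (N 0) = 0 := by
    rw [← zero_add L, h.periodic 0, h.inner_normal]
  obtain ⟨b, hb, hbL, hb0, harc⟩ := h.exists_first_return h.pos hL
  rcases hbL.eq_or_lt with rfl | hbL
  · exact harc t ht
  exfalso
  have h' := h.reverse
  have hret : inner ℝ (X (-(L - b))) (N (-0)) = 0 := by
    have := h.periodic (b - L)
    rw [sub_add_cancel] at this
    rw [neg_sub, neg_zero, ← this, hb0]
  -- By periodicity the backward arc returns no later than time L - b. So b + b' ≤ L, and a common
  -- point of the two open arcs is a genuine double point.
  obtain ⟨b', hb', hbL', hb0', harc'⟩ := h'.exists_first_return (sub_pos.2 hbL) hret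
  have hT := h.inner_tangent_end_neg hbL.le harc hb hbL hb0
  have hT' := h'.inner_tangent_end_neg (by linarith) harc' hb' (by linarith) hb0'
  have hback := fun t ht => h.backward_neg hbL.le harc hb hbL hb0 (t := t) ht
  simp only [neg_zero, inner_neg_right, neg_lt_zero] at hT' hb0' harc'
  have hcc : ∀ y, Continuous fun t => inner ℝ (X t) y := fun y => h.continuous.inner continuous_const
  have hcc' : ∀ y, Continuous fun t => inner ℝ (X (-t)) y := fun y =>
    h'.continuous.inner continuous_const
  have hd : ∀ y, HasDerivAt (fun s => inner ℝ (X s) y) (inner ℝ (T 0) y) 0 := by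
    intro y
    simpa using (h.hasDerivAt 0).inner ℝ (hasDerivAt_const 0 y)
  have hd' : ∀ y, HasDerivAt (fun s => inner ℝ (X (-s)) y) (-inner ℝ (T 0) y) 0 := by
    intro y
    simpa using (h'.hasDerivAt 0).inner ℝ (hasDerivAt_const 0 y)
  have hTT : inner ℝ (T 0) (T 0) = 1 := by
    rw [real_inner_self_eq_norm_sq, h.norm_tangent, one_pow]
  have hXX : inner ℝ (X 0) (X 0) = 1 := by
    rw [real_inner_self_eq_norm_sq, h.norm_curve, one_pow]
  have hr₁ : Tendsto (fun t => inner ℝ (X t) (T 0) / -inner ℝ (X t) (N 0)) (𝓝[>] 0) atTop := by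
    refine tendsto_div_neg_atTop (hd _) ?_ (h.inner_tangent 0) (h.inner_normal 0)
      (by rw [hTT]; exact one_pos) ?_
    · simpa [h.inner_tangent_normal] using hd (N 0)
    · filter_upwards [Ioo_mem_nhdsGT hb] with t ht using harc t ht
  have hr₂ : Tendsto (fun t => inner ℝ (X (-t)) (T 0) / -inner ℝ (X (-t)) (N 0)) (𝓝[>] 0)
      atBot := by
    have h1 : Tendsto (fun t => -inner ℝ (X (-t)) (T 0) / -inner ℝ (X (-t)) (N 0)) (𝓝[>] 0)
        atTop := by
      refine tendsto_div_neg_atTop (hd' _).neg ?_ ?_ ?_ (by rw [hTT]; simp) ?_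
      · simpa [h.inner_tangent_normal] using hd' (N 0)
      · simp [h.inner_tangent]
      · simp [h.inner_normal]
      · filter_upwards [Ioo_mem_nhdsGT hb'] with t ht using harc' t ht
    simpa [neg_div, Function.comp_def] using tendsto_neg_atTop_atBot.comp h1
  -- In the central projection of the hemisphere ⟨·, N 0⟩ < 0, with horizontal axis T 0 and vertical
  -- axis X 0, the forward arc runs from right to left and the backward arc from left to right.
  obtain ⟨t₁, ht₁, t₂, ht₂, h1, h2⟩ := exists_crossing hb hb' (hcc (X 0)) (hcc (T 0)) (hcc (N 0))
    (hcc' (X 0)) (hcc' (T 0)) (hcc' (N 0)) harc harc' (by rw [hXX]; exact one_pos)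
    (h.inner_tangent 0) (by rw [neg_zero, hXX]; exact one_pos)
    (by rw [neg_zero]; exact h.inner_tangent 0) hr₁ hr₂ hb0 hT hb0' hT'
    (h.injOn_ratio harc hback)
  exact h.ne (-t₂) t₁ (by linarith [ht₁.1, ht₂.1]) (by linarith [ht₁.2, ht₂.2])
    (h.eq_of_ratio_eq (harc t₁ ht₁) (harc' t₂ ht₂) h1 h2).symm

theorem inner_neg (h : IsConvexFrame X T N L) {s t : ℝ} (hst : s < t) (ht : t < s + L) :
    inner ℝ (X t) (N s) < 0 := by
  simpa using (h.shift s).inner_neg_zero (t := t - s) ⟨by linarith, by linarith⟩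

end IsConvexFrame

end ConvexCurves

/-! ### The unit tangent field of a curve -/

section TangentField

/-- The cross product in Euclidean three-space. -/
def cross (a b : Ambient 1) : Ambient 1 :=
  WithLp.toLp 2 (![a 1 * b 2 - a 2 * b 1, a 2 * b 0 - a 0 * b 2, a 0 * b 1 - a 1 * b 0] :
    Fin 3 → ℝ)

theorem inner_ambient_one (a b : Ambient 1) :
    inner ℝ a b = a 0 * b 0 + a 1 * b 1 + a 2 * b 2 := by
  have : inner ℝ a b = ∑ i : Fin 3, inner ℝ (a i) (b i) := PiLp.inner_apply _ _
  rw [this, Fin.sum_univ_three]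
  simp only [RCLike.inner_apply, conj_trivial]
  ring

theorem inner_cross (a b c : Ambient 1) : inner ℝ (cross a b) c =
    (a 1 * b 2 - a 2 * b 1) * c 0 + (a 2 * b 0 - a 0 * b 2) * c 1 +
      (a 0 * b 1 - a 1 * b 0) * c 2 := by
  rw [inner_ambient_one]
  rfl

theorem inner_cross_left (a b : Ambient 1) : inner ℝ (cross a b) a = 0 := by
  rw [inner_cross]
  ring

theorem inner_cross_right (a b : Ambient 1) : inner ℝ (cross a b) b = 0 := by
  rw [inner_cross]
  ring

theorem inner_cross_self (a b : Ambient 1) : inner ℝ (cross a b) (cross a b) =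
    inner ℝ a a * inner ℝ b b - inner ℝ a b ^ 2 := by
  rw [inner_cross]
  simp only [inner_ambient_one]
  change (a 1 * b 2 - a 2 * b 1) * (a 1 * b 2 - a 2 * b 1) +
    (a 2 * b 0 - a 0 * b 2) * (a 2 * b 0 - a 0 * b 2) +
    (a 0 * b 1 - a 1 * b 0) * (a 0 * b 1 - a 1 * b 0) = _
  ring

theorem continuous_inner_cross {X : Type*} [TopologicalSpace X] {a b c : X → Ambient 1}
    {p : X} (ha : ContinuousAt a p) (hb : ContinuousAt b p) (hc : ContinuousAt c p) :
    ContinuousAt (fun q => inner ℝ (cross (a q) (b q)) (c q)) p := by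
  simp only [inner_cross]
  have h : ∀ i, Continuous fun y : Ambient 1 => y i := fun i => by fun_prop
  have ha' := fun i => (h i).continuousAt.comp ha
  have hb' := fun i => (h i).continuousAt.comp hb
  have hc' := fun i => (h i).continuousAt.comp hc
  exact (((((ha' 1).mul (hb' 2)).sub ((ha' 2).mul (hb' 1))).mul (hc' 0)).add
    ((((ha' 2).mul (hb' 0)).sub ((ha' 0).mul (hb' 2))).mul (hc' 1))).add
    ((((ha' 0).mul (hb' 1)).sub ((ha' 1).mul (hb' 0))).mul (hc' 2))

/-- The basis vector of the one-dimensional coordinate space. -/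
def coordUnit : Coord 1 := EuclideanSpace.single 0 1

theorem coord_one_eq (V : Coord 1) : V = V 0 • coordUnit := by
  ext i
  fin_cases i
  simp [coordUnit]

theorem exists_smul_coordUnit (V : Coord 1) : ∃ c : ℝ, V = c • coordUnit := ⟨V 0, coord_one_eq V⟩

variable {M₀ : Type*} {x ν : M₀ → Sph 1}

/-- The oriented unit tangent of a curve on the two-sphere. -/
def unitTangent (x ν : M₀ → Sph 1) (p : M₀) : Ambient 1 := cross (ν p) (x p)

theorem inner_unitTangent_curve (p : M₀) :
    inner ℝ (unitTangent x ν p) (x p : Ambient 1) = 0 :=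
  inner_cross_right _ _

theorem inner_unitTangent_normal (p : M₀) :
    inner ℝ (unitTangent x ν p) (ν p : Ambient 1) = 0 :=
  inner_cross_left _ _

variable [TopologicalSpace M₀] [ChartedSpace (EuclideanSpace ℝ (Fin 1)) M₀]

theorem IsConvexNormal.inner_unitTangent_self (hν : IsConvexNormal x ν) (p : M₀) :
    inner ℝ (unitTangent x ν p) (unitTangent x ν p) = 1 := by
  rw [unitTangent, inner_cross_self, inner_self_sph, inner_self_sph, real_inner_comm,
    hν.inner_self]
  norm_num

variable [IsManifold (𝓡 1) 2 M₀]

theorem IsConvexNormal.exists_jac_eq_unitTangent (hν : IsConvexNormal x ν) (hx : IsC2Immersion x)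
    (p : M₀) : ∃ V : Coord 1, jac x p V = unitTangent x ν p := by
  obtain ⟨a, V, h⟩ := hx.exists_tangent_decomposition (hν.unitNormal p)
    (inner_unitTangent_normal (x := x) (ν := ν) p)
  have h1 : inner ℝ (unitTangent x ν p) (x p : Ambient 1) =
      inner ℝ (a • (x p : Ambient 1) + jac x p V) (x p : Ambient 1) := by rw [← h]
  rw [inner_unitTangent_curve, inner_add_left, inner_smul_left, inner_self_sph,
    real_inner_comm (x p : Ambient 1), hx.inner_jac_self] at h1
  have ha : a = 0 := by simpa using h1.symm
  exact ⟨V, by rw [h, ha]; simp⟩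

/-- The unit tangent of the curve in the preferred chart. -/
def tangentCoord (hν : IsConvexNormal x ν) (hx : IsC2Immersion x) (p : M₀) : Coord 1 :=
  (hν.exists_jac_eq_unitTangent hx p).choose

/-- The unit tangent vector field of the curve. -/
def tangentField (hν : IsConvexNormal x ν) (hx : IsC2Immersion x) (p : M₀) :
    TangentSpace (𝓡 1) p :=
  tangentCoord hν hx p

theorem jac_tangentCoord (hν : IsConvexNormal x ν) (hx : IsC2Immersion x) (p : M₀) :
    jac x p (tangentCoord hν hx p) = unitTangent x ν p :=
  (hν.exists_jac_eq_unitTangent hx p).choose_spec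

theorem tangentCoord_ne_zero (hν : IsConvexNormal x ν) (hx : IsC2Immersion x) (p : M₀) :
    tangentCoord hν hx p ≠ 0 := by
  intro h
  have h1 := jac_tangentCoord hν hx p
  have h2 := hν.inner_unitTangent_self p
  rw [← h1, h, map_zero, inner_zero_left] at h2
  exact zero_ne_one h2

theorem IsConvexNormal.expand (hν : IsConvexNormal x ν) (hx : IsC2Immersion x) (p : M₀)
    (y : Ambient 1) : y = inner ℝ y (x p : Ambient 1) • (x p : Ambient 1) +
      inner ℝ y (unitTangent x ν p) • unitTangent x ν p +
      inner ℝ y (ν p : Ambient 1) • (ν p : Ambient 1) := by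
  obtain ⟨a, V, b, h⟩ := hx.exists_decomposition (hν.unitNormal p) y
  obtain ⟨c, hc⟩ : ∃ c : ℝ, jac x p V = c • unitTangent x ν p := by
    have hτ := jac_tangentCoord hν hx p
    obtain ⟨w, hw⟩ := exists_smul_coordUnit (tangentCoord hν hx p)
    obtain ⟨c, hc⟩ := exists_smul_coordUnit V
    have hw0 : w ≠ 0 := by
      rintro rfl
      exact tangentCoord_ne_zero hν hx p (by rw [hw, zero_smul])
    refine ⟨c / w, ?_⟩
    rw [← hτ, ← map_smul, hw, hc, smul_smul, div_mul_cancel₀ _ hw0]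
  rw [hc] at h
  have e1 : inner ℝ (ν p : Ambient 1) (x p : Ambient 1) = 0 := by
    rw [real_inner_comm, hν.inner_self]
  have e2 := inner_unitTangent_curve (x := x) (ν := ν) p
  have e3 := inner_unitTangent_normal (x := x) (ν := ν) p
  have e4 := hν.inner_unitTangent_self p
  have h1 : inner ℝ y (x p : Ambient 1) = a := by
    rw [h]
    simp [inner_add_left, inner_smul_left, e1, e2]
  have h2 : inner ℝ y (unitTangent x ν p) = c := by
    rw [h, inner_add_left, inner_add_left, inner_smul_left, inner_smul_left, inner_smul_left,
      real_inner_comm (unitTangent x ν p) (x p : Ambient 1),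
      real_inner_comm (unitTangent x ν p) (ν p : Ambient 1), e2, e3, e4]
    simp
  have h3 : inner ℝ y (ν p : Ambient 1) = b := by
    rw [h]
    simp [inner_add_left, inner_smul_left, hν.inner_self, e3]
  rw [h1, h2, h3]
  exact h

/-- The unit tangent vector field is continuously differentiable. -/
theorem contMDiff_tangentField (hν : IsConvexNormal x ν) (hx : IsC2Immersion x) :
    haveI : IsManifold (𝓡 1) 1 M₀ := .of_le (n := 2) (by norm_num)
    ContMDiff (𝓡 1) (𝓡 1).tangent 1
      (fun p : M₀ => (⟨p, tangentField hν hx p⟩ : TangentBundle (𝓡 1) M₀)) := by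
  have : IsManifold (𝓡 1) 1 M₀ := .of_le (n := 2) (by norm_num)
  have hc := hν.continuous hx le_rfl
  intro p₀
  refine (Bundle.contMDiffAt_section (F := Coord 1) (E := TangentSpace (𝓡 1)) p₀).2 ?_
  set φ := chartAt (Coord 1) p₀ with hφ
  set A : M₀ → Ambient 1 := fun q => fderiv ℝ (inChart x p₀) (φ q) coordUnit with hA
  set ρ : M₀ → ℝ := fun q => inner ℝ (unitTangent x ν q) (A q) with hρ
  have hAc : ContinuousAt A p₀ := by
    have h1 := (hx.continuousAt_fderiv p₀).comp (continuousAt_chart_center (n := 1) p₀)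
    exact h1.clm_apply continuousAt_const
  have hρc : ContinuousAt ρ p₀ :=
    continuous_inner_cross (continuous_subtype_val.comp hc).continuousAt
      (continuous_subtype_val.comp hx.continuous).continuousAt hAc
  have hspan : ∀ q ∈ φ.source, A q = ρ q • unitTangent x ν q := by
    intro q hq
    have h1 := hν.expand hx q (A q)
    rw [hA, real_inner_comm, hx.inner_fderiv_self hq, real_inner_comm,
      real_inner_comm (ν q : Ambient 1), ((hx.isUnitNormal_iff hq _).1 (hν.unitNormal q)).2,
      zero_smul, zero_smul, zero_add, add_zero] at h1
    exact h1
  have hA0 : ∀ q ∈ φ.source, A q ≠ 0 := by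
    intro q hq h
    have h1 := hx.fderiv_injective hq (a₁ := coordUnit) (a₂ := 0) (by rw [map_zero]; exact h)
    simp [coordUnit] at h1
  have hρ0 : ∀ q ∈ φ.source, ρ q ≠ 0 := by
    intro q hq h
    have := hspan q hq
    rw [h, zero_smul] at this
    exact hA0 q hq this
  have hnorm : ∀ q ∈ φ.source, ‖A q‖ = |ρ q| := by
    intro q hq
    have h1 : ‖unitTangent x ν q‖ = 1 := by
      have := hν.inner_unitTangent_self q
      rw [real_inner_self_eq_norm_sq] at this
      exact (pow_eq_one_iff_of_nonneg (norm_nonneg _) two_ne_zero).1 this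
    rw [hspan q hq, norm_smul, h1, mul_one, Real.norm_eq_abs]
  have hp₀ : p₀ ∈ φ.source := mem_chart_source _ p₀
  -- The coordinate of the field is 1 / ρ, and ρ involves ν, which is only known to be continuous.
  -- But |ρ| = ‖A‖ and the sign of ρ is locally constant, so the coordinate is as smooth as the
  -- first derivative of x.
  obtain ⟨σ, hσ⟩ : ∃ σ : ℝ, ∀ᶠ q in 𝓝 p₀, (ρ q)⁻¹ = σ * ‖A q‖⁻¹ := by
    rcases lt_or_gt_of_ne (hρ0 p₀ hp₀) with h | h
    · refine ⟨-1, ?_⟩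
      filter_upwards [hρc.eventually_lt_const h, chart_source_mem_nhds (n := 1) p₀] with q h1 h2
      rw [hnorm q h2, abs_of_neg h1, inv_neg]
      ring
    · refine ⟨1, ?_⟩
      filter_upwards [hρc.eventually_const_lt h, chart_source_mem_nhds (n := 1) p₀] with q h1 h2
      rw [hnorm q h2, abs_of_pos h1, one_mul]
  have hG : ContDiffAt ℝ 1 (fun u => (σ * ‖fderiv ℝ (inChart x p₀) u coordUnit‖⁻¹) • coordUnit)
      (φ p₀) := by
    have h1 : ContDiffAt ℝ 1 (fun u => fderiv ℝ (inChart x p₀) u coordUnit) (φ p₀) :=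
      ((hx.contDiffAt_center p₀).fderiv_right (m := 1) (by norm_num)).clm_apply contDiffAt_const
    exact (contDiffAt_const.mul ((h1.norm ℝ (hA0 p₀ hp₀)).inv
      (norm_ne_zero_iff.2 (hA0 p₀ hp₀)))).smul contDiffAt_const
  have hcomp : ContMDiffAt (𝓡 1) 𝓘(ℝ, Coord 1) 1
      ((fun u => (σ * ‖fderiv ℝ (inChart x p₀) u coordUnit‖⁻¹) • coordUnit) ∘ φ) p₀ := by
    have h2 := (contMDiffOn_chart (I := 𝓡 1) (n := 1) (x := p₀)).contMDiffAt
      ((chartAt (Coord 1) p₀).open_source.mem_nhds hp₀)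
    exact ContMDiffAt.comp p₀ hG.contMDiffAt h2
  refine hcomp.congr_of_eventuallyEq ?_
  filter_upwards [hσ, chart_source_mem_nhds (n := 1) p₀] with q hq hqs
  obtain ⟨w, hW⟩ := exists_smul_coordUnit (fderiv ℝ (chartChange q p₀) (chartAt (Coord 1) q q)
    (tangentCoord hν hx q))
  have hWeq : (trivializationAt (Coord 1) (TangentSpace (𝓡 1)) p₀
      (⟨q, tangentField hν hx q⟩ : TangentBundle (𝓡 1) M₀)).2 = w • coordUnit := by
    rw [TangentBundle.trivializationAt_apply, ← hW]
    simp only [modelWithCornersSelf_coe, Set.range_id, fderivWithin_univ]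
    rfl
  have h1 := hx.fderiv_inChart q p₀ (mem_chart_source _ q) hqs (tangentCoord hν hx q)
  have h2 := jac_tangentCoord hν hx q
  rw [jac] at h2
  rw [h2, hW, map_smul] at h1
  have h3 : w * ρ q = 1 := by
    rw [hρ, ← inner_smul_right]
    change inner ℝ (unitTangent x ν q) (w • fderiv ℝ (inChart x p₀) (φ q) coordUnit) = 1
    rw [← h1, hν.inner_unitTangent_self]
  change (trivializationAt (Coord 1) (TangentSpace (𝓡 1)) p₀
      (⟨q, tangentField hν hx q⟩ : TangentBundle (𝓡 1) M₀)).2 = (σ * ‖A q‖⁻¹) • coordUnit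
  rw [hWeq, ← hq, eq_inv_of_mul_eq_one_left h3]

end TangentField

/-! ### Compact one-dimensional manifolds as periodic orbits; the case n = 1 -/

section ClosedCurves

open Filter Set

variable {M₀ : Type*} [TopologicalSpace M₀] [ChartedSpace (EuclideanSpace ℝ (Fin 1)) M₀]

section Flow

variable {v : ∀ p : M₀, TangentSpace (𝓡 1) p} {γ : ℝ → M₀} {t : ℝ}

theorem hasDerivAt_chart_of_hasMFDerivAt
    (h : HasMFDerivAt 𝓘(ℝ, ℝ) (𝓡 1) γ t ((1 : ℝ →L[ℝ] ℝ).smulRight (v (γ t)))) :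
    HasDerivAt (fun s => chartAt (Coord 1) (γ t) (γ s)) (v (γ t) : Coord 1) t := by
  have h1 : HasFDerivWithinAt (fun s => chartAt (Coord 1) (γ t) (γ s))
      ((1 : ℝ →L[ℝ] ℝ).smulRight (v (γ t) : Coord 1)) univ t := by
    have h2 := h.2
    simp only [modelWithCornersSelf_coe, range_id] at h2
    exact h2
  obtain ⟨V, hV⟩ : ∃ V : Coord 1, V = v (γ t) := ⟨_, rfl⟩
  have h2 : HasFDerivAt (fun s => chartAt (Coord 1) (γ t) (γ s))
      ((1 : ℝ →L[ℝ] ℝ).smulRight V) t := by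
    rw [hV]
    exact hasFDerivWithinAt_univ.1 h1
  rw [← hV]
  simpa using h2.hasDerivAt

theorem eventually_ne_of_hasMFDerivAt
    (h : HasMFDerivAt 𝓘(ℝ, ℝ) (𝓡 1) γ t ((1 : ℝ →L[ℝ] ℝ).smulRight (v (γ t))))
    (h0 : (v (γ t) : Coord 1) ≠ 0) : ∀ᶠ s in 𝓝[≠] t, γ s ≠ γ t := by
  filter_upwards [(hasDerivAt_chart_of_hasMFDerivAt h).eventually_ne h0
    (c := chartAt (Coord 1) (γ t) (γ t))] with s hs hs'
  exact hs (by rw [hs'])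

/-- A regular curve in a one-dimensional manifold is open. -/
theorem image_mem_nhds_of_hasMFDerivAt
    (h : HasMFDerivAt 𝓘(ℝ, ℝ) (𝓡 1) γ t ((1 : ℝ →L[ℝ] ℝ).smulRight (v (γ t))))
    (h0 : (v (γ t) : Coord 1) ≠ 0) {S : Set ℝ} (hS : S ∈ 𝓝 t) (hc : ContinuousOn γ S) :
    γ '' S ∈ 𝓝 (γ t) := by
  set φ := chartAt (Coord 1) (γ t) with hφ
  obtain ⟨V, hV⟩ : ∃ V : Coord 1, V = v (γ t) := ⟨_, rfl⟩
  have hd : HasDerivAt (fun s => φ (γ s)) V t := hV ▸ hasDerivAt_chart_of_hasMFDerivAt h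
  have hg : HasDerivAt (fun s => φ (γ s) 0) (V 0) t :=
    (hasDerivAt_pi.1 ((PiLp.continuousLinearEquiv 2 ℝ (fun _ : Fin 1 => ℝ)).hasFDerivAt.comp_hasDerivAt
      t hd)) 0
  have hw : V 0 ≠ 0 := by
    intro h
    apply h0
    rw [← hV, coord_one_eq V, h, zero_smul]
    rfl
  obtain ⟨δ, hδ, hball⟩ := Metric.mem_nhds_iff.1 (inter_mem hS
    (h.continuousAt (chart_source_mem_nhds (n := 1) (γ t))))
  set I := Metric.ball t δ with hI
  have hIS : I ⊆ S := fun s hs => (hball hs).1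
  have hIsrc : ∀ s ∈ I, γ s ∈ φ.source := fun s hs => (hball hs).2
  have hgc : ContinuousOn (fun s => φ (γ s) 0) I := by
    have h1 : ContinuousOn (fun s => φ (γ s)) I :=
      φ.continuousOn.comp (hc.mono hIS) hIsrc
    exact (by fun_prop : Continuous fun y : Coord 1 => y 0).comp_continuousOn h1
  obtain ⟨s₁, hs₁, s₂, hs₂, hlt₁, hlt₂⟩ : ∃ s₁ ∈ I, ∃ s₂ ∈ I,
      φ (γ s₁) 0 < φ (γ t) 0 ∧ φ (γ t) 0 < φ (γ s₂) 0 := by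
    have hIm : I ∈ 𝓝 t := Metric.ball_mem_nhds t hδ
    have key : ∀ {g : ℝ → ℝ} {g' : ℝ}, HasDerivAt g g' t → 0 < g' →
        ∃ s₁ ∈ I, ∃ s₂ ∈ I, g s₁ < g t ∧ g t < g s₂ := by
      intro g g' hg hg'
      have h1 := hg.sub_const (g t)
      obtain ⟨s₂, h2, h3⟩ := ((eventually_pos_of_hasDerivAt h1 (sub_self _) hg').and
        (mem_nhdsWithin_of_mem_nhds hIm)).exists
      obtain ⟨s₁, h4, h5⟩ := ((eventually_neg_of_hasDerivAt h1 (sub_self _) hg').and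
        (mem_nhdsWithin_of_mem_nhds hIm)).exists
      exact ⟨s₁, h5, s₂, h3, by linarith, by linarith⟩
    rcases lt_or_gt_of_ne hw with hw | hw
    · obtain ⟨s₁, h1, s₂, h2, h3, h4⟩ := key hg.neg (neg_pos.2 hw)
      exact ⟨s₂, h2, s₁, h1, neg_lt_neg_iff.1 h4, neg_lt_neg_iff.1 h3⟩
    · exact key hg hw
  have hpre : IsPreconnected I := (convex_ball t δ).isPreconnected
  have hcoord : ContinuousAt (fun q => φ q 0) (γ t) :=
    (by fun_prop : Continuous fun y : Coord 1 => y 0).continuousAt.comp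
      (continuousAt_chart_center (n := 1) (γ t))
  filter_upwards [chart_source_mem_nhds (n := 1) (γ t), hcoord.eventually_const_lt hlt₁,
    hcoord.eventually_lt_const hlt₂] with q hq h1 h2
  obtain ⟨s, hs, hsq⟩ := hpre.intermediate_value hs₁ hs₂ hgc
    (show φ q 0 ∈ _ from ⟨h1.le, h2.le⟩)
  refine ⟨s, hIS hs, φ.injOn (hIsrc s hs) hq ?_⟩
  rw [coord_one_eq (φ (γ s)), coord_one_eq (φ q)]
  exact congrArg (· • coordUnit) hsq

variable [T2Space M₀] [CompactSpace M₀]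

/-- In dimension one an integral curve through p sweeps out a neighbourhood of p, and its time
translates are integral curves through all points there, with half the existence time. Compactness
makes the existence time uniform. -/
theorem exists_isMIntegralCurve [IsManifold (𝓡 1) 1 M₀]
    (hv : ContMDiff (𝓡 1) (𝓡 1).tangent 1 (fun p : M₀ => (⟨p, v p⟩ : TangentBundle (𝓡 1) M₀)))
    (h0 : ∀ p, (v p : Coord 1) ≠ 0) (p : M₀) :
    ∃ γ : ℝ → M₀, γ 0 = p ∧ IsMIntegralCurve γ v := by
  obtain ⟨ε, hε, h⟩ : ∃ ε > 0, ∀ p ∈ (univ : Set M₀), ∃ γ : ℝ → M₀, γ 0 = p ∧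
      IsMIntegralCurveOn γ v (Ioo (-ε) ε) := by
    refine isCompact_univ.induction_on (p := fun S => ∃ ε > 0, ∀ p ∈ S, ∃ γ : ℝ → M₀, γ 0 = p ∧
      IsMIntegralCurveOn γ v (Ioo (-ε) ε)) ⟨1, one_pos, by simp⟩ ?_ ?_ ?_
    · rintro S S' hSS' ⟨ε, hε, h⟩
      exact ⟨ε, hε, fun p hp => h p (hSS' hp)⟩
    · rintro S S' ⟨ε, hε, h⟩ ⟨ε', hε', h'⟩
      refine ⟨min ε ε', lt_min hε hε', fun p hp => ?_⟩
      rcases hp with hp | hp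
      · obtain ⟨γ, h1, h2⟩ := h p hp
        exact ⟨γ, h1, h2.mono (Ioo_subset_Ioo (neg_le_neg (min_le_left _ _)) (min_le_left _ _))⟩
      · obtain ⟨γ, h1, h2⟩ := h' p hp
        exact ⟨γ, h1, h2.mono (Ioo_subset_Ioo (neg_le_neg (min_le_right _ _)) (min_le_right _ _))⟩
    · intro p _
      obtain ⟨γ, h1, h2⟩ := exists_isMIntegralCurveAt_of_contMDiffAt_boundaryless 0 (hv p)
      obtain ⟨ε, hε, h3⟩ := isMIntegralCurveAt_iff'.1 h2
      rw [Real.ball_eq_Ioo, zero_sub, zero_add] at h3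
      have h4 : γ '' Ioo (-(ε / 2)) (ε / 2) ∈ 𝓝 p := by
        have := image_mem_nhds_of_hasMFDerivAt (v := v) h2.hasMFDerivAt (h0 _)
          (S := Ioo (-(ε / 2)) (ε / 2)) (Ioo_mem_nhds (by linarith) (by linarith))
          (h3.continuousOn.mono (Ioo_subset_Ioo (by linarith) (by linarith)))
        rwa [h1] at this
      refine ⟨_, mem_nhdsWithin_of_mem_nhds h4, ε / 2, by linarith, ?_⟩
      rintro _ ⟨s, hs, rfl⟩
      refine ⟨γ ∘ (· + s), by simp, (h3.comp_add s).mono fun t ht => ?_⟩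
      change t + s ∈ Ioo (-ε) ε
      exact ⟨by linarith [ht.1, hs.1], by linarith [ht.2, hs.2]⟩
  exact exists_isMIntegralCurve_of_isMIntegralCurveOn hv hε (fun p => h p (mem_univ p)) p

/-- A compact connected one-dimensional manifold with a nowhere vanishing vector field is a single
periodic orbit. -/
theorem exists_periodic_isMIntegralCurve [ConnectedSpace M₀] [IsManifold (𝓡 1) 1 M₀]
    (hv : ContMDiff (𝓡 1) (𝓡 1).tangent 1 (fun p : M₀ => (⟨p, v p⟩ : TangentBundle (𝓡 1) M₀)))
    (h0 : ∀ p, (v p : Coord 1) ≠ 0) :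
    ∃ (γ : ℝ → M₀) (L : ℝ), 0 < L ∧ IsMIntegralCurve γ v ∧ Function.Surjective γ ∧
      Function.Periodic γ L ∧ ∀ s t, s < t → t < s + L → γ s ≠ γ t := by
  obtain ⟨γ, -, hγ⟩ := exists_isMIntegralCurve hv h0 (Classical.arbitrary M₀)
  have hopen : ∀ {γ : ℝ → M₀}, IsMIntegralCurve γ v → ∀ t, ∀ S ∈ 𝓝 t, γ '' S ∈ 𝓝 (γ t) :=
    fun hγ t S hS => image_mem_nhds_of_hasMFDerivAt (hγ t) (h0 _) hS hγ.continuous.continuousOn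
  have hsurj : Function.Surjective γ := by
    rw [← range_eq_univ]
    refine IsClopen.eq_univ ⟨isClosed_of_closure_subset fun z hz => ?_,
      isOpen_iff_mem_nhds.2 ?_⟩ ⟨γ 0, mem_range_self 0⟩
    · obtain ⟨η, hη0, hη⟩ := exists_isMIntegralCurve hv h0 z
      have h1 := hopen hη 0 univ univ_mem
      rw [hη0] at h1
      obtain ⟨_, ⟨s, -, rfl⟩, ⟨t, ht⟩⟩ := mem_closure_iff_nhds.1 hz _ h1
      have h2 := isMIntegralCurve_Ioo_eq_of_contMDiff_boundaryless (t₀ := 0) hv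
        (hη.comp_add s) (hγ.comp_add t) (by simpa using ht.symm)
      refine ⟨-s + t, ?_⟩
      have h3 := congrFun h2 (-s)
      simp only [Function.comp_apply, neg_add_cancel, hη0] at h3
      exact h3.symm
    · rintro _ ⟨t, rfl⟩
      simpa using hopen hγ t univ univ_mem
  -- An injective orbit would be a homeomorphism from ℝ onto the compact space M₀.
  have hnotinj : ¬Function.Injective γ := by
    intro hinj
    have homeo : ℝ ≃ₜ M₀ := (Equiv.ofBijective γ ⟨hinj, hsurj⟩).toHomeomorphOfContinuousOpen
      hγ.continuous (isOpenMap_iff_nhds_le.2 fun t S hS => by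
        have := hopen hγ t _ hS
        exact mem_of_superset this (image_preimage_subset _ _))
    exact not_compactSpace_iff.2 inferInstance homeo.symm.compactSpace
  obtain ⟨T, hT, hTper⟩ : ∃ T > 0, Function.Periodic γ T := by
    rcases hγ.periodic_xor_injective hv with h | h
    · exact h.1
    · exact absurd h.1 hnotinj
  obtain ⟨ε, hε, hne⟩ := Metric.eventually_nhds_iff.1 (eventually_nhdsWithin_iff.1
    (eventually_ne_of_hasMFDerivAt (hγ 0) (h0 _)))
  have hne' : ∀ t, 0 < t → t < ε → γ t ≠ γ 0 := fun t h1 h2 =>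
    hne (by simpa [abs_of_pos h1] using h2) h1.ne'
  have hεT : ε ≤ T := by
    by_contra hcon
    exact hne' T hT (not_le.1 hcon) (by simpa using hTper 0)
  -- There are no returns before time ε, so the least return time exists; it is the minimal period.
  set S := Icc ε T ∩ {t | γ t = γ 0} with hS
  have hSc : IsCompact S := isCompact_Icc.inter_right
    (isClosed_eq hγ.continuous continuous_const)
  obtain ⟨L, ⟨hL1, hL2⟩, hmin⟩ := hSc.exists_isMinOn ⟨T, ⟨hεT, le_rfl⟩, by simpa using hTper 0⟩
    continuous_id.continuousOn
  refine ⟨γ, L, hε.trans_le hL1.1, hγ, hsurj, ?_, fun s t hst ht heq => ?_⟩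
  · simpa using hγ.periodic_of_eq hv hL2
  · have h1 := hγ.periodic_of_eq hv heq.symm 0
    rw [zero_add] at h1
    have h2 : ε ≤ t - s := by
      by_contra hcon
      exact hne' _ (by linarith) (not_le.1 hcon) h1
    have h3 : L ≤ t - s := hmin ⟨⟨h2, by linarith [hL1.2]⟩, h1⟩
    linarith

end Flow

variable {x ν : M₀ → Sph 1} [IsManifold (𝓡 1) 2 M₀] [T2Space M₀] [CompactSpace M₀]
  [ConnectedSpace M₀]

theorem IsConvexNormal.exists_convexFrame (hν : IsConvexNormal x ν) (hx : IsC2Immersion x)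
    (hinj : Function.Injective x) : ∃ (γ : ℝ → M₀) (L : ℝ), Function.Surjective γ ∧
      Function.Periodic γ L ∧ IsConvexFrame (fun t => (x (γ t) : Ambient 1))
        (fun t => unitTangent x ν (γ t)) (fun t => (ν (γ t) : Ambient 1)) L := by
  have : IsManifold (𝓡 1) 1 M₀ := .of_le (n := 2) (by norm_num)
  have hc := hν.continuous hx le_rfl
  obtain ⟨γ, L, hL, hγ, hsurj, hper, hne⟩ := exists_periodic_isMIntegralCurve
    (contMDiff_tangentField hν hx) (tangentCoord_ne_zero hν hx)
  have hd : ∀ t, HasDerivAt (fun s => chartAt (Coord 1) (γ t) (γ s)) (tangentCoord hν hx (γ t)) t :=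
    fun t => hasDerivAt_chart_of_hasMFDerivAt (hγ t)
  have hsrc : ∀ t, ∀ᶠ s in 𝓝 t, γ s ∈ (chartAt (Coord 1) (γ t)).source := fun t =>
    hγ.continuous.continuousAt (chart_source_mem_nhds (n := 1) (γ t))
  refine ⟨γ, L, hsurj, hper, ?_⟩
  exact
    { hasDerivAt := fun t => by
        have h1 := (hx.hasFDerivAt_center (γ t)).comp_hasDerivAt t (hd t)
        rw [jac_tangentCoord] at h1
        refine h1.congr_of_eventuallyEq ?_
        filter_upwards [hsrc t] with s hs
        exact (inChart_apply (γ t) hs).symm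
      continuous_normal := continuous_subtype_val.comp (hc.comp hγ.continuous)
      norm_curve := fun t => norm_sph _
      norm_tangent := fun t => by
        have := hν.inner_unitTangent_self (γ t)
        rw [real_inner_self_eq_norm_sq] at this
        exact (pow_eq_one_iff_of_nonneg (norm_nonneg _) two_ne_zero).1 this
      norm_normal := fun t => norm_sph _
      inner_tangent := fun t => by rw [real_inner_comm, inner_unitTangent_curve]
      inner_normal := fun t => hν.inner_self _
      inner_tangent_normal := fun t => inner_unitTangent_normal _
      expand := fun t => hν.expand hx _
      hasDerivAt_normal := fun t y hy => by
        obtain ⟨a, Y, h⟩ := hx.exists_tangent_decomposition (hν.unitNormal (γ t)) hy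
        obtain ⟨A, hA, hA'⟩ := hν.hasFDerivAt_inner hx hc (γ t) h
        have h1 := hA.comp_hasDerivAt t (hd t)
        set V := tangentCoord hν hx (γ t) with hV
        have hV0 : V ≠ 0 := tangentCoord_ne_zero hν hx (γ t)
        obtain ⟨c, hc⟩ : ∃ c : ℝ, Y = c • V := by
          obtain ⟨w, hw⟩ := exists_smul_coordUnit V
          obtain ⟨c, hc⟩ := exists_smul_coordUnit Y
          have hw0 : w ≠ 0 := by
            rintro rfl
            exact hV0 (by rw [hw, zero_smul])
          exact ⟨c / w, by rw [hw, hc, smul_smul, div_mul_cancel₀ _ hw0]⟩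
        have hyT : inner ℝ y (unitTangent x ν (γ t)) = c := by
          rw [h, hc, map_smul, jac_tangentCoord, inner_add_left, inner_smul_left, inner_smul_left,
            hν.inner_unitTangent_self, real_inner_comm, inner_unitTangent_curve]
          simp
        -- The factor k is the second fundamental form on the unit tangent.
        refine ⟨-inner ℝ (hess x (γ t) V V) (ν (γ t) : Ambient 1),
          neg_pos.2 (hν.hess_neg _ hV0), ?_⟩
        rw [hA', hc, map_smul, inner_smul_left] at h1
        rw [hyT]
        have h2 : -inner ℝ (hess x (γ t) V V) (ν (γ t) : Ambient 1) * c =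
            -((starRingEnd ℝ) c * inner ℝ (hess x (γ t) V V) (ν (γ t) : Ambient 1)) := by
          rw [conj_trivial]
          ring
        rw [h2]
        refine h1.congr_of_eventuallyEq ?_
        filter_upwards [hsrc t] with s hs
        simp only [Function.comp_apply, (chartAt (Coord 1) (γ t)).left_inv hs]
      local_neg := fun t => by
        obtain ⟨U, hU, hneg⟩ := hν.exists_nhds_height_neg hx hc (γ t)
        obtain ⟨ε, hε, hball⟩ := Metric.mem_nhds_iff.1 (hγ.continuous.continuousAt hU)
        -- The bound L / 2 keeps both parameters within one period, so distinct parameters give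
        -- distinct points.
        refine ⟨min ε (L / 2), lt_min hε (by linarith), fun s hs s' hs' hss' => ?_⟩
        have h1 := hball (Metric.ball_subset_ball (min_le_left _ _) hs)
        have h2 := hball (Metric.ball_subset_ball (min_le_left _ _) hs')
        have h3 := Metric.ball_subset_ball (min_le_right ε (L / 2)) hs
        have h4 := Metric.ball_subset_ball (min_le_right ε (L / 2)) hs'
        rw [Real.ball_eq_Ioo] at h3 h4
        refine hneg _ h1 _ h2 ?_
        rcases lt_or_gt_of_ne hss' with hlt | hlt
        · exact hne s s' hlt (by linarith [h3.1, h4.2])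
        · exact (hne s' s hlt (by linarith [h4.1, h3.2])).symm
      periodic := fun t => by simp only [hper t]
      periodic_normal := fun t => by simp only [hper t]
      pos := hL
      ne := fun s t h1 h2 heq => hne s t h1 h2 (hinj (Subtype.ext heq)) }

/-- The tangent great circles of a closed strictly convex curve without double points support the
curve strictly. -/
theorem IsConvexNormal.height_neg_of_injective (hν : IsConvexNormal x ν) (hx : IsC2Immersion x)
    (hinj : Function.Injective x) {p q : M₀} (hpq : p ≠ q) : height x ν p q < 0 := by
  obtain ⟨γ, L, hsurj, hper, hframe⟩ := hν.exists_convexFrame hx hinj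
  obtain ⟨s, rfl⟩ := hsurj p
  obtain ⟨t, rfl⟩ := hsurj q
  obtain ⟨t', ht', heq⟩ := hper.exists_mem_Ico hframe.pos t s
  rw [heq] at hpq ⊢
  have hlt : s < t' := lt_of_le_of_ne ht'.1 fun h => hpq (by rw [h])
  exact hframe.inner_neg hlt ht'.2

end ClosedCurves

/-! ### Convex bodies are determined by their boundary -/

section Bodies

variable {n : ℕ}

theorem continuous_circlePoint {u v : Sph n} (h : inner ℝ (u : Ambient n) (v : Ambient n) = 0) :
    Continuous (circlePoint h) := by
  unfold circlePoint
  fun_prop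

theorem circlePoint_zero {u v : Sph n} (h : inner ℝ (u : Ambient n) (v : Ambient n) = 0) :
    circlePoint h 0 = u := Subtype.ext (by simp [circlePoint])

theorem exists_sph_orthogonal (z : Sph n) :
    ∃ w : Sph n, inner ℝ (z : Ambient n) (w : Ambient n) = 0 := by
  have hz : (z : Ambient n) ≠ 0 := by
    intro h
    have := norm_sph z
    rw [h, norm_zero] at this
    exact zero_ne_one this
  have : Fact (Module.finrank ℝ (Ambient n) = (n + 1) + 1) := ⟨by simp⟩
  have h1 : Module.finrank ℝ (Submodule.span ℝ {(z : Ambient n)})ᗮ = n + 1 :=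
    Submodule.finrank_orthogonal_span_singleton hz
  have : Nontrivial (Submodule.span ℝ {(z : Ambient n)})ᗮ :=
    Module.nontrivial_of_finrank_pos (R := ℝ) (by rw [h1]; omega)
  obtain ⟨⟨w, hw⟩, hw0⟩ := exists_ne (0 : (Submodule.span ℝ {(z : Ambient n)})ᗮ)
  have hw0' : w ≠ 0 := fun h => hw0 (Subtype.ext h)
  refine ⟨⟨‖w‖⁻¹ • w, by simp [norm_smul, hw0']⟩, ?_⟩
  rw [inner_smul_right, Submodule.mem_orthogonal_singleton_iff_inner_right.1 hw, mul_zero]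

theorem exists_mem_frontier_of_path {X : Type*} [TopologicalSpace X] {K : Set X}
    (hK : IsClosed K) {c : ℝ → X} (hc : Continuous c) {b : ℝ} (hb : 0 ≤ b) (h0 : c 0 ∈ K)
    (hcb : c b ∉ K) : ∃ t ∈ Set.Ico 0 b, c t ∈ frontier K := by
  have hS : IsCompact (Set.Icc 0 b ∩ c ⁻¹' K) := isCompact_Icc.inter_right (hK.preimage hc)
  obtain ⟨t, ⟨ht, htK⟩, hmax⟩ := hS.exists_isMaxOn ⟨0, ⟨le_rfl, hb⟩, h0⟩ continuous_id.continuousOn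
  have htb : t < b := lt_of_le_of_ne ht.2 (by
    rintro rfl
    exact hcb htK)
  refine ⟨t, ⟨ht.1, htb⟩, ?_⟩
  rw [hK.frontier_eq]
  refine ⟨htK, fun hint => ?_⟩
  have h1 : c ⁻¹' interior K ∈ 𝓝[>] t :=
    mem_nhdsWithin_of_mem_nhds (hc.continuousAt (isOpen_interior.mem_nhds hint))
  obtain ⟨s, hs, hs'⟩ := Filter.nonempty_of_mem (Filter.inter_mem h1 (Ioo_mem_nhdsGT htb))
  exact absurd (hmax ⟨⟨ht.1.trans hs'.1.le, hs'.2.le⟩, interior_subset (s := K) hs⟩)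
    (not_le.2 hs'.1)

/-- A convex body is the union of the arcs joining its boundary points. -/
theorem IsConvexBody.exists_frontier_combination {K : Set (Sph n)} (hK : IsConvexBody K) {z : Sph n}
    (hz : z ∈ K) : ∃ u ∈ frontier K, ∃ v ∈ frontier K, ∃ a b : ℝ, 0 ≤ a ∧ 0 ≤ b ∧
      (z : Ambient n) = a • (u : Ambient n) + b • (v : Ambient n) := by
  by_cases hzf : z ∈ frontier K
  · exact ⟨z, hzf, z, hzf, 1, 0, zero_le_one, le_rfl, by simp⟩
  obtain ⟨e, he⟩ := hK.hemisphere
  -- A great semicircle from z ends at -z, which is outside the open hemisphere containing K, so it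
  -- leaves K on the way.
  have hexit : ∀ {w : Sph n} (h : inner ℝ (z : Ambient n) (w : Ambient n) = 0),
      ∃ t ∈ Set.Ioo 0 Real.pi, circlePoint h t ∈ frontier K := by
    intro w h
    obtain ⟨t, ht, htK⟩ := exists_mem_frontier_of_path hK.isClosed (continuous_circlePoint h)
      Real.pi_pos.le (by rwa [circlePoint_zero]) (fun hmem => by
        have h1 := he _ hmem
        have h2 := he z hz
        simp only [circlePoint, Real.cos_pi, Real.sin_pi, zero_smul, add_zero, neg_one_smul,
          inner_neg_left] at h1
        linarith)
    refine ⟨t, ⟨lt_of_le_of_ne ht.1 ?_, ht.2⟩, htK⟩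
    rintro rfl
    rw [circlePoint_zero] at htK
    exact hzf htK
  obtain ⟨w, hw⟩ := exists_sph_orthogonal z
  have hw' : inner ℝ (z : Ambient n) ((-w : Sph n) : Ambient n) = 0 := by
    rw [coe_neg_sphere, inner_neg_right, hw, neg_zero]
  obtain ⟨t, ht, htK⟩ := hexit hw
  obtain ⟨s, hs, hsK⟩ := hexit hw'
  have hsin_t := Real.sin_pos_of_pos_of_lt_pi ht.1 ht.2
  have hsin_s := Real.sin_pos_of_pos_of_lt_pi hs.1 hs.2
  have key : Real.sin (t + s) • (z : Ambient n) = Real.sin s • (circlePoint hw t : Ambient n) +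
      Real.sin t • (circlePoint hw' s : Ambient n) := by
    simp only [circlePoint, coe_neg_sphere, Real.sin_add]
    module
  -- Pairing `key` with the pole of the hemisphere gives the sign, so z is a positive combination of
  -- the two exit points.
  have hpos : 0 < Real.sin (t + s) := by
    have h1 := congrArg (fun y => inner ℝ y (e : Ambient n)) key
    simp only [inner_add_left, inner_smul_left, conj_trivial] at h1
    have h2 := mul_pos hsin_s (he _ (hK.isClosed.frontier_subset htK))
    have h3 := mul_pos hsin_t (he _ (hK.isClosed.frontier_subset hsK))
    have h4 := he z hz
    by_contra hcon
    nlinarith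
  refine ⟨_, htK, _, hsK, Real.sin s / Real.sin (t + s), Real.sin t / Real.sin (t + s),
    (div_pos hsin_s hpos).le, (div_pos hsin_t hpos).le, ?_⟩
  rw [div_eq_inv_mul, div_eq_inv_mul, mul_smul, mul_smul, ← smul_add, ← key, smul_smul,
    inv_mul_cancel₀ hpos.ne', one_smul]

theorem IsConvexBody.subset_of_frontier_subset {K K' : Set (Sph n)} (hK : IsConvexBody K)
    (hK' : IsConvexBody K') (h : frontier K ⊆ K') : K ⊆ K' := by
  intro z hz
  obtain ⟨u, hu, v, hv, a, b, ha, hb, hab⟩ := hK.exists_frontier_combination hz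
  exact hK'.geodesic_mem u (h hu) v (h hv) a b ha hb z hab

theorem IsConvexBodyOf.eq {K K' A : Set (Sph n)} (hK : IsConvexBodyOf K A)
    (hK' : IsConvexBodyOf K' A) : K = K' :=
  (hK.1.subset_of_frontier_subset hK'.1 (by
    rw [hK.2, ← hK'.2]
    exact hK'.1.isClosed.frontier_subset)).antisymm
  (hK'.1.subset_of_frontier_subset hK.1 (by
    rw [hK'.2, ← hK.2]
    exact hK.1.isClosed.frontier_subset))

end Bodies

/-! ### Dual pairs of hypersurfaces and their bodies -/

section SupportPair

variable {n : ℕ} {M : Type*} {x ν : M → Sph n}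

/-- The great spheres polar to the points `ν p` support the hypersurface `x` at the points `x p`
only, and every point supported by `ν p` is `x p`. -/
structure IsSupportPair (x ν : M → Sph n) : Prop where
  inner_self : ∀ p, inner ℝ (x p : Ambient n) (ν p : Ambient n) = 0
  inner_neg : ∀ p q, p ≠ q → inner ℝ (x q : Ambient n) (ν p : Ambient n) < 0
  eq_of_inner_eq_zero : ∀ (y : Sph n) (p : M),
    (∀ q, inner ℝ (y : Ambient n) (ν q : Ambient n) ≤ 0) →
    inner ℝ (y : Ambient n) (ν p : Ambient n) = 0 → y = x p

/-- The body bounded by the polar great spheres of the points `ν p`. -/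
def supportBody (ν : M → Sph n) : Set (Sph n) :=
  {y | ∀ p, inner ℝ (y : Ambient n) (ν p : Ambient n) ≤ 0}

namespace IsSupportPair

theorem inner_nonpos (h : IsSupportPair x ν) (p q : M) :
    inner ℝ (x q : Ambient n) (ν p : Ambient n) ≤ 0 := by
  by_cases hpq : p = q
  · rw [hpq, h.inner_self]
  · exact (h.inner_neg p q hpq).le

theorem mem_supportBody (h : IsSupportPair x ν) (p : M) : x p ∈ supportBody ν :=
  fun q => h.inner_nonpos q p

variable [TopologicalSpace M] [CompactSpace M]

/-- By compactness the supremum 0 is attained at some x p, and the dual pair then identifies y with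
ν p. -/
theorem polarSet_range_eq [Nonempty M] (h : IsSupportPair x ν) (h' : IsSupportPair ν x)
    (hx : Continuous x) : polarSet (Set.range x) = Set.range ν := by
  apply Set.Subset.antisymm
  · intro y hy
    have hy1 : IsLUB ((fun z : Sph n => inner ℝ (z : Ambient n) (y : Ambient n)) '' Set.range x) 0 :=
      hy
    have hcont : Continuous fun z : Sph n => inner ℝ (z : Ambient n) (y : Ambient n) :=
      continuous_subtype_val.inner continuous_const
    obtain ⟨_, ⟨p, rfl⟩, hp⟩ := hy1.mem_of_isClosed ((Set.range_nonempty x).image _)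
      ((isCompact_range hx).image hcont).isClosed
    refine ⟨p, (h'.eq_of_inner_eq_zero y p (fun q => ?_) ?_).symm⟩
    · rw [real_inner_comm]
      exact hy1.1 ⟨_, ⟨q, rfl⟩, rfl⟩
    · rw [real_inner_comm]
      exact hp
  · rintro _ ⟨p, rfl⟩
    refine IsGreatest.isLUB ⟨⟨x p, ⟨p, rfl⟩, h.inner_self p⟩, ?_⟩
    rintro _ ⟨_, ⟨q, rfl⟩, rfl⟩
    exact h.inner_nonpos p q
variable [Nontrivial M]

/-- By compactness of M, points with all inequalities strict are interior, and a point with some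
equality is x p. Two distinct points p₁, p₂ provide the rest: x p₁ + x p₂ normalised is interior,
and -(ν p₁ + ν p₂) normalised is the pole of a hemisphere, since a point of the body orthogonal to
both normals would equal both x p₁ and x p₂. -/
theorem isConvexBodyOf (h : IsSupportPair x ν) (hν : Continuous ν) :
    IsConvexBodyOf (supportBody ν) (Set.range x) := by
  obtain ⟨p₁, p₂, hne⟩ := exists_pair_ne M
  have hclosed : IsClosed (supportBody ν) := by
    have : supportBody ν = ⋂ p, {y : Sph n | inner ℝ (y : Ambient n) (ν p : Ambient n) ≤ 0} := by
      ext y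
      rw [Set.mem_iInter]
      rfl
    rw [this]
    exact isClosed_iInter fun p =>
      isClosed_le (continuous_subtype_val.inner continuous_const) continuous_const
  have hopen : ∀ y : Sph n, (∀ p, inner ℝ (y : Ambient n) (ν p : Ambient n) < 0) →
      y ∈ interior (supportBody ν) := by
    intro y hy
    rw [mem_interior_iff_mem_nhds]
    have hc : Continuous fun z : Sph n × M => inner ℝ (z.1 : Ambient n) (ν z.2 : Ambient n) :=
      (continuous_subtype_val.comp continuous_fst).inner
        (continuous_subtype_val.comp (hν.comp continuous_snd))
    have h1 := isCompact_univ.eventually_forall_of_forall_eventually (x₀ := y)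
      (K := (Set.univ : Set M)) (P := fun y p => inner ℝ (y : Ambient n) (ν p : Ambient n) < 0)
      (fun p _ => hc.continuousAt.eventually_lt_const (hy p))
    filter_upwards [h1] with z hz p
    exact (hz p (Set.mem_univ p)).le
  have hsum : ∀ p, inner ℝ ((x p₁ : Ambient n) + x p₂) (ν p : Ambient n) < 0 := by
    intro p
    rw [inner_add_left]
    have h1 := h.inner_nonpos p p₁
    have h2 := h.inner_nonpos p p₂
    by_cases hp : p = p₁
    · have := h.inner_neg p p₂ (by rw [hp]; exact hne)
      linarith
    · have := h.inner_neg p p₁ hp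
      linarith
  have hsum0 : (x p₁ : Ambient n) + x p₂ ≠ 0 := by
    intro h0
    have := hsum p₁
    rw [h0, inner_zero_left] at this
    exact lt_irrefl _ this
  have hnu0 : (ν p₁ : Ambient n) + ν p₂ ≠ 0 := by
    intro h0
    have h1 := hsum p₁
    have h2 := hsum p₂
    have h3 : inner ℝ ((x p₁ : Ambient n) + x p₂) ((ν p₁ : Ambient n) + ν p₂) = 0 := by
      rw [h0, inner_zero_right]
    rw [inner_add_right] at h3
    linarith
  refine ⟨⟨hclosed, ?_, ?_, ?_⟩, ?_⟩
  · refine ⟨⟨‖(x p₁ : Ambient n) + x p₂‖⁻¹ • ((x p₁ : Ambient n) + x p₂),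
      by
        rw [mem_sphere_zero_iff_norm, norm_smul, norm_inv, norm_norm,
          inv_mul_cancel₀ (norm_ne_zero_iff.2 hsum0)]⟩, hopen _ fun p => ?_⟩
    rw [inner_smul_left]
    exact mul_neg_of_pos_of_neg (inv_pos.2 (norm_pos_iff.2 hsum0)) (hsum p)
  · refine ⟨⟨-(‖(ν p₁ : Ambient n) + ν p₂‖⁻¹ • ((ν p₁ : Ambient n) + ν p₂)),
      by
        rw [mem_sphere_zero_iff_norm, norm_neg, norm_smul, norm_inv, norm_norm,
          inv_mul_cancel₀ (norm_ne_zero_iff.2 hnu0)]⟩, fun y hy => ?_⟩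
    rw [inner_neg_right, inner_smul_right, ← mul_neg]
    refine mul_pos (inv_pos.2 (norm_pos_iff.2 hnu0)) (neg_pos.2 ?_)
    rw [inner_add_right]
    have h1 := hy p₁
    have h2 := hy p₂
    by_contra hcon
    have e1 := h.eq_of_inner_eq_zero y p₁ hy (by linarith)
    have e2 := h.eq_of_inner_eq_zero y p₂ hy (by linarith)
    have h3 := h.inner_neg p₁ p₂ hne
    rw [← e2, e1, h.inner_self] at h3
    exact lt_irrefl _ h3
  · intro u hu v hv a b ha hb w hw p
    rw [hw, inner_add_left, inner_smul_left, inner_smul_left]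
    exact add_nonpos (mul_nonpos_of_nonneg_of_nonpos ha (hu p))
      (mul_nonpos_of_nonneg_of_nonpos hb (hv p))
  · rw [hclosed.frontier_eq]
    apply Set.Subset.antisymm
    · rintro y ⟨hy, hy'⟩
      obtain ⟨p, hp⟩ : ∃ p, inner ℝ (y : Ambient n) (ν p : Ambient n) = 0 := by
        by_contra! hcon
        exact hy' (hopen y fun p => lt_of_le_of_ne (hy p) (hcon p))
      exact ⟨p, (h.eq_of_inner_eq_zero y p hy hp).symm⟩
    · rintro _ ⟨p, rfl⟩
      refine ⟨h.mem_supportBody p, fun hint => ?_⟩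
      have h1 := (continuous_circlePoint (h.inner_self p)).tendsto 0
      rw [circlePoint_zero] at h1
      obtain ⟨t, ht, ht'⟩ := Filter.nonempty_of_mem (Filter.inter_mem
        (mem_nhdsWithin_of_mem_nhds (h1 (mem_interior_iff_mem_nhds.1 hint)))
        (Ioo_mem_nhdsGT Real.pi_pos))
      have h2 : inner ℝ (circlePoint (h.inner_self p) t : Ambient n) (ν p : Ambient n) ≤ 0 := ht p
      rw [circlePoint, inner_add_left, inner_smul_left, inner_smul_left, h.inner_self,
        inner_self_sph] at h2
      have h3 := Real.sin_pos_of_pos_of_lt_pi ht'.1 ht'.2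
      simp only [conj_trivial] at h2
      linarith

theorem isConvexBodyOf_iff (h : IsSupportPair x ν) (hν : Continuous ν) (K : Set (Sph n)) :
    IsConvexBodyOf K (Set.range x) ↔ K = supportBody ν :=
  ⟨fun hK => hK.eq (h.isConvexBodyOf hν), fun hK => hK ▸ h.isConvexBodyOf hν⟩

/-- Nonpositivity on the boundary points x p passes to their nonnegative combinations, which exhaust
the body. -/
theorem polarBody_eq (h : IsSupportPair x ν) (hν : Continuous ν) :
    polarBody (supportBody ν) = supportBody x := by
  apply Set.Subset.antisymm
  · intro y hy p
    rw [real_inner_comm]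
    exact hy _ (h.mem_supportBody p)
  · intro y hy z hz
    obtain ⟨hK, hfr⟩ := h.isConvexBodyOf hν
    obtain ⟨u, hu, v, hv, a, b, ha, hb, hab⟩ := hK.exists_frontier_combination hz
    rw [hfr] at hu hv
    obtain ⟨p, rfl⟩ := hu
    obtain ⟨q, rfl⟩ := hv
    rw [hab, inner_add_left, inner_smul_left, inner_smul_left, real_inner_comm,
      real_inner_comm (y : Ambient n)]
    exact add_nonpos (mul_nonpos_of_nonneg_of_nonpos ha (hy p))
      (mul_nonpos_of_nonneg_of_nonpos hb (hy q))

end IsSupportPair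

end SupportPair

/-! ### The hypersurface and its Gauss map as a dual pair -/

section Hypersurface

variable {n : ℕ} {M₀ : Type*} [TopologicalSpace M₀]
  [ChartedSpace (EuclideanSpace ℝ (Fin n)) M₀]

theorem nontrivial_of_chartedSpace [Nonempty M₀] (hn : 1 ≤ n) : Nontrivial M₀ := by
  obtain ⟨p⟩ := ‹Nonempty M₀›
  obtain ⟨v, hv⟩ : ∃ v : Coord n, v ≠ 0 :=
    ⟨EuclideanSpace.single (⟨0, hn⟩ : Fin n) (1 : ℝ), by simp⟩
  obtain ⟨s, hs⟩ := (eventually_chartRay_ne p hv).exists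
  exact ⟨_, _, hs⟩

variable {x ν : M₀ → Sph n} [IsManifold (𝓡 n) 2 M₀]

theorem IsConvexNormal.isSupportPair (hν : IsConvexNormal x ν) (hx : IsC2Immersion x)
    (hc : Continuous ν) (hn : 1 ≤ n) (h : ∀ p q, p ≠ q → height x ν p q < 0) :
    IsSupportPair x ν where
  inner_self := hν.inner_self
  inner_neg := h
  eq_of_inner_eq_zero y p hy hp := by
    by_contra hne
    obtain ⟨q, -, hq⟩ := hν.exists_inner_pos hx hc hn hp hne Filter.univ_mem
    exact absurd (hy q) (not_le.2 hq)

/-- A point y touching x at p makes p a maximum of ⟨y, x⟩, so y = ±ν p, and any second point of M₀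
excludes the minus sign. Thus ν is never treated as an immersion itself. -/
theorem IsConvexNormal.isSupportPair_dual [Nontrivial M₀] (hν : IsConvexNormal x ν)
    (hx : IsC2Immersion x) (h : ∀ p q, p ≠ q → height x ν p q < 0) :
    IsSupportPair ν x where
  inner_self p := (hν.unitNormal p).1
  inner_neg p q hpq := by
    rw [real_inner_comm]
    exact h q p hpq.symm
  eq_of_inner_eq_zero y p hy hp := by
    have hunit : IsUnitNormal x p y := by
      refine hx.isUnitNormal_of_forall_nonpos (by rw [real_inner_comm, hp]) fun V => ?_
      by_contra hcon
      obtain ⟨s, hs⟩ := (eventually_lt_chartRay (V := V)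
        (g := fun z => inner ℝ (y : Ambient n) (x z : Ambient n)) (hx.hasFDerivAt_inner p y)
        (not_le.1 hcon)).exists
      rw [hp] at hs
      exact absurd (hy _) (not_le.2 hs)
    rcases hx.unitNormal_eq_or_neg (hν.unitNormal p) hunit with h1 | h1
    · exact Subtype.ext h1
    · obtain ⟨q, hq⟩ := exists_ne p
      have h2 := h p q hq.symm
      have h3 := hy q
      rw [h1, inner_neg_left, real_inner_comm] at h3
      rw [height] at h2
      linarith

/-- Only the candidate -ν p has to be excluded: the geodesic from x p in this direction stays in the
body for small t. Uniformity over the normals ν q follows from compactness, using ⟨ν p, ν q⟩ > 0 for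
q near p and the strict inequality ⟨x p, ν q⟩ < 0 elsewhere. -/
theorem IsConvexNormal.isGaussMap_iff [CompactSpace M₀] (hν : IsConvexNormal x ν)
    (hx : IsC2Immersion x) (hc : Continuous ν) (h : IsSupportPair x ν) (μ : M₀ → Sph n) :
    IsGaussMap x (supportBody ν) μ ↔ μ = ν := by
  constructor
  · intro hμ
    funext p
    obtain ⟨h1, h2⟩ := hμ p
    rcases hx.unitNormal_eq_or_neg (hν.unitNormal p) h1 with h3 | h3
    · exact Subtype.ext h3
    exfalso
    have h4 : inner ℝ (x p : Ambient n) (μ p : Ambient n) = 0 := by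
      rw [h3, inner_neg_right, h.inner_self, neg_zero]
    have hcont : Continuous fun z : ℝ × M₀ =>
        inner ℝ (circlePoint h4 z.1 : Ambient n) (ν z.2 : Ambient n) :=
      (continuous_subtype_val.comp ((continuous_circlePoint h4).comp continuous_fst)).inner
        (continuous_subtype_val.comp (hc.comp continuous_snd))
    have h5 := isCompact_univ.eventually_forall_of_forall_eventually (x₀ := (0 : ℝ))
      (K := (Set.univ : Set M₀)) (P := fun t q => t ∈ Set.Ioo 0 (Real.pi / 2) →
        inner ℝ (circlePoint h4 t : Ambient n) (ν q : Ambient n) ≤ 0) (fun q _ => by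
        by_cases hqp : q = p
        · subst hqp
          have h6 : Continuous fun z : ℝ × M₀ => inner ℝ (ν q : Ambient n) (ν z.2 : Ambient n) :=
            continuous_const.inner (continuous_subtype_val.comp (hc.comp continuous_snd))
          have h7 := h6.continuousAt (x := ((0 : ℝ), q)) |>.eventually_const_lt (u := 0)
            (by
              change (0 : ℝ) < inner ℝ (ν q : Ambient n) (ν q : Ambient n)
              rw [inner_self_sph]
              exact one_pos)
          filter_upwards [h7] with z hz ht
          have h8 := h.inner_nonpos z.2 q
          have h9 := Real.cos_pos_of_mem_Ioo ⟨by linarith [ht.1, Real.pi_pos], ht.2⟩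
          have h10 := Real.sin_pos_of_pos_of_lt_pi ht.1 (by linarith [ht.2, Real.pi_pos])
          rw [circlePoint, inner_add_left, inner_smul_left, inner_smul_left, h3, inner_neg_left]
          simp only [conj_trivial]
          nlinarith
        · have h6 := (hcont.continuousAt (x := ((0 : ℝ), q))).eventually_lt_const (u := 0)
            (by
              change inner ℝ (circlePoint h4 0 : Ambient n) (ν q : Ambient n) < 0
              rw [circlePoint_zero]
              exact h.inner_neg q p hqp)
          filter_upwards [h6] with z hz _
          exact hz.le)
    obtain ⟨t, ht1, ht2, ht3⟩ := (h2.and ((h5.filter_mono nhdsWithin_le_nhds).and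
      (Ioo_mem_nhdsGT (show (0 : ℝ) < Real.pi / 2 by linarith [Real.pi_pos])))).exists
    exact ht1 ⟨circlePoint h4 t, fun q => ht2 q (Set.mem_univ q) ht3, rfl⟩
  · rintro rfl p
    refine ⟨hν.unitNormal p, ?_⟩
    filter_upwards [Ioo_mem_nhdsGT Real.pi_pos] with t ht
    rintro ⟨y, hy, hyt⟩
    have h1 := hy p
    have h2 := Real.sin_pos_of_pos_of_lt_pi ht.1 ht.2
    simp only [] at hyt
    rw [hyt, inner_add_left, inner_smul_left, inner_smul_left, h.inner_self,
      inner_self_sph] at h1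
    simp only [conj_trivial] at h1
    linarith

end Hypersurface

end SphereGeom

end

theorem theorem2p8 (n : ℕ) (hn : 1 ≤ n) {M₀ : Type*} [TopologicalSpace M₀] [T2Space M₀]
    [CompactSpace M₀] [ConnectedSpace M₀] [ChartedSpace (EuclideanSpace ℝ (Fin n)) M₀]
    [IsManifold (𝓡 n) 2 M₀] (x : M₀ → SphereGeom.Sph n)
    (himm : SphereGeom.IsC2Immersion x) (hconv : SphereGeom.IsStrictlyConvex x)
    (hinj : n = 1 → Function.Injective x) :
    ∃ (Mhat : Set (SphereGeom.Sph n)) (xt : M₀ → SphereGeom.Sph n)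
      (Mthat : Set (SphereGeom.Sph n)),
      (∀ K, SphereGeom.IsConvexBodyOf K (Set.range x) ↔ K = Mhat) ∧
      (∀ ν, SphereGeom.IsGaussMap x Mhat ν ↔ ν = xt) ∧
      (∀ K, SphereGeom.IsConvexBodyOf K (Set.range xt) ↔ K = Mthat) ∧
      SphereGeom.polarSet (Set.range x) = Set.range xt ∧
      SphereGeom.polarBody Mhat = Mthat := by
  obtain ⟨ν, hν⟩ := hconv.exists_convexNormal
  have hc := hν.continuous himm hn
  have hneg : ∀ p q, p ≠ q → SphereGeom.height x ν p q < 0 := by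
    intro p q hpq
    rcases hn.eq_or_lt with h1 | h2
    · subst h1
      exact hν.height_neg_of_injective himm (hinj rfl) hpq
    · exact hν.height_neg himm hc h2 hpq
  have : Nontrivial M₀ := SphereGeom.nontrivial_of_chartedSpace hn
  have h1 := hν.isSupportPair himm hc hn hneg
  have h2 := hν.isSupportPair_dual himm hneg
  exact ⟨SphereGeom.supportBody ν, ν, SphereGeom.supportBody x, h1.isConvexBodyOf_iff hc,
    hν.isGaussMap_iff himm hc h1, h2.isConvexBodyOf_iff himm.continuous,
    h1.polarSet_range_eq h2 himm.continuous, h1.polarBody_eq hc⟩
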